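/- Let $\beta, c, c_1 > 0$ and $B$ be real numbers and put $\gamma = 1 + c\beta/(c+\beta)$. There is a constant $C > 0$, depending only on $\beta, c, c_1, B$, with the following property. Let $g$ be a complex-valued multiplicative function with $|g(p)| \le \beta$ on the primes $p$, for which the series $$\sum_{q} |g(q)|\, q^{-1} (\log q)^{\gamma},$$ taken over the prime powers $q = p^k$ with $k \ge 2$, converges with sum at most $B$. Let $3/2 \le Y \le x$ be real numbers such that $$\sum_{w < p \le x} \frac{|g(p)| - c}{p} \ge -c_1 \qquad \text{for all real } w \text{ with } Y \le w \le x,$$ the sum being over primes $p$. Then for every real $T > 0$, with $$\lambda = \min_{|t| \le T}\ \sum_{Y < p \le x} \frac{|g(p)| - \operatorname{Re}\left(g(p)\, p^{it}\right)}{p},$$ we have $$\left|\sum_{n \le x} g(n)\right| \le C\, \frac{x}{\log x} \prod_{p \le x}\left(1 + \frac{|g(p)|}{p}\right) \left( \exp\left(-\frac{\lambda c}{c+\beta}\right) + T^{-1/2} \right).$$ -/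

import Mathlib

/-- The (finite) set of primes `p` with `w < p ≤ x`, for real `w ≥ 0` and `x`. -/
noncomputable def primesIoc (w x : ℝ) : Finset ℕ :=
  (Finset.Ioc ⌊w⌋₊ ⌊x⌋₊).filter Nat.Prime

theorem mem_primesIoc {w x : ℝ} (hw : 0 ≤ w) {p : ℕ} :
    p ∈ primesIoc w x ↔ p.Prime ∧ w < p ∧ (p : ℝ) ≤ x := by
  unfold primesIoc
  rw [Finset.mem_filter, Finset.mem_Ioc, Nat.floor_lt hw]
  constructor
  · rintro ⟨⟨h1, h2⟩, h3⟩
    exact ⟨h3, h1, (Nat.le_floor_iff' h3.ne_zero).1 h2⟩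
  · rintro ⟨h3, h1, h2⟩
    exact ⟨⟨h1, (Nat.le_floor_iff' h3.ne_zero).2 h2⟩, h3⟩

/-- The higher prime powers: the integers `q = p ^ k` with `p` prime and `k ≥ 2`. -/
def higherPrimePowers : Set ℕ :=
  {q | ∃ p k : ℕ, p.Prime ∧ 2 ≤ k ∧ q = p ^ k}

/-- The sum `∑_{Y < p ≤ x} (|g(p)| - Re g(p) p^{it}) / p` over primes. -/
noncomputable def pretentiousSum (g : ℕ → ℂ) (Y x t : ℝ) : ℝ :=
  ∑ p ∈ primesIoc Y x,
    (‖g p‖ - (g p * (p : ℂ) ^ ((t : ℂ) * Complex.I)).re) / (p : ℝ)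

/-- The quantity `λ = min_{|t| ≤ T} ∑_{Y < p ≤ x} (|g(p)| - Re g(p) p^{it}) / p`.
The infimum is attained for `T ≥ 0`, see `isLeast_pretentiousMin`. -/
noncomputable def pretentiousMin (g : ℕ → ℂ) (Y x T : ℝ) : ℝ :=
  sInf (pretentiousSum g Y x '' {t : ℝ | |t| ≤ T})

theorem continuous_pretentiousSum (g : ℕ → ℂ) (Y x : ℝ) :
    Continuous (pretentiousSum g Y x) := by
  unfold pretentiousSum
  refine continuous_finsetSum _ fun p hp => ?_
  have hp0 : (p : ℂ) ≠ 0 := by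
    exact_mod_cast (Finset.mem_filter.1 hp).2.ne_zero
  refine Continuous.div_const (continuous_const.sub (Complex.continuous_re.comp
    (continuous_const.mul ?_))) _
  exact (Complex.continuous_ofReal.mul continuous_const).const_cpow (Or.inl hp0)

theorem isLeast_pretentiousMin (g : ℕ → ℂ) (Y x : ℝ) {T : ℝ} (hT : 0 ≤ T) :
    IsLeast (pretentiousSum g Y x '' {t : ℝ | |t| ≤ T}) (pretentiousMin g Y x T) := by
  have hs : {t : ℝ | |t| ≤ T} = Set.Icc (-T) T := by
    ext t
    rw [Set.mem_ofPred_eq, Set.mem_Icc, abs_le]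
  have hc : IsCompact (pretentiousSum g Y x '' {t : ℝ | |t| ≤ T}) := by
    rw [hs]; exact isCompact_Icc.image (continuous_pretentiousSum g Y x)
  exact hc.isLeast_sInf ⟨_, 0, by simpa using hT, rfl⟩

/-! Let f be the multiplicative function with f(p^k) = g(p)^k / k! (`expMul g`). Its Dirichlet
series is exp(∑ g(p) p^{-s}), so its logarithmic derivative involves primes alone: f log is the
convolution of f with g log on the primes. Nearly all the work is done for f. At the end g = h * f,
where h vanishes at the primes, and the hypothesis on higher prime powers bounds ∑ |h(d)| (1 + log
d)^γ / d through an Euler product.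

Write S(u) = ∑_{n ≤ u} f(n), N(u) = ∑_{n ≤ u} f(n) log n, L = log x and M(w) = ∑_{w < p ≤ x}
|g(p)|/p. The first goal is a bound for the logarithmic mean I = ∫_{1/2}^x |S(w)| w^{-2} dw. Partial
summation and a Hardy-type inequality reduce it to a trivial contribution from w ≤ U and to ∫_U^x
|N(w)| / (w² log w) dw. On a block (log X)/e < log w ≤ log X, Plancherel on the line Re s = 1 +
1/log X turns the mean square of N into that of G(s) Q(s)/s, with G the Dirichlet series of f and Q
= ∑ g(p) log p · p^{-s}. On every interval of unit length Q has mean square O(log X), because primes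
interact only with primes of comparable size. Pointwise, up to constants, |G| is at most exp(M(0) -
λ + M(X)) for |t| ≤ T and at most exp(M(0) - M(X)) for all t.

For log X_k = e^{-k} L one has ck - O(1) ≤ M(X_k) ≤ βk + O(1), so the k-th block contributes
exp(M(0)) times e^{-λ+βk} + T^{-1/2} e^{-ck}. Both series are geometric. Stopping at k = v =
λ/(c+β), that is at log U = e^{-v} L, makes the first one e^{-λ+βv} = e^{-λc/(c+β)}, which is also
the saving e^{-cv} in the trivial part below U. This balance is the source of the exponent.

The pointwise bound comes from a bootstrap on S(u) log u, through N(u) = ∑_{p ≤ u} g(p) log p ·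
S(u/p). For p > P, Brun–Titchmarsh allows S(u/p) to be replaced by averages over intervals of
relative length η, which yields u I + η u exp(M(0)). For p ≤ P an assumed bound |S(v)| ≤ A v (1 +
log(x/v))^γ is inserted; with P a power of L this costs A times a power of log L, which is o(L). If
log u ≥ L/2, division by log u returns at most A/2. For smaller u the weight, with γ = 1 + θ and θ =
cβ/(c+β), makes the elementary bound sufficient, because λ ≤ β log(log x/log Y) + O(1) gives
e^{-λc/(c+β)} ≫ L^{-θ}. At u = x/d the same weight becomes (1 + log d)^γ, whence the power of the
logarithm in the hypothesis on g. When T < 1 or log x/log Y is bounded, the bracket in the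
conclusion is bounded below and elementary estimates suffice. -/

/-! ### Chebyshev and Mertens estimates for sums over primes. -/

open Finset in
theorem sum_log_primesIoc_zero_le {t : ℝ} (ht : 0 ≤ t) :
    ∑ p ∈ primesIoc 0 t, Real.log p ≤ 2 * t := by
  have h := Chebyshev.theta_le_log4_mul_x ht
  have h4 : Real.log 4 ≤ 2 := by
    rw [show (4 : ℝ) = 2 ^ 2 by norm_num, Real.log_pow]
    have := Real.log_two_lt_d9
    push_cast; linarith
  have : ∑ p ∈ primesIoc 0 t, Real.log p = Chebyshev.theta t := by
    simp [primesIoc, Chebyshev.theta]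
  rw [this]
  nlinarith

theorem prime_of_mem_primesIoc {w x : ℝ} {p : ℕ} (h : p ∈ primesIoc w x) : p.Prime :=
  (Finset.mem_filter.1 h).2

theorem primesIoc_subset {w w' x x' : ℝ} (hw : w' ≤ w) (hx : x ≤ x') :
    primesIoc w x ⊆ primesIoc w' x' := by
  intro p hp
  simp only [primesIoc, Finset.mem_filter, Finset.mem_Ioc] at hp ⊢
  exact ⟨⟨(Nat.floor_le_floor hw).trans_lt hp.1.1, hp.1.2.trans (Nat.floor_le_floor hx)⟩, hp.2⟩

/-- Splitting a sum over primes in `(w, x]` at an intermediate point. -/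
theorem sum_primesIoc_add {M : Type*} [AddCommMonoid M] {w v x : ℝ} (hwv : w ≤ v) (hvx : v ≤ x)
    (φ : ℕ → M) :
    ∑ p ∈ primesIoc w v, φ p + ∑ p ∈ primesIoc v x, φ p = ∑ p ∈ primesIoc w x, φ p := by
  unfold primesIoc
  rw [← Finset.sum_union, ← Finset.filter_union,
    Finset.Ioc_union_Ioc_eq_Ioc (Nat.floor_le_floor hwv) (Nat.floor_le_floor hvx)]
  rw [Finset.disjoint_left]
  intro p hp hq
  simp only [Finset.mem_filter, Finset.mem_Ioc] at hp hq
  omega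

/-- Dyadic decomposition of sums over primes with weight `log p / p`. -/
theorem sum_prime_log_div_mul_le {φ : ℕ → ℝ} (hφ : Summable φ) (hφ0 : ∀ j, 0 ≤ φ j)
    (S : Finset ℕ) (hS : ∀ p ∈ S, p.Prime) {w : ℕ → ℝ} (hw : ∀ p ∈ S, w p ≤ φ (Nat.log 2 p)) :
    ∑ p ∈ S, Real.log p / p * w p ≤ 4 * ∑' j, φ j := by
  -- Chebyshev on one dyadic block: 2 · 2^(j+1) / 2^j = 4.
  have hblock : ∀ j : ℕ, ∑ p ∈ S with Nat.log 2 p = j, Real.log p / p ≤ 4 := by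
    intro j
    have h1 : ∑ p ∈ S with Nat.log 2 p = j, Real.log p / p
        ≤ ∑ p ∈ S with Nat.log 2 p = j, Real.log p / 2 ^ j := by
      refine Finset.sum_le_sum fun p hp => ?_
      obtain ⟨hpS, hj⟩ := Finset.mem_filter.1 hp
      have h2 : 2 ^ j ≤ p := hj ▸ Nat.pow_log_le_self 2 (hS p hpS).ne_zero
      have h3 : (2 : ℝ) ^ j ≤ p := by exact_mod_cast h2
      exact div_le_div_of_nonneg_left (Real.log_natCast_nonneg p) (by positivity) h3
    have h2 : ∑ p ∈ S with Nat.log 2 p = j, Real.log p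
        ≤ ∑ p ∈ primesIoc 0 (2 ^ (j + 1)), Real.log p := by
      refine Finset.sum_le_sum_of_subset_of_nonneg ?_ fun p _ _ => Real.log_natCast_nonneg p
      intro p hp
      obtain ⟨hpS, hj⟩ := Finset.mem_filter.1 hp
      rw [mem_primesIoc le_rfl]
      refine ⟨hS p hpS, by exact_mod_cast (hS p hpS).pos, ?_⟩
      have : p < 2 ^ (j + 1) := hj ▸ Nat.lt_pow_succ_log_self one_lt_two p
      exact_mod_cast this.le
    have h3 := sum_log_primesIoc_zero_le (t := 2 ^ (j + 1)) (by positivity)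
    rw [← Finset.sum_div] at h1
    refine h1.trans ?_
    rw [div_le_iff₀ (by positivity)]
    calc _ ≤ 2 * (2 : ℝ) ^ (j + 1) := h2.trans h3
      _ = _ := by ring
  calc ∑ p ∈ S, Real.log p / p * w p
      ≤ ∑ p ∈ S, Real.log p / p * φ (Nat.log 2 p) :=
        Finset.sum_le_sum fun p hp => mul_le_mul_of_nonneg_left (hw p hp)
          (div_nonneg (Real.log_natCast_nonneg p) (Nat.cast_nonneg p))
    _ = ∑ j ∈ S.image (Nat.log 2), ∑ p ∈ S with Nat.log 2 p = j,
          Real.log p / p * φ (Nat.log 2 p) :=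
        (Finset.sum_fiberwise_of_maps_to (fun p hp => Finset.mem_image_of_mem _ hp) _).symm
    _ = ∑ j ∈ S.image (Nat.log 2), (∑ p ∈ S with Nat.log 2 p = j, Real.log p / p) * φ j := by
        refine Finset.sum_congr rfl fun j _ => ?_
        rw [Finset.sum_mul]
        refine Finset.sum_congr rfl fun p hp => ?_
        rw [(Finset.mem_filter.1 hp).2]
    _ ≤ ∑ j ∈ S.image (Nat.log 2), 4 * φ j :=
        Finset.sum_le_sum fun j _ => mul_le_mul_of_nonneg_right (hblock j) (hφ0 j)
    _ = 4 * ∑ j ∈ S.image (Nat.log 2), φ j := by rw [Finset.mul_sum]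
    _ ≤ 4 * ∑' j, φ j :=
        mul_le_mul_of_nonneg_left (hφ.sum_le_tsum _ fun j _ => hφ0 j) (by norm_num)

theorem two_pow_log_le {p : ℕ} (hp : p.Prime) : (2 : ℝ) ^ (Nat.log 2 p) ≤ p := by
  exact_mod_cast Nat.pow_log_le_self 2 hp.ne_zero

/-- `∑_p (log p) p^{-1-α} ≪ 1/α`. -/
theorem sum_prime_log_mul_rpow_le {α : ℝ} (hα : 0 < α) (hα2 : α ≤ 2) (S : Finset ℕ)
    (hS : ∀ p ∈ S, p.Prime) : ∑ p ∈ S, Real.log p / p * (p : ℝ) ^ (-α) ≤ 16 / α := by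
  set r : ℝ := (2 : ℝ) ^ (-α) with hr
  have hr0 : 0 < r := by positivity
  have hlog : (1 / 2 : ℝ) ≤ Real.log 2 := by have := Real.log_two_gt_d9; linarith
  -- 2^α ≥ 1 + α/2, and (1 - α/4)(1 + α/2) ≥ 1 exactly because α ≤ 2.
  have hr1 : r ≤ 1 - α / 4 := by
    have h1 : r * (1 + α / 2) ≤ 1 := by
      have : (1 + α / 2) ≤ (2 : ℝ) ^ α := by
        rw [Real.rpow_def_of_pos two_pos]
        have := Real.add_one_le_exp (Real.log 2 * α)
        nlinarith
      calc r * (1 + α / 2) ≤ r * 2 ^ α := by gcongr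
        _ = 1 := by rw [hr, ← Real.rpow_add two_pos]; simp
    by_contra hcon
    push Not at hcon
    nlinarith
  have hrlt : r < 1 := by linarith
  have h := sum_prime_log_div_mul_le (φ := fun j => r ^ j)
    (summable_geometric_of_lt_one hr0.le hrlt) (fun j => by positivity) S hS
    (w := fun p => (p : ℝ) ^ (-α)) (fun p hp => by
      have h2 := two_pow_log_le (hS p hp)
      calc (p : ℝ) ^ (-α) ≤ ((2 : ℝ) ^ (Nat.log 2 p)) ^ (-α) :=
            Real.rpow_le_rpow_of_nonpos (by positivity) h2 (by linarith)
        _ = r ^ (Nat.log 2 p) := by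
            rw [hr, ← Real.rpow_natCast, ← Real.rpow_natCast, ← Real.rpow_mul two_pos.le,
              ← Real.rpow_mul two_pos.le, mul_comm])
  refine h.trans ?_
  rw [tsum_geometric_of_lt_one hr0.le hrlt]
  have : (1 - r)⁻¹ ≤ (α / 4)⁻¹ := inv_anti₀ (by positivity) (by linarith)
  calc 4 * (1 - r)⁻¹ ≤ 4 * (α / 4)⁻¹ := by gcongr
    _ = 16 / α := by field_simp; norm_num

/-- `∑_p 1/(p log p)` converges. -/
theorem exists_sum_prime_inv_mul_log_le : ∃ C : ℝ, 0 < C ∧ ∀ S : Finset ℕ, (∀ p ∈ S, p.Prime) →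
    ∑ p ∈ S, 1 / ((p : ℝ) * Real.log p) ≤ C := by
  have hs : Summable (fun j : ℕ => 4 * (1 / (j : ℝ) ^ 2)) :=
    (Real.summable_one_div_nat_pow.2 one_lt_two).mul_left 4
  refine ⟨4 * ∑' j : ℕ, 4 * (1 / (j : ℝ) ^ 2), ?_, ?_⟩
  · refine mul_pos four_pos (hs.tsum_pos (fun j => by positivity) 1 (by norm_num))
  intro S hS
  have hlog : (1 / 2 : ℝ) ≤ Real.log 2 := by have := Real.log_two_gt_d9; linarith
  refine le_trans (le_of_eq ?_) (sum_prime_log_div_mul_le hs (fun j => by positivity) S hS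
    (w := fun p => 1 / Real.log p ^ 2) ?_)
  · refine Finset.sum_congr rfl fun p hp => ?_
    have h1 : 0 < Real.log p := Real.log_pos (by exact_mod_cast (hS p hp).one_lt)
    have h2 : (0 : ℝ) < p := by exact_mod_cast (hS p hp).pos
    field_simp
  · intro p hp
    have hj : 1 ≤ Nat.log 2 p := Nat.log_pos one_lt_two (hS p hp).two_le
    have hj' : (1 : ℝ) ≤ Nat.log 2 p := by exact_mod_cast hj
    have h2 := two_pow_log_le (hS p hp)
    have h3 : (Nat.log 2 p : ℝ) / 2 ≤ Real.log p := by
      have := Real.log_le_log (by positivity) h2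
      rw [Real.log_pow] at this
      nlinarith
    rw [show (4 : ℝ) * (1 / (Nat.log 2 p : ℝ) ^ 2) = 1 / ((Nat.log 2 p : ℝ) / 2) ^ 2 by
      field_simp; norm_num]
    gcongr

theorem log_factorial_eq_sum (n : ℕ) :
    Real.log (n.factorial : ℝ) = ∑ p ∈ primesIoc 0 n, ((n.factorial).factorization p : ℝ) *
      Real.log p := by
  have h := Real.log_nat_eq_sum_factorization n.factorial
  rw [h, Finsupp.sum]
  refine Finset.sum_subset ?_ ?_
  · intro p hp
    rw [Nat.support_factorization] at hp
    have hpp := Nat.prime_of_mem_primeFactors hp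
    rw [mem_primesIoc le_rfl]
    exact ⟨hpp, by exact_mod_cast hpp.pos,
      by exact_mod_cast (hpp.dvd_factorial.1 (Nat.dvd_of_mem_primeFactors hp))⟩
  · intro p _ hp
    rw [Finsupp.notMem_support_iff.1 hp]; simp

/-- Mertens' first theorem. -/
theorem exists_abs_sum_prime_log_div_sub_log_le : ∃ C : ℝ, 0 < C ∧ ∀ t : ℝ, 1 ≤ t →
    |∑ p ∈ primesIoc 0 t, Real.log p / p - Real.log t| ≤ C := by
  have hnat : ∀ n : ℕ, 1 ≤ n →
      |∑ p ∈ primesIoc 0 n, Real.log p / p - Real.log n| ≤ 17 := by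
    intro n hn
    have hn0 : (0 : ℝ) < n := by exact_mod_cast hn
    have hfac := log_factorial_eq_sum n
    have hupper : Real.log (n.factorial : ℝ) ≤ n * Real.log n := by
      rw [← Real.log_pow]
      exact Real.log_le_log (by exact_mod_cast n.factorial_pos) (by exact_mod_cast n.factorial_le_pow)
    have hlower : n * Real.log n - n ≤ Real.log (n.factorial : ℝ) := by
      have h1 : (n : ℝ) ^ n / n.factorial ≤ Real.exp n := by
        have := Real.pow_div_factorial_le_exp (n : ℝ) hn0.le n
        exact this
      have h2 := Real.log_le_log (by positivity) h1
      rw [Real.log_exp, Real.log_div (by positivity) (by positivity), Real.log_pow] at h2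
      linarith
    have hth := sum_log_primesIoc_zero_le (t := (n : ℝ)) hn0.le
    have hp2 : ∀ p ∈ primesIoc 0 (n : ℝ), (2 : ℝ) ≤ p := fun p hp => by
      exact_mod_cast (prime_of_mem_primesIoc hp).two_le
    -- Upper half of the estimate: v_p(n!) ≥ n/p - 1, compared with log n! ≤ n log n.
    have hA : n * ∑ p ∈ primesIoc 0 (n : ℝ), Real.log p / p - 2 * n
        ≤ Real.log (n.factorial : ℝ) := by
      rw [hfac]
      refine le_trans (sub_le_sub_left hth _) ?_
      rw [Finset.mul_sum, ← Finset.sum_sub_distrib]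
      refine Finset.sum_le_sum fun p hp => ?_
      have hpp := prime_of_mem_primesIoc hp
      have hv : n / p ≤ (n.factorial).factorization p := by
        rw [← (hpp.pow_dvd_iff_le_factorization n.factorial_ne_zero)]
        have := Nat.Prime.pow_dvd_factorial_iff hpp (n := n) (r := n / p) (b := n + 2)
          (lt_of_le_of_lt (Nat.log_le_self p n) (by omega))
        rw [this]
        have h1 : n / p = ∑ i ∈ Finset.Ico 1 2, n / p ^ i := by simp
        rw [h1]
        refine Finset.sum_le_sum_of_subset ?_
        exact Finset.Ico_subset_Ico_right (by omega)
      have hv' : (n : ℝ) / p - 1 ≤ ((n.factorial).factorization p : ℝ) := by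
        have h1 : (n : ℝ) / p < (n / p : ℕ) + 1 := by
          rw [div_lt_iff₀ (by exact_mod_cast hpp.pos)]
          exact_mod_cast Nat.lt_mul_of_div_lt (Nat.lt_succ_self (n / p)) hpp.pos
        have h2 : ((n / p : ℕ) : ℝ) ≤ ((n.factorial).factorization p : ℝ) := by exact_mod_cast hv
        linarith
      calc n * (Real.log p / p) - Real.log p = (n / p - 1) * Real.log p := by ring
        _ ≤ _ := mul_le_mul_of_nonneg_right hv' (Real.log_natCast_nonneg p)
    -- Lower half: Legendre's formula gives (p - 1) v_p(n!) ≤ n, so v_p(n!) ≤ n/p + 2n/p², and the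
    -- second term contributes O(n) in total.
    have hB : Real.log (n.factorial : ℝ)
        ≤ n * ∑ p ∈ primesIoc 0 (n : ℝ), Real.log p / p + 16 * n := by
      have hC' : ∑ p ∈ primesIoc 0 (n : ℝ), (Real.log p / p) * (p : ℝ)⁻¹ ≤ 8 := by
        have := sum_prime_log_div_mul_le (φ := fun j => (1 / 2 : ℝ) ^ j)
          (summable_geometric_two) (fun j => by positivity) (primesIoc 0 (n : ℝ))
          (fun p hp => prime_of_mem_primesIoc hp) (w := fun p => (p : ℝ)⁻¹) (fun p hp => by
            have := two_pow_log_le (prime_of_mem_primesIoc hp)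
            rw [one_div, inv_pow]
            exact inv_anti₀ (by positivity) this)
        rw [tsum_geometric_two] at this
        linarith
      rw [hfac]
      have : ∑ p ∈ primesIoc 0 (n : ℝ), ((n.factorial).factorization p : ℝ) * Real.log p
          ≤ ∑ p ∈ primesIoc 0 (n : ℝ), (n * (Real.log p / p) +
            2 * n * ((Real.log p / p) * (p : ℝ)⁻¹)) := by
        refine Finset.sum_le_sum fun p hp => ?_
        have hpp := prime_of_mem_primesIoc hp
        have h2 := hp2 p hp
        have : Fact p.Prime := ⟨hpp⟩
        have hv : ((n.factorial).factorization p : ℝ) * (p - 1) ≤ n := by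
          have h1 := sub_one_mul_padicValNat_factorial (p := p) n
          have h3 : (p - 1) * (n.factorial).factorization p ≤ n := by
            rw [Nat.factorization_def _ hpp, h1]; omega
          have h4 : ((p - 1 : ℕ) : ℝ) = p - 1 := by
            rw [Nat.cast_sub hpp.one_lt.le]; simp
          rw [← h4, mul_comm]
          exact_mod_cast h3
        have hv2 : ((n.factorial).factorization p : ℝ) ≤ n / p + 2 * n / p * (p : ℝ)⁻¹ := by
          have h5 : ((n.factorial).factorization p : ℝ) ≤ n / (p - 1) := by
            rw [le_div_iff₀ (by linarith)]; exact hv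
          refine h5.trans ?_
          have hp0 : (0 : ℝ) < p := by linarith
          rw [show (n : ℝ) / p + 2 * n / p * (p : ℝ)⁻¹ = n * (p + 2) / (p * p) by field_simp]
          rw [div_le_div_iff₀ (by linarith) (by positivity)]
          have : (0:ℝ) ≤ n * (p - 2) := mul_nonneg hn0.le (by linarith)
          nlinarith
        calc _ ≤ (n / p + 2 * n / p * (p : ℝ)⁻¹) * Real.log p :=
              mul_le_mul_of_nonneg_right hv2 (Real.log_natCast_nonneg p)
          _ = _ := by ring
      refine this.trans ?_
      rw [Finset.sum_add_distrib, ← Finset.mul_sum, ← Finset.mul_sum]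
      nlinarith
    rw [abs_le]
    constructor
    · have : n * (Real.log n - 17) ≤ n * ∑ p ∈ primesIoc 0 (n : ℝ), Real.log p / p := by linarith
      have := le_of_mul_le_mul_left this hn0
      linarith
    · have : n * ∑ p ∈ primesIoc 0 (n : ℝ), Real.log p / p ≤ n * (Real.log n + 2) := by linarith
      have := le_of_mul_le_mul_left this hn0
      linarith
  refine ⟨18, by norm_num, fun t ht => ?_⟩
  have hfl : 1 ≤ ⌊t⌋₊ := (Nat.one_le_floor_iff t).2 ht
  have h := hnat ⌊t⌋₊ hfl
  have heq : primesIoc 0 (⌊t⌋₊ : ℝ) = primesIoc 0 t := by simp [primesIoc]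
  rw [heq] at h
  have hf1 : (1 : ℝ) ≤ ⌊t⌋₊ := by exact_mod_cast hfl
  have h1 : Real.log ⌊t⌋₊ ≤ Real.log t :=
    Real.log_le_log (by linarith) (Nat.floor_le (by linarith))
  have h2 : Real.log t ≤ Real.log ⌊t⌋₊ + 1 := by
    have h3 : t ≤ Real.exp 1 * ⌊t⌋₊ := by
      have := Nat.lt_floor_add_one t
      have := Real.add_one_le_exp (1 : ℝ)
      nlinarith
    have := Real.log_le_log (by linarith) h3
    rw [Real.log_mul (by positivity) (by linarith), Real.log_exp] at this
    linarith
  rw [abs_le] at h ⊢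
  constructor <;> linarith

theorem hasDerivAt_inv_log {t : ℝ} (ht : 1 < t) :
    HasDerivAt (fun u => (Real.log u)⁻¹) (-(1 / (t * Real.log t ^ 2))) t := by
  have h := (Real.hasDerivAt_log (by positivity : t ≠ 0)).inv (Real.log_pos ht).ne'
  refine HasDerivAt.congr_deriv h ?_
  have : Real.log t ≠ 0 := (Real.log_pos ht).ne'
  field_simp

theorem hasDerivAt_log_log {t : ℝ} (ht : 1 < t) :
    HasDerivAt (fun u => Real.log (Real.log u)) (1 / (t * Real.log t)) t := by
  have h := (Real.hasDerivAt_log (by positivity : t ≠ 0)).log (Real.log_pos ht).ne'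
  refine HasDerivAt.congr_deriv h ?_
  have : Real.log t ≠ 0 := (Real.log_pos ht).ne'
  field_simp

theorem continuousOn_inv_mul_log_sq {a b : ℝ} (ha : 1 < a) :
    ContinuousOn (fun t => 1 / (t * Real.log t ^ 2)) (Set.Icc a b) := by
  intro t ht
  have ht1 : 1 < t := ha.trans_le ht.1
  have hl := Real.log_pos ht1
  refine ContinuousAt.continuousWithinAt ?_
  have : ContinuousAt Real.log t := Real.continuousAt_log (by positivity)
  fun_prop (disch := positivity)

open MeasureTheory in
/-- Mertens' second theorem. -/
theorem exists_abs_sum_prime_inv_sub_log_le : ∃ C : ℝ, 0 < C ∧ ∀ w t : ℝ, 3 / 2 ≤ w → w ≤ t →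
    |∑ p ∈ primesIoc w t, (1 : ℝ) / p - Real.log (Real.log t / Real.log w)| ≤ C := by
  obtain ⟨C, hC, hM⟩ := exists_abs_sum_prime_log_div_sub_log_le
  refine ⟨6 * C, by positivity, fun w t hw hwt => ?_⟩
  have hw1 : 1 < w := by linarith
  have ht1 : 1 < t := by linarith
  have hlw : (1 / 3 : ℝ) ≤ Real.log w := by
    have h1 := Real.one_sub_inv_le_log_of_pos (x := w) (by linarith)
    have h2 : w⁻¹ ≤ (3 / 2)⁻¹ := inv_anti₀ (by norm_num) hw
    norm_num at h2; linarith
  have hlwt : Real.log w ≤ Real.log t := Real.log_le_log (by linarith) hwt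
  have hlt : (1 / 3 : ℝ) ≤ Real.log t := hlw.trans hlwt
  set c : ℕ → ℝ := fun k => if k.Prime then Real.log k / k else 0 with hc
  have hA : ∀ u : ℝ, ∑ k ∈ Finset.Icc 0 ⌊u⌋₊, c k = ∑ p ∈ primesIoc 0 u, Real.log p / p := by
    intro u
    rw [primesIoc, Finset.sum_filter, Nat.floor_zero]
    rw [← Finset.sum_subset (Finset.Ioc_subset_Icc_self)]
    intro k hk hk'
    have : k = 0 := by
      simp only [Finset.mem_Icc, Finset.mem_Ioc] at hk hk'; omega
    simp [hc, this]
  have habel := sum_mul_eq_sub_sub_integral_mul (f := fun u => (Real.log u)⁻¹) c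
    (by linarith : 0 ≤ w) hwt
    (fun u hu => (hasDerivAt_inv_log (hw1.trans_le hu.1)).differentiableAt)
    (by
      refine IntegrableOn.congr_fun (f := fun t => -(1 / (t * Real.log t ^ 2))) ?_ ?_
        measurableSet_Icc
      · exact (continuousOn_inv_mul_log_sq hw1).neg.integrableOn_Icc
      · intro u hu
        exact (hasDerivAt_inv_log (hw1.trans_le hu.1)).deriv.symm)
  have hL : ∑ k ∈ Finset.Ioc ⌊w⌋₊ ⌊t⌋₊, (Real.log k)⁻¹ * c k
      = ∑ p ∈ primesIoc w t, (1 : ℝ) / p := by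
    rw [primesIoc, Finset.sum_filter]
    refine Finset.sum_congr rfl fun k _ => ?_
    by_cases hk : k.Prime
    · have : 0 < Real.log k := Real.log_pos (by exact_mod_cast hk.one_lt)
      simp only [hc, hk, if_true]
      field_simp
    · simp [hc, hk]
  rw [hL, hA, hA] at habel
  set A : ℝ → ℝ := fun u => ∑ p ∈ primesIoc 0 u, Real.log p / p with hAdef
  have hint : ∫ u in Set.Ioc w t, deriv (fun u => (Real.log u)⁻¹) u *
      ∑ k ∈ Finset.Icc 0 ⌊u⌋₊, c k = -∫ u in Set.Ioc w t, 1 / (u * Real.log u ^ 2) * A u := by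
    rw [← integral_neg]
    refine setIntegral_congr_fun measurableSet_Ioc fun u hu => ?_
    rw [(hasDerivAt_inv_log (hw1.trans hu.1)).deriv, hA]
    ring
  rw [hint] at habel
  have hI0 : IntegrableOn (fun u => 1 / (u * Real.log u ^ 2) * A u) (Set.Ioc w t) := by
    have := integrableOn_mul_sum_Icc (m := 0) c (by linarith : 0 ≤ w)
      (continuousOn_inv_mul_log_sq (b := t) hw1).integrableOn_Icc
    refine (this.congr_fun (fun u _ => ?_) measurableSet_Icc).mono_set Set.Ioc_subset_Icc_self
    simp only [hA, hAdef]
  -- With log u + κ in place of the partial sum A(u) the integrand has an explicit primitive; κ = ±C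
  -- then encloses the true integral.
  have hmodel : ∀ κ : ℝ, IntegrableOn (fun u => 1 / (u * Real.log u ^ 2) * (Real.log u + κ))
        (Set.Ioc w t) ∧ ∫ u in Set.Ioc w t, 1 / (u * Real.log u ^ 2) * (Real.log u + κ)
      = (Real.log (Real.log t) - κ * (Real.log t)⁻¹) -
        (Real.log (Real.log w) - κ * (Real.log w)⁻¹) := by
    intro κ
    have hcont : ContinuousOn (fun u => 1 / (u * Real.log u ^ 2) * (Real.log u + κ))
        (Set.Icc w t) := by
      refine (continuousOn_inv_mul_log_sq hw1).mul (ContinuousOn.add ?_ continuousOn_const)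
      exact Real.continuousOn_log.mono fun u hu => by
        have : 0 < u := by linarith [hu.1]
        exact this.ne'
    refine ⟨hcont.integrableOn_Icc.mono_set Set.Ioc_subset_Icc_self, ?_⟩
    rw [← intervalIntegral.integral_of_le hwt]
    refine intervalIntegral.integral_eq_sub_of_hasDerivAt
      (f := fun u => Real.log (Real.log u) - κ * (Real.log u)⁻¹) ?_ ?_
    · intro u hu
      rw [Set.uIcc_of_le hwt] at hu
      have hu1 : 1 < u := hw1.trans_le hu.1
      have hul := Real.log_pos hu1
      refine HasDerivAt.congr_deriv
        ((hasDerivAt_log_log hu1).sub ((hasDerivAt_inv_log hu1).const_mul κ)) ?_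
      field_simp
      ring
    · rw [intervalIntegrable_iff_integrableOn_Icc_of_le hwt]
      exact hcont.integrableOn_Icc
  have hAb : ∀ u, 1 ≤ u → Real.log u + (-C) ≤ A u ∧ A u ≤ Real.log u + C := by
    intro u hu
    have := abs_le.1 (hM u hu)
    constructor <;> linarith [this.1, this.2]
  have hup : ∫ u in Set.Ioc w t, 1 / (u * Real.log u ^ 2) * A u
      ≤ ∫ u in Set.Ioc w t, 1 / (u * Real.log u ^ 2) * (Real.log u + C) := by
    refine setIntegral_mono_on hI0 (hmodel C).1 measurableSet_Ioc fun u hu => ?_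
    have hu1 : 1 < u := hw1.trans hu.1
    exact mul_le_mul_of_nonneg_left (hAb u hu1.le).2 (by positivity)
  have hlo : ∫ u in Set.Ioc w t, 1 / (u * Real.log u ^ 2) * (Real.log u + (-C))
      ≤ ∫ u in Set.Ioc w t, 1 / (u * Real.log u ^ 2) * A u := by
    refine setIntegral_mono_on (hmodel (-C)).1 hI0 measurableSet_Ioc fun u hu => ?_
    have hu1 : 1 < u := hw1.trans hu.1
    exact mul_le_mul_of_nonneg_left (hAb u hu1.le).1 (by positivity)
  rw [(hmodel C).2] at hup
  rw [(hmodel (-C)).2] at hlo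
  rw [habel, Real.log_div (by positivity) (by positivity)]
  have hAt := hAb t ht1.le
  have hAw := hAb w hw1.le
  have hlw0 : 0 < Real.log w := by linarith
  have hlt0 : 0 < Real.log t := by linarith
  have e1 : (Real.log t)⁻¹ * A t ≤ 1 + C * (Real.log t)⁻¹ := by
    calc _ ≤ (Real.log t)⁻¹ * (Real.log t + C) := by gcongr; exact hAt.2
      _ = _ := by field_simp
  have e2 : 1 - C * (Real.log t)⁻¹ ≤ (Real.log t)⁻¹ * A t := by
    calc _ = (Real.log t)⁻¹ * (Real.log t + (-C)) := by field_simp; ring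
      _ ≤ _ := by gcongr; exact hAt.1
  have e3 : (Real.log w)⁻¹ * A w ≤ 1 + C * (Real.log w)⁻¹ := by
    calc _ ≤ (Real.log w)⁻¹ * (Real.log w + C) := by gcongr; exact hAw.2
      _ = _ := by field_simp
  have e4 : 1 - C * (Real.log w)⁻¹ ≤ (Real.log w)⁻¹ * A w := by
    calc _ = (Real.log w)⁻¹ * (Real.log w + (-C)) := by field_simp; ring
      _ ≤ _ := by gcongr; exact hAw.1
  have e5 : C * (Real.log w)⁻¹ ≤ C * 3 := by
    gcongr
    exact (inv_anti₀ (by norm_num) hlw).trans (by norm_num)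
  have e6 : 0 ≤ C * (Real.log t)⁻¹ := by positivity
  rw [abs_le]
  constructor <;> linarith

/-- Comparison of `∑ p^{-1}` over `p ≤ X` with `∑ p^{-σ}`, `σ = 1 + 1 / log X`. -/
theorem exists_sum_prime_rpow_compare : ∃ C : ℝ, 0 < C ∧ ∀ X : ℝ, 3 / 2 ≤ X →
    (∑ p ∈ primesIoc 0 X, (1 / (p : ℝ) - (p : ℝ) ^ (-(1 + 1 / Real.log X))) ≤ C) ∧
    ∀ x : ℝ, ∑ p ∈ primesIoc X x, (p : ℝ) ^ (-(1 + 1 / Real.log X)) ≤ C := by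
  obtain ⟨C, hC, hM⟩ := exists_abs_sum_prime_log_div_sub_log_le
  refine ⟨1 + 3 * C + 64, by positivity, fun X hX => ?_⟩
  have hlX : (1 / 3 : ℝ) ≤ Real.log X := by
    have h1 := Real.one_sub_inv_le_log_of_pos (x := X) (by linarith)
    have h2 : X⁻¹ ≤ (3 / 2)⁻¹ := inv_anti₀ (by norm_num) hX
    norm_num at h2; linarith
  set L := Real.log X with hL
  have hL0 : 0 < L := by linarith
  have hsplit : ∀ p : ℕ, p.Prime → (p : ℝ) ^ (-(1 + 1 / L)) = 1 / p * (p : ℝ) ^ (-(1 / L)) := by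
    intro p hp
    have hp0 : (0 : ℝ) < p := by exact_mod_cast hp.pos
    rw [neg_add, Real.rpow_add hp0, Real.rpow_neg_one, one_div (p : ℝ)]
  constructor
  · have h1 : ∑ p ∈ primesIoc 0 X, (1 / (p : ℝ) - (p : ℝ) ^ (-(1 + 1 / L)))
        ≤ ∑ p ∈ primesIoc 0 X, Real.log p / p * L⁻¹ := by
      refine Finset.sum_le_sum fun p hp => ?_
      have hpp := prime_of_mem_primesIoc hp
      have hp0 : (0 : ℝ) < p := by exact_mod_cast hpp.pos
      rw [hsplit p hpp]
      have : 1 - Real.log p / L ≤ (p : ℝ) ^ (-(1 / L)) := by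
        rw [Real.rpow_def_of_pos hp0]
        have := Real.add_one_le_exp (Real.log p * -(1 / L))
        refine le_trans (le_of_eq ?_) this
        field_simp
        ring
      calc 1 / (p : ℝ) - 1 / p * (p : ℝ) ^ (-(1 / L)) = 1 / p * (1 - (p : ℝ) ^ (-(1 / L))) := by ring
        _ ≤ 1 / p * (Real.log p / L) := by gcongr; linarith
        _ = _ := by field_simp
    refine h1.trans ?_
    rw [← Finset.sum_mul]
    have h2 := (abs_le.1 (hM X (by linarith))).2
    have h3 : L⁻¹ ≤ 3 := (inv_anti₀ (by norm_num) hlX).trans (by norm_num)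
    calc _ ≤ (L + C) * L⁻¹ := by gcongr; linarith
      _ = 1 + C * L⁻¹ := by field_simp
      _ ≤ 1 + C * 3 := by gcongr
      _ ≤ _ := by linarith
  · intro x
    have h1 : ∑ p ∈ primesIoc X x, (p : ℝ) ^ (-(1 + 1 / L))
        ≤ ∑ p ∈ primesIoc X x, (Real.log p / p * (p : ℝ) ^ (-(1 / L))) * L⁻¹ := by
      refine Finset.sum_le_sum fun p hp => ?_
      have hpp := prime_of_mem_primesIoc hp
      have hp0 : (0 : ℝ) < p := by exact_mod_cast hpp.pos
      rw [hsplit p hpp]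
      have hXp : L ≤ Real.log p :=
        Real.log_le_log (by linarith) ((mem_primesIoc (by linarith)).1 hp).2.1.le
      have : 1 ≤ Real.log p * L⁻¹ := by rw [← div_eq_mul_inv, le_div_iff₀ hL0]; linarith
      calc 1 / (p : ℝ) * (p : ℝ) ^ (-(1 / L)) = 1 / (p : ℝ) * (p : ℝ) ^ (-(1 / L)) * 1 := by ring
        _ ≤ 1 / (p : ℝ) * (p : ℝ) ^ (-(1 / L)) * (Real.log p * L⁻¹) := by gcongr
        _ = _ := by ring
    refine h1.trans ?_
    rw [← Finset.sum_mul]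
    -- The estimate for ∑ (log p) p^{-1-α} needs α ≤ 2, whereas 1/L can be as large as 3; in that
    -- case the exponent is weakened to 2.
    rcases le_total (1 / L) 2 with h2 | h2
    · have h3 := sum_prime_log_mul_rpow_le (α := 1 / L) (by positivity) h2 (primesIoc X x)
        (fun p hp => prime_of_mem_primesIoc hp)
      calc _ ≤ (16 / (1 / L)) * L⁻¹ := by gcongr
        _ = 16 := by field_simp
        _ ≤ _ := by linarith
    · have h3 := sum_prime_log_mul_rpow_le (α := 2) two_pos le_rfl (primesIoc X x)
        (fun p hp => prime_of_mem_primesIoc hp)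
      have h4 : ∑ p ∈ primesIoc X x, Real.log p / p * (p : ℝ) ^ (-(1 / L))
          ≤ ∑ p ∈ primesIoc X x, Real.log p / p * (p : ℝ) ^ (-(2 : ℝ)) := by
        refine Finset.sum_le_sum fun p hp => ?_
        have hp1 : (1 : ℝ) ≤ p := by exact_mod_cast (prime_of_mem_primesIoc hp).one_le
        have := Real.log_nonneg hp1
        gcongr
      have h5 : L⁻¹ ≤ 3 := (inv_anti₀ (by norm_num) hlX).trans (by norm_num)
      calc _ ≤ (16 / 2) * (3 : ℝ) := by gcongr; exact h4.trans h3
        _ ≤ _ := by linarith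

/-! ### Ramanujan sums, Selberg's sieve and the Brun–Titchmarsh inequality. -/

open ArithmeticFunction in
/-- The Ramanujan sum `c_q(n) = ∑_{d ∣ (q, n)} d μ(q/d)`. -/
noncomputable def ramanujanSum (q n : ℕ) : ℝ :=
  ∑ d ∈ q.divisors, if d ∣ n then (d : ℝ) * (moebius (q / d) : ℝ) else 0

open ArithmeticFunction in
theorem ramanujanSum_of_coprime {q n : ℕ} (hq : q ≠ 0) (h : Nat.Coprime q n) :
    ramanujanSum q n = (moebius q : ℝ) := by
  unfold ramanujanSum
  rw [Finset.sum_eq_single 1]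
  · simp
  · intro d hd hd1
    rw [if_neg]
    intro hdn
    exact hd1 (Nat.eq_one_of_dvd_coprimes h (Nat.dvd_of_mem_divisors hd) hdn)
  · intro h1; simp [hq] at h1

open ArithmeticFunction in
-- Möbius inversion in the form δ_k * ζ * μ = δ_k, where δ_k is the indicator of k.
theorem sum_divisors_ite_dvd_moebius {k q : ℕ} (hk : k ≠ 0) :
    ∑ d ∈ q.divisors, (if k ∣ d then (moebius (q / d) : ℝ) else 0) = if q = k then 1 else 0 := by
  let δ : ArithmeticFunction ℝ := ⟨fun n => if n = k then 1 else 0, by simp [hk.symm]⟩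
  have h1 : δ * (zeta : ArithmeticFunction ℝ) * (moebius : ArithmeticFunction ℝ) = δ := by
    rw [mul_assoc, coe_zeta_mul_coe_moebius, mul_one]
  have h2 := congrArg (fun f : ArithmeticFunction ℝ => f q) h1
  simp only [mul_apply (f := δ * (zeta : ArithmeticFunction ℝ))] at h2
  rw [← Nat.map_div_right_divisors, Finset.sum_map] at h2
  have h3 : δ q = if q = k then 1 else 0 := rfl
  rw [← h3, ← h2]
  refine Finset.sum_congr rfl fun d hd => ?_
  have hd0 : d ≠ 0 := (Nat.pos_of_mem_divisors hd).ne'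
  have h4 : (δ * (zeta : ArithmeticFunction ℝ)) d = if k ∣ d then 1 else 0 := by
    rw [coe_mul_zeta_apply]
    change ∑ i ∈ d.divisors, (if i = k then (1 : ℝ) else 0) = _
    rw [Finset.sum_ite_eq']
    simp [hd0]
  change _ = (δ * (zeta : ArithmeticFunction ℝ)) d * (moebius : ArithmeticFunction ℝ) (q / d)
  rw [h4]
  split_ifs <;> simp

open ArithmeticFunction in
-- Expanding gcd(d, e) as the sum of φ(k) over its divisors k decouples d and e, and each factor is
-- then a Kronecker delta by Möbius inversion. This is the mean value of the product of two
-- Ramanujan sums.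
theorem sum_divisors_gcd_moebius_moebius {q r : ℕ} (hq : q ≠ 0) :
    ∑ d ∈ q.divisors, ∑ e ∈ r.divisors,
      (Nat.gcd d e : ℝ) * ((moebius (q / d) : ℝ) * (moebius (r / e) : ℝ))
      = if q = r then (Nat.totient q : ℝ) else 0 := by
  have hg : ∀ d ∈ q.divisors, ∀ e ∈ r.divisors, (Nat.gcd d e : ℝ)
      = ∑ k ∈ q.divisors, if k ∣ d ∧ k ∣ e then (Nat.totient k : ℝ) else 0 := by
    intro d hd e he
    have hd0 : d ≠ 0 := (Nat.pos_of_mem_divisors hd).ne'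
    have h1 := Nat.sum_totient (Nat.gcd d e)
    rw [← Finset.sum_filter, ← Nat.cast_sum]
    rw [show (q.divisors.filter fun k => k ∣ d ∧ k ∣ e) = (Nat.gcd d e).divisors from ?_, h1]
    ext k
    simp only [Finset.mem_filter, Nat.mem_divisors, Nat.dvd_gcd_iff]
    constructor
    · rintro ⟨_, h⟩; exact ⟨h, Nat.gcd_ne_zero_left hd0⟩
    · rintro ⟨h, _⟩; exact ⟨⟨h.1.trans (Nat.dvd_of_mem_divisors hd), hq⟩, h⟩
  calc _ = ∑ d ∈ q.divisors, ∑ e ∈ r.divisors, ∑ k ∈ q.divisors, (Nat.totient k : ℝ) *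
        ((if k ∣ d then (moebius (q / d) : ℝ) else 0) *
          (if k ∣ e then (moebius (r / e) : ℝ) else 0)) := by
        refine Finset.sum_congr rfl fun d hd => Finset.sum_congr rfl fun e he => ?_
        rw [hg d hd e he, Finset.sum_mul]
        refine Finset.sum_congr rfl fun k _ => ?_
        by_cases h1 : k ∣ d <;> by_cases h2 : k ∣ e <;> simp [h1, h2]
    _ = ∑ k ∈ q.divisors, (Nat.totient k : ℝ) *
        ((∑ d ∈ q.divisors, if k ∣ d then (moebius (q / d) : ℝ) else 0) *
          ∑ e ∈ r.divisors, if k ∣ e then (moebius (r / e) : ℝ) else 0) := by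
        simp_rw [Finset.sum_mul_sum, Finset.mul_sum]
        rw [Finset.sum_comm]
        refine (Finset.sum_congr rfl fun e _ => Finset.sum_comm).trans ?_
        rw [Finset.sum_comm]
        refine Finset.sum_congr rfl fun k _ => Finset.sum_comm
    _ = ∑ k ∈ q.divisors, if q = k then (if q = r then (Nat.totient q : ℝ) else 0) else 0 := by
        refine Finset.sum_congr rfl fun k hk => ?_
        have hk0 : k ≠ 0 := (Nat.pos_of_mem_divisors hk).ne'
        rw [sum_divisors_ite_dvd_moebius hk0, sum_divisors_ite_dvd_moebius hk0]
        by_cases h : q = k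
        · subst h
          simp [eq_comm]
        · simp [h]
    _ = _ := by
        rw [Finset.sum_ite_eq, if_pos (Nat.mem_divisors_self q hq)]

theorem abs_card_filter_dvd_Ioc_sub_le {a b l : ℕ} (hab : a ≤ b) (hl : 0 < l) :
    |(((Finset.Ioc a b).filter (l ∣ ·)).card : ℝ) - ((b : ℝ) - a) / l| ≤ 1 := by
  have h1 : ((Finset.Ioc a b).filter (l ∣ ·)).card + a / l = b / l := by
    rw [← Nat.Ioc_filter_dvd_card_eq_div b l, ← Nat.Ioc_filter_dvd_card_eq_div a l,
      ← Finset.card_union_of_disjoint, ← Finset.filter_union, Finset.union_comm,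
      Finset.Ioc_union_Ioc_eq_Ioc (Nat.zero_le a) hab]
    rw [Finset.disjoint_left]
    intro p hp hq
    simp only [Finset.mem_filter, Finset.mem_Ioc] at hp hq
    omega
  have hl' : (0 : ℝ) < l := by exact_mod_cast hl
  have h2 : (((Finset.Ioc a b).filter (l ∣ ·)).card : ℝ) = (b / l : ℕ) - (a / l : ℕ) := by
    rw [← h1]; push_cast; ring
  have hb1 : ((b / l : ℕ) : ℝ) ≤ b / l := Nat.cast_div_le
  have ha1 : ((a / l : ℕ) : ℝ) ≤ a / l := Nat.cast_div_le
  have hb2 : (b : ℝ) / l < (b / l : ℕ) + 1 := by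
    rw [div_lt_iff₀ hl']; exact_mod_cast Nat.lt_mul_of_div_lt (Nat.lt_succ_self (b / l)) hl
  have ha2 : (a : ℝ) / l < (a / l : ℕ) + 1 := by
    rw [div_lt_iff₀ hl']; exact_mod_cast Nat.lt_mul_of_div_lt (Nat.lt_succ_self (a / l)) hl
  rw [h2, sub_div, abs_le]
  constructor <;> linarith

open ArithmeticFunction in
-- Orthogonality of Ramanujan sums on an interval. The pair (d, e) counts multiples of lcm(d, e):
-- the main term carries de/lcm(d, e) = gcd(d, e), and the counting error of at most 1 costs at most
-- qr for each of at most qr pairs.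
theorem abs_sum_ramanujanSum_mul_sub_le {a b q r : ℕ} (hab : a ≤ b) (hq : q ≠ 0) (hr : r ≠ 0) :
    |∑ n ∈ Finset.Ioc a b, ramanujanSum q n * ramanujanSum r n
      - ((b : ℝ) - a) * (if q = r then (Nat.totient q : ℝ) else 0)| ≤ (q : ℝ) ^ 2 * (r : ℝ) ^ 2 := by
  have hexp : ∑ n ∈ Finset.Ioc a b, ramanujanSum q n * ramanujanSum r n
      = ∑ d ∈ q.divisors, ∑ e ∈ r.divisors, ((d : ℝ) * e *
        ((moebius (q / d) : ℝ) * (moebius (r / e) : ℝ))) *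
          (((Finset.Ioc a b).filter (Nat.lcm d e ∣ ·)).card : ℝ) := by
    simp_rw [ramanujanSum, Finset.sum_mul_sum]
    rw [Finset.sum_comm]
    refine Finset.sum_congr rfl fun d _ => ?_
    rw [Finset.sum_comm]
    refine Finset.sum_congr rfl fun e _ => ?_
    rw [← Finset.sum_boole, Finset.mul_sum]
    refine Finset.sum_congr rfl fun n _ => ?_
    by_cases h1 : d ∣ n <;> by_cases h2 : e ∣ n <;> simp [h1, h2, Nat.lcm_dvd_iff]
    ring
  rw [hexp, ← sum_divisors_gcd_moebius_moebius hq, Finset.mul_sum, ← Finset.sum_sub_distrib]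
  have hmu : ∀ n : ℕ, |(moebius n : ℝ)| ≤ 1 := fun n => by
    exact_mod_cast abs_moebius_le_one (n := n)
  calc _ ≤ ∑ d ∈ q.divisors, ∑ e ∈ r.divisors, (q : ℝ) * r := by
        refine (Finset.abs_sum_le_sum_abs _ _).trans (Finset.sum_le_sum fun d hd => ?_)
        rw [Finset.mul_sum, ← Finset.sum_sub_distrib]
        refine (Finset.abs_sum_le_sum_abs _ _).trans (Finset.sum_le_sum fun e he => ?_)
        have hd0 : 0 < d := Nat.pos_of_mem_divisors hd
        have he0 : 0 < e := Nat.pos_of_mem_divisors he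
        have hl0 : 0 < Nat.lcm d e := Nat.lcm_pos hd0 he0
        have hgl : (Nat.gcd d e : ℝ) * Nat.lcm d e = d * e := by exact_mod_cast Nat.gcd_mul_lcm d e
        have hl' : (0 : ℝ) < Nat.lcm d e := by exact_mod_cast hl0
        have hcard := abs_card_filter_dvd_Ioc_sub_le hab hl0
        set m : ℝ := (moebius (q / d) : ℝ) * (moebius (r / e) : ℝ) with hm
        have hm1 : |m| ≤ 1 := by
          rw [hm, abs_mul]
          exact mul_le_one₀ (hmu _) (abs_nonneg _) (hmu _)
        have hrew : (d : ℝ) * e * m * (((Finset.Ioc a b).filter (Nat.lcm d e ∣ ·)).card : ℝ)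
            - ((b : ℝ) - a) * ((Nat.gcd d e : ℝ) * m)
            = (d : ℝ) * e * m * ((((Finset.Ioc a b).filter (Nat.lcm d e ∣ ·)).card : ℝ)
              - ((b : ℝ) - a) / Nat.lcm d e) := by
          have : (Nat.gcd d e : ℝ) = d * e / Nat.lcm d e := by
            rw [eq_div_iff hl'.ne']; exact hgl
          rw [this]; field_simp
        rw [hrew, abs_mul, abs_mul, abs_of_nonneg (by positivity : (0 : ℝ) ≤ (d : ℝ) * e)]
        have hdq : (d : ℝ) ≤ q := by
          exact_mod_cast Nat.le_of_dvd (Nat.pos_of_ne_zero hq) (Nat.dvd_of_mem_divisors hd)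
        have her : (e : ℝ) ≤ r := by
          exact_mod_cast Nat.le_of_dvd (Nat.pos_of_ne_zero hr) (Nat.dvd_of_mem_divisors he)
        calc _ ≤ (q : ℝ) * r * 1 * 1 := by gcongr
          _ = _ := by ring
    _ = (q.divisors.card : ℝ) * (r.divisors.card) * (q * r) := by
        simp only [Finset.sum_const, nsmul_eq_mul]; ring
    _ ≤ (q : ℝ) * r * (q * r) := by
        gcongr <;> exact_mod_cast Nat.card_divisors_le_self _
    _ = _ := by ring

open ArithmeticFunction in
/-- Selberg's upper bound sieve for an interval. -/
theorem card_coprime_Ioc_mul_le {a b z : ℕ} (hab : a ≤ b) (hz : 1 ≤ z) (A : Finset ℕ)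
    (hA : A ⊆ Finset.Ioc a b)
    (hcop : ∀ n ∈ A, ∀ q, 1 ≤ q → q ≤ z → Nat.Coprime q n) :
    (A.card : ℝ) * ∑ q ∈ Finset.Icc 1 z, (moebius q : ℝ) ^ 2 / Nat.totient q
      ≤ ((b : ℝ) - a) + (z : ℝ) ^ 6 * ∑ q ∈ Finset.Icc 1 z, (moebius q : ℝ) ^ 2 / Nat.totient q := by
  set V := ∑ q ∈ Finset.Icc 1 z, (moebius q : ℝ) ^ 2 / Nat.totient q with hV
  have hV1 : 1 ≤ V := by
    have h1 : (1 : ℕ) ∈ Finset.Icc 1 z := Finset.mem_Icc.2 ⟨le_rfl, hz⟩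
    have := Finset.single_le_sum (f := fun q : ℕ => (moebius q : ℝ) ^ 2 / Nat.totient q)
      (fun q _ => by positivity) h1
    simpa using this
  -- Selberg's weights in Ramanujan form. At an n coprime to all q ≤ z the sum w(n) equals V, while
  -- orthogonality bounds the total of w² by (b - a)V + z^6; comparing the two gives the sieve
  -- bound.
  set κ : ℕ → ℝ := fun q => (moebius q : ℝ) / Nat.totient q with hκ
  set w : ℕ → ℝ := fun n => ∑ q ∈ Finset.Icc 1 z, κ q * ramanujanSum q n with hw
  have hwA : ∀ n ∈ A, w n = V := by
    intro n hn
    refine Finset.sum_congr rfl fun q hq => ?_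
    obtain ⟨h1, h2⟩ := Finset.mem_Icc.1 hq
    rw [ramanujanSum_of_coprime (by omega) (hcop n hn q h1 h2), hκ]
    ring
  have hκ1 : ∀ q ∈ Finset.Icc 1 z, |κ q| ≤ 1 := by
    intro q hq
    obtain ⟨h1, _⟩ := Finset.mem_Icc.1 hq
    have ht : (1 : ℝ) ≤ Nat.totient q := by exact_mod_cast Nat.totient_pos.2 (by omega)
    rw [hκ]
    simp only
    rw [abs_div, abs_of_nonneg (by positivity : (0 : ℝ) ≤ Nat.totient q)]
    refine div_le_one_of_le₀ (le_trans ?_ ht) (by positivity)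
    exact_mod_cast abs_moebius_le_one (n := q)
  have hWle : ∑ n ∈ Finset.Ioc a b, w n ^ 2 ≤ ((b : ℝ) - a) * V + (z : ℝ) ^ 6 := by
    have h1 : ∑ n ∈ Finset.Ioc a b, w n ^ 2 = ∑ q ∈ Finset.Icc 1 z, ∑ r ∈ Finset.Icc 1 z,
        κ q * κ r * ∑ n ∈ Finset.Ioc a b, ramanujanSum q n * ramanujanSum r n := by
      simp_rw [hw, sq, Finset.sum_mul_sum, Finset.mul_sum]
      rw [Finset.sum_comm]
      refine Finset.sum_congr rfl fun q _ => ?_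
      rw [Finset.sum_comm]
      refine Finset.sum_congr rfl fun r _ => Finset.sum_congr rfl fun n _ => by ring
    have h2 : ((b : ℝ) - a) * V = ∑ q ∈ Finset.Icc 1 z, ∑ r ∈ Finset.Icc 1 z,
        κ q * κ r * (((b : ℝ) - a) * (if q = r then (Nat.totient q : ℝ) else 0)) := by
      rw [hV, Finset.mul_sum]
      refine Finset.sum_congr rfl fun q hq => ?_
      rw [Finset.sum_eq_single q]
      · have ht : (0 : ℝ) < Nat.totient q := by
          exact_mod_cast Nat.totient_pos.2 (Finset.mem_Icc.1 hq).1
        simp only [hκ, if_true]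
        field_simp
      · intro r _ hr; rw [if_neg hr.symm]; ring
      · intro h; exact absurd hq h
    have h3 : ∑ n ∈ Finset.Ioc a b, w n ^ 2 - ((b : ℝ) - a) * V
        ≤ ∑ q ∈ Finset.Icc 1 z, ∑ r ∈ Finset.Icc 1 z, (q : ℝ) ^ 2 * (r : ℝ) ^ 2 := by
      rw [h1, h2, ← Finset.sum_sub_distrib]
      refine Finset.sum_le_sum fun q hq => ?_
      rw [← Finset.sum_sub_distrib]
      refine Finset.sum_le_sum fun r hr => ?_
      rw [← mul_sub]
      refine (le_abs_self _).trans ?_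
      rw [abs_mul, abs_mul]
      have := abs_sum_ramanujanSum_mul_sub_le (q := q) (r := r) hab
        (by have := (Finset.mem_Icc.1 hq).1; omega) (by have := (Finset.mem_Icc.1 hr).1; omega)
      calc _ ≤ 1 * 1 * ((q : ℝ) ^ 2 * (r : ℝ) ^ 2) := by
            gcongr
            exacts [hκ1 q hq, hκ1 r hr]
        _ = _ := by ring
    have h4 : ∑ q ∈ Finset.Icc 1 z, (q : ℝ) ^ 2 ≤ (z : ℝ) ^ 3 := by
      calc _ ≤ ∑ q ∈ Finset.Icc 1 z, (z : ℝ) ^ 2 := Finset.sum_le_sum fun q hq => by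
            have : (q : ℝ) ≤ z := by exact_mod_cast (Finset.mem_Icc.1 hq).2
            gcongr
        _ = _ := by simp; ring
    rw [← Finset.sum_mul_sum] at h3
    have h5 : (∑ q ∈ Finset.Icc 1 z, (q : ℝ) ^ 2) * ∑ q ∈ Finset.Icc 1 z, (q : ℝ) ^ 2
        ≤ (z : ℝ) ^ 3 * (z : ℝ) ^ 3 := by gcongr
    nlinarith
  have hle : (A.card : ℝ) * V ^ 2 ≤ ∑ n ∈ Finset.Ioc a b, w n ^ 2 := by
    calc (A.card : ℝ) * V ^ 2 = ∑ n ∈ A, w n ^ 2 := by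
          rw [Finset.sum_congr rfl fun n hn => by rw [hwA n hn]]; simp
      _ ≤ _ := Finset.sum_le_sum_of_subset_of_nonneg hA fun n _ _ => sq_nonneg _
  have hfin : ((A.card : ℝ) * V) * V ≤ (((b : ℝ) - a) + (z : ℝ) ^ 6 * V) * V := by
    have hz6 : (0 : ℝ) ≤ (z : ℝ) ^ 6 := by positivity
    have : (z : ℝ) ^ 6 ≤ (z : ℝ) ^ 6 * V * V := by nlinarith [mul_le_mul hV1 hV1 zero_le_one (by linarith)]
    nlinarith
  exact le_of_mul_le_mul_right hfin (by linarith)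

open ArithmeticFunction in
-- Writing n = m²q with q squarefree, the harmonic sum up to z is at most ∑ μ(q)²/φ(q) times ∑ 1/m²
-- ≤ 2.
theorem log_le_two_mul_sum_moebius_sq_div_totient {z : ℕ} (hz : 1 ≤ z) :
    Real.log z ≤ 2 * ∑ q ∈ Finset.Icc 1 z, (moebius q : ℝ) ^ 2 / Nat.totient q := by
  have h1 : Real.log z ≤ ∑ n ∈ Finset.Icc 1 z, 1 / (n : ℝ) := by
    have := log_add_one_le_harmonic z
    have h2 : ((harmonic z : ℚ) : ℝ) = ∑ n ∈ Finset.Icc 1 z, 1 / (n : ℝ) := by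
      rw [harmonic_eq_sum_Icc]; push_cast; simp
    rw [← h2]
    refine le_trans (Real.log_le_log (by exact_mod_cast hz) (by push_cast; linarith)) this
  have hdec : ∀ n : ℕ, ∃ q m : ℕ, m ^ 2 * q = n ∧ Squarefree q := Nat.sq_mul_squarefree
  choose Q M hQM hQ using hdec
  have h3 : ∑ n ∈ Finset.Icc 1 z, 1 / (n : ℝ)
      ≤ ∑ y ∈ Finset.Icc 1 z ×ˢ Finset.Icc 1 z,
        ((moebius y.1 : ℝ) ^ 2 / Nat.totient y.1) * ((y.2 : ℝ) ^ 2)⁻¹ := by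
    calc _ ≤ ∑ n ∈ Finset.Icc 1 z,
          (fun y : ℕ × ℕ => ((moebius y.1 : ℝ) ^ 2 / Nat.totient y.1) * ((y.2 : ℝ) ^ 2)⁻¹)
            (Q n, M n) := by
          refine Finset.sum_le_sum fun n hn => ?_
          have hn0 : n ≠ 0 := by have := (Finset.mem_Icc.1 hn).1; omega
          have hq0 : 0 < Q n := Nat.pos_of_ne_zero fun h => by
            have := hQM n; rw [h] at this; simp at this; exact hn0 this.symm
          have hm0 : 0 < M n := Nat.pos_of_ne_zero fun h => by
            have := hQM n; rw [h] at this; simp at this; exact hn0 this.symm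
          have hmu : (moebius (Q n) : ℝ) ^ 2 = 1 := by
            exact_mod_cast moebius_sq_eq_one_of_squarefree (hQ n)
          simp only [hmu]
          have hn' : (n : ℝ) = (M n : ℝ) ^ 2 * Q n := by exact_mod_cast (hQM n).symm
          have ht : (Nat.totient (Q n) : ℝ) ≤ Q n := by exact_mod_cast Nat.totient_le _
          have ht0 : (0 : ℝ) < Nat.totient (Q n) := by exact_mod_cast Nat.totient_pos.2 hq0
          have hm0' : (0 : ℝ) < M n := by exact_mod_cast hm0
          rw [hn', ← div_eq_mul_inv, div_div]
          refine one_div_le_one_div_of_le (by positivity) ?_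
          rw [mul_comm]
          gcongr
      _ = ∑ y ∈ (Finset.Icc 1 z).image (fun n => (Q n, M n)),
          ((moebius y.1 : ℝ) ^ 2 / Nat.totient y.1) * ((y.2 : ℝ) ^ 2)⁻¹ := by
          rw [Finset.sum_image]
          intro n _ n' _ h
          simp only [Prod.mk.injEq] at h
          rw [← hQM n, ← hQM n', h.1, h.2]
      _ ≤ _ := by
          refine Finset.sum_le_sum_of_subset_of_nonneg ?_ fun y _ _ => by positivity
          intro y hy
          obtain ⟨n, hn, rfl⟩ := Finset.mem_image.1 hy
          obtain ⟨hn1, hnz⟩ := Finset.mem_Icc.1 hn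
          have hq0 : 0 < Q n := Nat.pos_of_ne_zero fun h => by
            have := hQM n; rw [h] at this; simp at this; omega
          have hm0 : 0 < M n := Nat.pos_of_ne_zero fun h => by
            have := hQM n; rw [h] at this; simp at this; omega
          have hqn : Q n ≤ n := Nat.le_of_dvd (by omega) ⟨M n ^ 2, by rw [mul_comm]; exact (hQM n).symm⟩
          have hmn : M n ≤ n := Nat.le_of_dvd (by omega) ⟨M n * Q n, by
            rw [← mul_assoc, ← sq]; exact (hQM n).symm⟩
          simp only [Finset.mem_product, Finset.mem_Icc]
          omega
  have h4 : ∑ m ∈ Finset.Icc 1 z, ((m : ℝ) ^ 2)⁻¹ ≤ 2 := by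
    have h5 : Finset.Icc 1 z = insert 1 (Finset.Ioc 1 z) := by
      ext k; simp only [Finset.mem_Icc, Finset.mem_insert, Finset.mem_Ioc]; omega
    rw [h5, Finset.sum_insert (by simp)]
    have := sum_Ioc_inv_sq_le_sub (α := ℝ) one_ne_zero hz
    have hz0 : (0 : ℝ) ≤ (z : ℝ)⁻¹ := by positivity
    simp only [Nat.cast_one, inv_one, one_pow] at this ⊢
    linarith
  rw [Finset.sum_product] at h3
  simp only at h3
  rw [← Finset.sum_mul_sum] at h3
  have hV0 : 0 ≤ ∑ q ∈ Finset.Icc 1 z, (moebius q : ℝ) ^ 2 / Nat.totient q :=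
    Finset.sum_nonneg fun q _ => by positivity
  nlinarith

/-- The Brun–Titchmarsh inequality, up to a constant. -/
theorem sum_log_primesIoc_sub_le {t h : ℝ} (h1 : 1 ≤ t) (hth : Real.sqrt t ≤ h) (hht : h ≤ t) :
    ∑ p ∈ primesIoc (t - h) t, Real.log p ≤ 300 * h := by
  have hsq1 : 1 ≤ Real.sqrt t := Real.one_le_sqrt.2 h1
  have hh1 : 1 ≤ h := hsq1.trans hth
  have hlt : 0 ≤ Real.log t := Real.log_nonneg h1
  have hw0 : 0 ≤ t - h := by linarith
  have hfl : ((⌊t⌋₊ : ℝ) - ⌊t - h⌋₊) ≤ h + 1 := by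
    have := Nat.floor_le (by linarith : 0 ≤ t)
    have := Nat.lt_floor_add_one (t - h)
    linarith
  have hab : ⌊t - h⌋₊ ≤ ⌊t⌋₊ := Nat.floor_le_floor (by linarith)
  have hlogle : ∀ S ⊆ primesIoc (t - h) t, ∑ p ∈ S, Real.log p ≤ S.card * Real.log t := by
    intro S hS
    rw [← nsmul_eq_mul]
    refine Finset.sum_le_card_nsmul _ _ _ fun p hp => ?_
    obtain ⟨hpp, _, hpt⟩ := (mem_primesIoc hw0).1 (hS hp)
    exact Real.log_le_log (by exact_mod_cast hpp.pos) hpt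
  -- For log t ≤ 96 counting integers is enough. Beyond that, log s ≥ 4 for s = t^(1/24) below,
  -- which makes log z ≥ (log t)/48.
  rcases le_total (Real.log t) 96 with hsmall | hbig
  · refine (hlogle _ subset_rfl).trans ?_
    have hc : ((primesIoc (t - h) t).card : ℝ) ≤ h + 1 := by
      refine le_trans ?_ hfl
      rw [← Nat.cast_sub hab, ← Nat.card_Ioc]
      exact_mod_cast Finset.card_filter_le _ _
    calc _ ≤ (h + 1) * 96 := by gcongr
      _ ≤ _ := by linarith
  · have ht0 : 0 < t := by linarith
    -- The sieve error is z^6, so the level t^(1/24) keeps it at t^(1/4), which stays below h even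
    -- after multiplication by log t.
    set s : ℝ := t ^ (1 / 24 : ℝ) with hs
    have hs0 : 0 < s := by positivity
    have hlogs : Real.log s = Real.log t / 24 := by rw [hs, Real.log_rpow ht0]; ring
    have hs2 : 2 ≤ s := by
      have := Real.add_one_le_exp (Real.log s)
      rw [Real.exp_log hs0] at this
      linarith
    have hs6 : s ^ 6 = Real.sqrt (Real.sqrt t) := by
      rw [hs, ← Real.rpow_natCast, ← Real.rpow_mul ht0.le, Real.sqrt_eq_rpow, Real.sqrt_eq_rpow,
        ← Real.rpow_mul ht0.le]
      norm_num
    set z := ⌊s⌋₊ with hzdef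
    have hz1 : 1 ≤ z := (Nat.one_le_floor_iff s).2 (by linarith)
    have hzs : (z : ℝ) ≤ s := Nat.floor_le hs0.le
    have hz1' : (1 : ℝ) ≤ z := by exact_mod_cast hz1
    have hzlog : Real.log t / 48 ≤ Real.log z := by
      have h2 : s / 2 ≤ z := by
        have := Nat.lt_floor_add_one s
        linarith
      have h3 := Real.log_le_log (by positivity) h2
      rw [Real.log_div (by positivity) (by norm_num), hlogs] at h3
      have := Real.log_two_lt_d9
      linarith
    set A := (primesIoc (t - h) t).filter (fun p => z < p) with hA
    set V := ∑ q ∈ Finset.Icc 1 z, (ArithmeticFunction.moebius q : ℝ) ^ 2 / Nat.totient q with hV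
    have hsieve := card_coprime_Ioc_mul_le hab hz1 A
      (fun p hp => (Finset.mem_filter.1 (Finset.mem_filter.1 hp).1).1) (by
        intro p hp q hq1 hqz
        obtain ⟨hp1, hp2⟩ := Finset.mem_filter.1 hp
        exact (Nat.coprime_of_lt_prime (by omega) (by omega) (prime_of_mem_primesIoc hp1)).symm)
    have hVlog : Real.log t / 96 ≤ V := by
      have := log_le_two_mul_sum_moebius_sq_div_totient hz1
      linarith
    have hV0 : 0 < V := by linarith
    have hz6 : (z : ℝ) ^ 6 ≤ Real.sqrt (Real.sqrt t) := by rw [← hs6]; gcongr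
    have hroot : Real.sqrt (Real.sqrt t) * Real.log t ≤ 4 * h := by
      set y := Real.sqrt (Real.sqrt t) with hy
      have hyy : y * y = Real.sqrt t := Real.mul_self_sqrt (Real.sqrt_nonneg t)
      have hy0 : 0 < y := Real.sqrt_pos.2 (by linarith)
      have hlogy : Real.log t = 4 * Real.log y := by
        rw [hy, Real.log_sqrt (Real.sqrt_nonneg t), Real.log_sqrt ht0.le]; ring
      have := Real.log_le_self hy0.le
      rw [hlogy]
      nlinarith
    have hAbound : (A.card : ℝ) * Real.log t ≤ 96 * (h + 1) + 4 * h := by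
      have h2 : (A.card : ℝ) - (z : ℝ) ^ 6 ≤ (h + 1) / V := by
        rw [le_div_iff₀ hV0]; linarith
      have h3 : (h + 1) / V ≤ (h + 1) / (Real.log t / 96) := by gcongr
      have hlt0 : 0 < Real.log t := by linarith
      have h4 : (A.card : ℝ) ≤ (h + 1) / (Real.log t / 96) + Real.sqrt (Real.sqrt t) := by linarith
      calc _ ≤ ((h + 1) / (Real.log t / 96) + Real.sqrt (Real.sqrt t)) * Real.log t := by gcongr
        _ = 96 * (h + 1) + Real.sqrt (Real.sqrt t) * Real.log t := by field_simp
        _ ≤ _ := by linarith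
    have hBcard : (((primesIoc (t - h) t).filter (fun p => ¬ z < p)).card : ℝ) ≤ z := by
      have : ((primesIoc (t - h) t).filter (fun p => ¬ z < p)) ⊆ Finset.Ioc 0 z := by
        intro p hp
        obtain ⟨hp1, hp2⟩ := Finset.mem_filter.1 hp
        exact Finset.mem_Ioc.2 ⟨(prime_of_mem_primesIoc hp1).pos, by omega⟩
      have := Finset.card_le_card this
      rw [Nat.card_Ioc] at this
      exact_mod_cast this
    have hzz : (z : ℝ) ≤ (z : ℝ) ^ 6 := le_self_pow₀ hz1' (by norm_num)
    rw [← Finset.sum_filter_add_sum_filter_not _ (fun p => z < p)]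
    have hfA := hlogle A (Finset.filter_subset _ _)
    have hfB := hlogle _ (Finset.filter_subset (fun p => ¬ z < p) (primesIoc (t - h) t))
    have hB2 : (((primesIoc (t - h) t).filter (fun p => ¬ z < p)).card : ℝ) * Real.log t
        ≤ 4 * h := by
      refine le_trans ?_ hroot
      gcongr
      linarith
    linarith

/-! ### Summatory functions and exponentially multiplicative functions. -/

/-- The sum of `f n` over the positive integers `n ≤ u`. -/
noncomputable def summatory {E : Type*} [AddCommMonoid E] (f : ℕ → E) (u : ℝ) : E :=
  ∑ n ∈ Finset.Ioc 0 ⌊u⌋₊, f n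

theorem summatory_of_lt_one {E : Type*} [AddCommMonoid E] (f : ℕ → E) {u : ℝ} (hu : u < 1) :
    summatory f u = 0 := by
  simp [summatory, Nat.floor_eq_zero.2 hu]

theorem norm_summatory_le (f : ℕ → ℂ) (u : ℝ) :
    ‖summatory f u‖ ≤ summatory (fun n => ‖f n‖) u := norm_sum_le _ _

theorem summatory_nonneg {f : ℕ → ℝ} (hf : ∀ n, 0 ≤ f n) (u : ℝ) : 0 ≤ summatory f u :=
  Finset.sum_nonneg fun n _ => hf n

theorem summatory_mono {f : ℕ → ℝ} (hf : ∀ n, 0 ≤ f n) {u v : ℝ} (h : u ≤ v) :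
    summatory f u ≤ summatory f v :=
  Finset.sum_le_sum_of_subset_of_nonneg (Finset.Ioc_subset_Ioc_right (Nat.floor_le_floor h))
    fun n _ _ => hf n

theorem summatory_mul (f g : ArithmeticFunction ℂ) (u : ℝ) :
    summatory (f * g) u = summatory (fun n => f n * summatory g (u / n)) u := by
  unfold summatory
  rw [ArithmeticFunction.sum_Ioc_mul_eq_sum_sum]
  refine Finset.sum_congr rfl fun n _ => ?_
  simp only [Nat.floor_div_natCast]

/-- The multiplicative function with the values `a(p)^k / k!` at prime powers `p^k`. -/
noncomputable def expMul (a : ℕ → ℂ) : ArithmeticFunction ℂ where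
  toFun n := if n = 0 then 0 else n.factorization.prod fun p k => a p ^ k / (k.factorial : ℂ)
  map_zero' := by simp

theorem expMul_apply (a : ℕ → ℂ) {n : ℕ} (hn : n ≠ 0) :
    expMul a n = n.factorization.prod fun p k => a p ^ k / (k.factorial : ℂ) := if_neg hn

theorem isMultiplicative_expMul (a : ℕ → ℂ) : (expMul a).IsMultiplicative := by
  rw [ArithmeticFunction.IsMultiplicative.iff_ne_zero]
  refine ⟨by simp [expMul_apply], fun {m n} hm hn hmn => ?_⟩
  rw [expMul_apply a hm, expMul_apply a hn, expMul_apply a (mul_ne_zero hm hn),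
    Nat.factorization_mul_of_coprime hmn, Finsupp.prod_add_index_of_disjoint]
  simpa using hmn.disjoint_primeFactors

theorem expMul_prime_pow (a : ℕ → ℂ) {p : ℕ} (hp : p.Prime) (k : ℕ) :
    expMul a (p ^ k) = a p ^ k / (k.factorial : ℂ) := by
  rw [expMul_apply a (pow_ne_zero k hp.ne_zero), hp.factorization_pow,
    Finsupp.prod_single_index (by simp)]

theorem expMul_ofReal_norm (a : ℕ → ℂ) (n : ℕ) :
    expMul (fun p => (‖a p‖ : ℂ)) n = (‖expMul a n‖ : ℂ) := by
  rcases eq_or_ne n 0 with rfl | hn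
  · simp
  · rw [expMul_apply _ hn, expMul_apply _ hn, Finsupp.prod, Finsupp.prod, norm_prod]
    push_cast
    refine Finset.prod_congr rfl fun p _ => ?_
    simp

theorem expMul_congr {a a' : ℕ → ℂ} {n : ℕ} (h : ∀ p : ℕ, p.Prime → p ∣ n → a p = a' p) :
    expMul a n = expMul a' n := by
  rcases eq_or_ne n 0 with rfl | hn
  · simp
  · rw [expMul_apply _ hn, expMul_apply _ hn]
    refine Finset.prod_congr rfl fun p hp => ?_
    rw [Nat.support_factorization] at hp
    simp only [h p (Nat.prime_of_mem_primeFactors hp) (Nat.dvd_of_mem_primeFactors hp)]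

theorem expMul_mul_monoidHom (a : ℕ → ℂ) (χ : ℕ →*₀ ℂ) (n : ℕ) :
    expMul (fun p => a p * χ p) n = expMul a n * χ n := by
  rcases eq_or_ne n 0 with rfl | hn
  · simp
  · rw [expMul_apply _ hn, expMul_apply _ hn]
    have h1 : χ n = n.factorization.prod fun p k => χ p ^ k := by
      conv_lhs => rw [← Nat.prod_factorization_pow_eq_self hn]
      rw [Finsupp.prod, Finsupp.prod, map_prod]
      simp
    rw [h1, Finsupp.prod, Finsupp.prod, Finsupp.prod, ← Finset.prod_mul_distrib]
    refine Finset.prod_congr rfl fun p _ => ?_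
    rw [mul_pow]; ring

/-- The arithmetic function supported on primes with the values `a(p) log p`. -/
noncomputable def primeLog (a : ℕ → ℂ) : ArithmeticFunction ℂ where
  toFun n := if n.Prime then a n * (Real.log n : ℂ) else 0
  map_zero' := by simp [Nat.not_prime_zero]

theorem primeLog_apply (a : ℕ → ℂ) (n : ℕ) :
    primeLog a n = if n.Prime then a n * (Real.log n : ℂ) else 0 := rfl

theorem mul_expMul_div (a : ℕ → ℂ) {p n : ℕ} (hp : p.Prime) (hpn : p ∣ n) (hn : n ≠ 0) :
    a p * expMul a (n / p) = n.factorization p * expMul a n := by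
  obtain ⟨k, m, hm, rfl⟩ := Nat.exists_eq_pow_mul_and_not_dvd hn p hp.ne_one
  have hm0 : m ≠ 0 := by rintro rfl; simp at hm
  have hcop : ∀ j, Nat.Coprime (p ^ j) m := fun j =>
    Nat.Coprime.pow_left j ((Nat.Prime.coprime_iff_not_dvd hp).2 hm)
  obtain ⟨j, rfl⟩ : ∃ j, k = j + 1 := by
    refine Nat.exists_eq_succ_of_ne_zero ?_
    rintro rfl
    rw [pow_zero, one_mul] at hpn
    exact hm hpn
  have h1 : p ^ (j + 1) * m / p = p ^ j * m := by
    rw [pow_succ, mul_comm (p ^ j) p, mul_assoc, Nat.mul_div_cancel_left _ hp.pos]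
  have h2 : (p ^ (j + 1) * m).factorization p = j + 1 := by
    rw [Nat.factorization_mul (pow_ne_zero _ hp.ne_zero) hm0, Finsupp.add_apply,
      hp.factorization_pow, Finsupp.single_eq_same, Nat.factorization_eq_zero_of_not_dvd hm]
  rw [h1, h2, (isMultiplicative_expMul a).map_mul_of_coprime (hcop j),
    (isMultiplicative_expMul a).map_mul_of_coprime (hcop (j + 1)), expMul_prime_pow a hp,
    expMul_prime_pow a hp, Nat.factorial_succ]
  have : ((j.factorial : ℕ) : ℂ) ≠ 0 := by exact_mod_cast j.factorial_ne_zero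
  have h3 : ((j + 1 : ℕ) : ℂ) ≠ 0 := by exact_mod_cast Nat.succ_ne_zero j
  push_cast at h3 ⊢
  field_simp
  ring

/-- The logarithmic derivative of exp(∑ a(p) p^{-s}) contains no higher prime powers. Concretely,
log n = ∑ v_p(n) log p, and the factorials in the denominators give v_p(n) f(n) = a(p) f(n/p). This
exact recursion over primes is the reason for working with `expMul`. -/
theorem primeLog_mul_expMul (a : ℕ → ℂ) (n : ℕ) :
    (primeLog a * expMul a) n = expMul a n * (Real.log n : ℂ) := by
  rcases eq_or_ne n 0 with rfl | hn
  · simp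
  rw [ArithmeticFunction.mul_apply, ← Nat.map_div_right_divisors, Finset.sum_map]
  change ∑ d ∈ n.divisors, primeLog a d * expMul a (n / d) = _
  have h1 : ∑ d ∈ n.divisors, primeLog a d * expMul a (n / d)
      = ∑ p ∈ n.primeFactors, primeLog a p * expMul a (n / p) := by
    refine (Finset.sum_subset ?_ ?_).symm
    · intro p hp
      exact Nat.mem_divisors.2 ⟨Nat.dvd_of_mem_primeFactors hp, hn⟩
    · intro d hd hd'
      rw [primeLog_apply, if_neg, zero_mul]
      intro hdp
      exact hd' (Nat.mem_primeFactors.2 ⟨hdp, Nat.dvd_of_mem_divisors hd, hn⟩)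
  rw [h1, Real.log_nat_eq_sum_factorization n, Finsupp.sum, Nat.support_factorization, Complex.ofReal_sum,
    Finset.mul_sum]
  refine Finset.sum_congr rfl fun p hp => ?_
  have hpp := Nat.prime_of_mem_primeFactors hp
  rw [primeLog_apply, if_pos hpp, Complex.ofReal_mul, Complex.ofReal_natCast]
  have := mul_expMul_div a hpp (Nat.dvd_of_mem_primeFactors hp) hn
  linear_combination (Real.log p : ℂ) * this

theorem summatory_expMul_mul_log (a : ℕ → ℂ) (u : ℝ) :
    summatory (fun n => expMul a n * (Real.log n : ℂ)) u
      = ∑ p ∈ primesIoc 0 u, a p * (Real.log p : ℂ) * summatory (expMul a) (u / p) := by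
  have h1 : summatory (fun n => expMul a n * (Real.log n : ℂ)) u
      = summatory (primeLog a * expMul a) u :=
    Finset.sum_congr rfl fun n _ => (primeLog_mul_expMul a n).symm
  rw [h1, summatory_mul, summatory, primesIoc, Finset.sum_filter, Nat.floor_zero]
  refine Finset.sum_congr rfl fun n _ => ?_
  rw [primeLog_apply]
  split_ifs <;> simp

/-- The convolution with the other variable outside. Here the inner sum over primes is open to
Chebyshev's bound, while the version with S(u/p) inside serves the bootstrap. -/
theorem summatory_expMul_mul_log' (a : ℕ → ℂ) (u : ℝ) :
    summatory (fun n => expMul a n * (Real.log n : ℂ)) u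
      = summatory (fun m => expMul a m * ∑ p ∈ primesIoc 0 (u / m), a p * (Real.log p : ℂ)) u := by
  have h1 : summatory (fun n => expMul a n * (Real.log n : ℂ)) u
      = summatory (expMul a * primeLog a) u := by
    rw [mul_comm]
    exact Finset.sum_congr rfl fun n _ => (primeLog_mul_expMul a n).symm
  rw [h1, summatory_mul]
  refine Finset.sum_congr rfl fun n _ => ?_
  change expMul a n * summatory (primeLog a) (u / n) = expMul a n * _
  rw [summatory, primesIoc, Finset.sum_filter, Nat.floor_zero]
  rfl

/-- Euler product: the local factor at p is the exponential series at a(p). Since a is supported on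
a finite set, convergence is absolute with no condition on the size of a. -/
theorem hasSum_expMul (a : ℕ → ℂ) (s : Finset ℕ) (hs : ∀ p : ℕ, p.Prime → p ∉ s → a p = 0) :
    Summable (fun n => ‖expMul a n‖) ∧
      HasSum (fun n => expMul a n) (Complex.exp (∑ p ∈ s with p.Prime, a p)) := by
  have hexp : ∀ p : ℕ, p.Prime → HasSum (fun k : ℕ => expMul a (p ^ k)) (Complex.exp (a p)) := by
    intro p hp
    simp_rw [expMul_prime_pow a hp]
    rw [Complex.exp_eq_exp_ℂ]
    exact NormedSpace.expSeries_div_hasSum_exp (a p)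
  have hsupp : ∀ n ∉ Nat.factoredNumbers s, expMul a n = 0 := by
    intro n hn
    rcases eq_or_ne n 0 with rfl | hn0
    · simp
    rw [Nat.mem_factoredNumbers_iff_primeFactors_subset] at hn
    have : ¬ n.primeFactors ⊆ s := fun h => hn ⟨hn0, h⟩
    obtain ⟨p, hp, hps⟩ := Finset.not_subset.1 this
    have hpp := Nat.prime_of_mem_primeFactors hp
    rw [expMul_apply a hn0]
    refine Finset.prod_eq_zero (i := p) (by rwa [Nat.support_factorization]) ?_
    have : n.factorization p ≠ 0 :=
      (hpp.factorization_pos_of_dvd hn0 (Nat.dvd_of_mem_primeFactors hp)).ne'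
    simp [hs p hpp hps, this]
  have h := EulerProduct.summable_and_hasSum_factoredNumbers_prod_filter_prime_tsum
    (f := fun n => expMul a n) (isMultiplicative_expMul a).1
    (fun {m n} hmn => (isMultiplicative_expMul a).map_mul_of_coprime hmn)
    (fun {p} hp => by
      simp_rw [expMul_prime_pow a hp]
      exact NormedSpace.norm_expSeries_div_summable (a p)) s
  constructor
  · refine (Function.Injective.summable_iff (f := fun n => ‖expMul a n‖)
      (Subtype.val_injective (p := fun n => n ∈ Nat.factoredNumbers s)) ?_).1 h.1
    intro n hn
    simp only [Subtype.range_coe_subtype] at hn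
    simp [hsupp n hn]
  · have h2 := (hasSum_subtype_iff_of_support_subset (f := fun n => expMul a n)
      (s := Nat.factoredNumbers s) (fun n hn => by
        by_contra hcon; exact hn (hsupp n hcon))).1 h.2
    convert h2 using 1
    rw [Complex.exp_sum]
    refine Finset.prod_congr rfl fun p hp => ?_
    exact (hexp p (Finset.mem_filter.1 hp).2).tsum_eq.symm

/-- All terms are nonnegative and every n ≤ u has its primes in (0, u]; so the sum is part of the
full Euler product with local parameters |a(p)|/p truncated at u. -/
theorem summatory_norm_expMul_div_le (a : ℕ → ℂ) (u : ℝ) :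
    summatory (fun n => ‖expMul a n‖ / n) u ≤ Real.exp (∑ p ∈ primesIoc 0 u, ‖a p‖ / p) := by
  let χ : ℕ →*₀ ℂ :=
    { toFun := fun n => (n : ℂ)⁻¹
      map_zero' := by simp
      map_one' := by simp
      map_mul' := fun m n => by push_cast; rw [mul_inv] }
  have hχa : ∀ n : ℕ, χ n = (n : ℂ)⁻¹ := fun n => rfl
  set a' : ℕ → ℂ := fun p => if p ∈ primesIoc 0 u then (‖a p‖ : ℂ) * χ p else 0 with ha'
  have h := hasSum_expMul a' (primesIoc 0 u) (fun p _ hps => by simp [ha', hps])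
  have hval : ∀ n ∈ Finset.Ioc 0 ⌊u⌋₊, expMul a' n = ((‖expMul a n‖ / n : ℝ) : ℂ) := by
    intro n hn
    have hn' := Finset.mem_Ioc.1 hn
    rw [expMul_congr (a' := fun p => (‖a p‖ : ℂ) * χ p), expMul_mul_monoidHom, expMul_ofReal_norm,
      hχa]
    · push_cast; rw [div_eq_mul_inv]
    · intro p hp hpn
      simp only [ha']
      rw [if_pos]
      simp only [primesIoc, Finset.mem_filter, Finset.mem_Ioc, Nat.floor_zero]
      exact ⟨⟨hp.pos, (Nat.le_of_dvd hn'.1 hpn).trans hn'.2⟩, hp⟩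
  have hnn : ∀ n, expMul a' n = (‖expMul a' n‖ : ℂ) := by
    intro n
    rw [← expMul_ofReal_norm]
    refine expMul_congr fun p _ _ => ?_
    simp only [ha']
    split_ifs
    · simp [hχa]
    · simp
  have hsum : HasSum (fun n => ‖expMul a' n‖) (Real.exp (∑ p ∈ primesIoc 0 u, ‖a p‖ / p)) := by
    rw [← Complex.hasSum_ofReal]
    convert h.2 using 1
    · funext n; exact (hnn n).symm
    · push_cast
      congr 1
      rw [Finset.filter_true_of_mem fun p hp => prime_of_mem_primesIoc hp]
      refine Finset.sum_congr rfl fun p hp => ?_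
      simp only [ha', if_pos hp, hχa]
      rw [div_eq_mul_inv]
  calc summatory (fun n => ‖expMul a n‖ / n) u = ∑ n ∈ Finset.Ioc 0 ⌊u⌋₊, ‖expMul a' n‖ := by
        refine Finset.sum_congr rfl fun n hn => ?_
        rw [hval n hn, Complex.norm_real, Real.norm_of_nonneg (by positivity)]
    _ ≤ _ := sum_le_hasSum _ (fun n _ => norm_nonneg _) hsum

theorem summatory_norm_le_mul (f : ℕ → ℂ) {u : ℝ} (hu : 0 ≤ u) :
    summatory (fun n => ‖f n‖) u ≤ u * summatory (fun n => ‖f n‖ / n) u := by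
  unfold summatory
  rw [Finset.mul_sum]
  refine Finset.sum_le_sum fun n hn => ?_
  obtain ⟨h1, h2⟩ := Finset.mem_Ioc.1 hn
  have h3 : (n : ℝ) ≤ u := (Nat.le_floor_iff hu).1 h2
  have h4 : (0 : ℝ) < n := by exact_mod_cast h1
  rw [mul_div_assoc', le_div_iff₀ h4, mul_comm]
  gcongr

/-- The elementary upper bound for sums of nonnegative multiplicative functions. -/
theorem summatory_norm_expMul_mul_log_le {β : ℝ} {a : ℕ → ℂ}
    (ha : ∀ p : ℕ, p.Prime → ‖a p‖ ≤ β) {u : ℝ} (hu : 1 ≤ u) :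
    summatory (fun n => ‖expMul a n‖) u * Real.log u
      ≤ (2 * β + 1) * u * Real.exp (∑ p ∈ primesIoc 0 u, ‖a p‖ / p) := by
  have hu0 : 0 < u := by linarith
  have hβ : 0 ≤ β := (norm_nonneg _).trans (ha 2 Nat.prime_two)
  set Φ := summatory (fun n => ‖expMul a n‖ / n) u with hΦ
  -- With log u = log n + log(u/n), this part is controlled by Chebyshev through the convolution
  -- identity; the remaining part uses log y ≤ y.
  have hlog : summatory (fun n => ‖expMul a n‖ * Real.log n) u ≤ 2 * β * u * Φ := by
    have h := summatory_expMul_mul_log' (fun p => (‖a p‖ : ℂ)) u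
    simp_rw [expMul_ofReal_norm] at h
    have h' : summatory (fun n => ‖expMul a n‖ * Real.log n) u
        = summatory (fun m => ‖expMul a m‖ * ∑ p ∈ primesIoc 0 (u / m), ‖a p‖ * Real.log p) u := by
      unfold summatory at h ⊢
      simp_rw [← Complex.ofReal_mul, ← Complex.ofReal_sum, ← Complex.ofReal_mul,
        ← Complex.ofReal_sum] at h
      exact Complex.ofReal_injective h
    rw [h', hΦ]
    unfold summatory
    rw [Finset.mul_sum]
    refine Finset.sum_le_sum fun m hm => ?_
    have hm0 : (0 : ℝ) < m := by exact_mod_cast (Finset.mem_Ioc.1 hm).1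
    have h1 : ∑ p ∈ primesIoc 0 (u / m), ‖a p‖ * Real.log p ≤ β * (2 * (u / m)) := by
      calc _ ≤ ∑ p ∈ primesIoc 0 (u / m), β * Real.log p :=
            Finset.sum_le_sum fun p hp => mul_le_mul_of_nonneg_right
              (ha p (prime_of_mem_primesIoc hp)) (Real.log_natCast_nonneg p)
        _ ≤ _ := by
            rw [← Finset.mul_sum]
            gcongr
            exact sum_log_primesIoc_zero_le (by positivity)
    calc _ ≤ ‖expMul a m‖ * (β * (2 * (u / m))) := by gcongr
      _ = _ := by ring
  have hrest : summatory (fun n => ‖expMul a n‖ * (Real.log u - Real.log n)) u ≤ u * Φ := by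
    rw [hΦ]
    unfold summatory
    rw [Finset.mul_sum]
    refine Finset.sum_le_sum fun m hm => ?_
    have hm0 : (0 : ℝ) < m := by exact_mod_cast (Finset.mem_Ioc.1 hm).1
    rw [← Real.log_div hu0.ne' hm0.ne']
    have h1 : Real.log (u / m) ≤ u / m := Real.log_le_self (by positivity)
    calc _ ≤ ‖expMul a m‖ * (u / m) := by gcongr
      _ = _ := by ring
  have hsplit : summatory (fun n => ‖expMul a n‖) u * Real.log u
      = summatory (fun n => ‖expMul a n‖ * Real.log n) u
        + summatory (fun n => ‖expMul a n‖ * (Real.log u - Real.log n)) u := by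
    unfold summatory
    rw [Finset.sum_mul, ← Finset.sum_add_distrib]
    exact Finset.sum_congr rfl fun n _ => by ring
  have hΦle := summatory_norm_expMul_div_le a u
  calc _ ≤ 2 * β * u * Φ + u * Φ := by rw [hsplit]; exact add_le_add hlog hrest
    _ = (2 * β + 1) * u * Φ := by ring
    _ ≤ _ := by gcongr

/-! ### Plancherel's theorem for functions and for Dirichlet series. -/

open MeasureTheory FourierTransform SchwartzMap in
-- Both the L² Fourier transform and the Fourier integral can be moved onto the test function; this
-- identifies the two as distributions.
theorem Lp_fourier_apply_schwartz {h : ℝ → ℂ} (h1 : Integrable h)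
    (H : Lp ℂ 2 (volume : Measure ℝ)) (hH : ∀ᵐ x, H x = h x) (G : 𝓢(ℝ, ℂ)) :
    ∫ x, G x • (𝓕 H) x = ∫ x, G x • 𝓕 h x := by
  have e1 : ∫ x, G x • (𝓕 H) x = Lp.toTemperedDistribution (𝓕 H) G :=
    (Lp.toTemperedDistribution_apply (𝓕 H) G).symm
  have e2 : Lp.toTemperedDistribution (𝓕 H) G = Lp.toTemperedDistribution H (𝓕 G) := by
    rw [← Lp.fourier_toTemperedDistribution_eq, TemperedDistribution.fourier_apply]
  have e3 : Lp.toTemperedDistribution H (𝓕 G) = ∫ x, (𝓕 (G : ℝ → ℂ)) x • h x := by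
    rw [Lp.toTemperedDistribution_apply]
    refine integral_congr_ae ?_
    filter_upwards [hH] with x hx
    rw [hx, SchwartzMap.fourier_coe]
  have e4 := VectorFourier.integral_fourierIntegral_smul_eq_flip (L := innerₗ ℝ)
    Real.continuous_fourierChar continuous_inner (G.integrable (μ := volume)) h1
  rw [flip_innerₗ] at e4
  exact e1.trans (e2.trans (e3.trans e4))

open MeasureTheory FourierTransform in
/-- Plancherel's theorem for functions in `L¹ ∩ L²`, with the Fourier integral. -/
theorem eLpNorm_fourier_eq_of_integrable {h : ℝ → ℂ} (h1 : Integrable h) (h2 : MemLp h 2) :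
    eLpNorm (𝓕 h) 2 = eLpNorm h 2 := by
  obtain ⟨H, hH⟩ : ∃ H : Lp ℂ 2 (volume : Measure ℝ), ∀ᵐ x, H x = h x :=
    ⟨h2.toLp h, h2.coeFn_toLp⟩
  have hcont : Continuous (𝓕 h) :=
    VectorFourier.fourierIntegral_continuous Real.continuous_fourierChar (L := innerₗ ℝ)
      continuous_inner h1
  have hae : ∀ᵐ ξ, (𝓕 H) ξ = 𝓕 h ξ := by
    refine ae_eq_of_integral_contDiff_smul_eq ((Lp.memLp (𝓕 H)).locallyIntegrable one_le_two)
      hcont.locallyIntegrable ?_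
    intro g g_smooth g_cpt
    have hg₁ : HasCompactSupport (Complex.ofRealCLM ∘ g) := g_cpt.comp_left rfl
    have hg₂ : ContDiff ℝ (⊤ : ℕ∞) (Complex.ofRealCLM ∘ g) := by fun_prop
    exact Lp_fourier_apply_schwartz h1 H hH (hg₁.toSchwartzMap hg₂)
  have hn : eLpNorm (𝓕 H : Lp ℂ 2 (volume : Measure ℝ)) 2 = eLpNorm H 2 := by
    have := Lp.norm_fourier_eq H
    rw [Lp.norm_def, Lp.norm_def] at this
    exact (ENNReal.toReal_eq_toReal_iff' (Lp.eLpNorm_ne_top _) (Lp.eLpNorm_ne_top _)).1 this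
  exact (eLpNorm_congr_ae (Filter.EventuallyEq.symm hae)).trans (hn.trans (eLpNorm_congr_ae hH))

open MeasureTheory in
theorem measurable_summatory {E : Type*} [AddCommMonoid E] [MeasurableSpace E] (f : ℕ → E) :
    Measurable (summatory f) :=
  (measurable_from_nat (f := fun N => ∑ n ∈ Finset.Ioc 0 N, f n)).comp Nat.measurable_floor

theorem summatory_norm_le_of_summable {c : ℕ → ℂ} (hc : Summable fun n => ‖c n‖ / n) {u : ℝ}
    (hu : 0 ≤ u) : summatory (fun n => ‖c n‖) u ≤ u * ∑' n, ‖c n‖ / n :=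
  (summatory_norm_le_mul c hu).trans (mul_le_mul_of_nonneg_left
    (hc.sum_le_tsum _ fun n _ => by positivity) hu)

open MeasureTheory FourierTransform in
/-- Plancherel's theorem for Dirichlet series. -/
theorem lintegral_summatory_sq_eq {c : ℕ → ℂ} (hc : Summable fun n => ‖c n‖ / n) {σ : ℝ}
    (hσ : 1 < σ) :
    ∫⁻ w in Set.Ioi (0 : ℝ), ENNReal.ofReal (w ^ (-1 - 2 * σ)) * ‖summatory c w‖ₑ ^ 2
      = ∫⁻ ξ : ℝ, ‖LSeries c (σ - 2 * Real.pi * ξ * Complex.I) /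
          (σ - 2 * Real.pi * ξ * Complex.I)‖ₑ ^ 2 := by
  set K := ∑' n, ‖c n‖ / n with hK
  have hK0 : 0 ≤ K := tsum_nonneg fun n => by positivity
  -- After w = e^{-u} the weighted square of the summatory function becomes |h|² du, and the Fourier
  -- transform of h at ξ is the Mellin transform of the summatory function at -s, s = σ - 2πiξ,
  -- which partial summation identifies with the L-series divided by s.
  set h : ℝ → ℂ := fun u => (Real.exp (σ * u) : ℝ) • summatory c (Real.exp (-u)) with hh
  have hmeas : Measurable h := by
    have := (measurable_summatory c).comp (Real.measurable_exp.comp measurable_neg)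
    exact (by fun_prop : Measurable fun u : ℝ => Real.exp (σ * u)).smul this
  have hzero : ∀ u, 0 < u → h u = 0 := by
    intro u hu
    simp only [hh]
    rw [summatory_of_lt_one c (by simpa using hu), smul_zero]
  have hbound : ∀ u, ‖h u‖ ≤ K * (Set.Iic (0 : ℝ)).indicator (fun u => Real.exp ((σ - 1) * u)) u := by
    intro u
    by_cases hu : 0 < u
    · rw [hzero u hu, Set.indicator_of_notMem (by simpa using hu)]; simp
    · rw [Set.indicator_of_mem (by simpa using hu)]
      simp only [hh]
      rw [norm_smul, Real.norm_of_nonneg (by positivity)]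
      calc _ ≤ Real.exp (σ * u) * (Real.exp (-u) * K) := by
            gcongr
            exact (norm_summatory_le c _).trans (summatory_norm_le_of_summable hc (by positivity))
        _ = K * Real.exp ((σ - 1) * u) := by
            rw [show (σ - 1) * u = σ * u + -u by ring, Real.exp_add]; ring
  have h1 : Integrable h := by
    refine Integrable.mono' (g := fun u => K * (Set.Iic (0 : ℝ)).indicator
      (fun u => Real.exp ((σ - 1) * u)) u) ?_ hmeas.aestronglyMeasurable
      (Filter.Eventually.of_forall hbound)
    refine Integrable.const_mul ?_ K
    rw [integrable_indicator_iff measurableSet_Iic]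
    exact integrableOn_exp_mul_Iic (by linarith) 0
  have hbdd : ∀ u, ‖h u‖ ≤ K := by
    intro u
    refine (hbound u).trans (mul_le_of_le_one_right hK0 ?_)
    by_cases hu : u ∈ Set.Iic (0 : ℝ)
    · rw [Set.indicator_of_mem hu]
      have : u ≤ 0 := hu
      exact Real.exp_le_one_iff.2 (mul_nonpos_of_nonneg_of_nonpos (by linarith) this)
    · rw [Set.indicator_of_notMem hu]; exact zero_le_one
  have h2 : MemLp h 2 := by
    rw [memLp_two_iff_integrable_sq_norm hmeas.aestronglyMeasurable]
    refine Integrable.mono' (h1.norm.const_mul K) (hmeas.norm.pow_const 2).aestronglyMeasurable ?_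
    refine Filter.Eventually.of_forall fun u => ?_
    rw [Real.norm_of_nonneg (by positivity), sq]
    exact mul_le_mul_of_nonneg_right (hbdd u) (norm_nonneg _)
  have hPl := eLpNorm_fourier_eq_of_integrable h1 h2
  have hsq : ∀ φ : ℝ → ℂ, eLpNorm φ 2 ^ 2 = ∫⁻ u, ‖φ u‖ₑ ^ 2 := by
    intro φ
    have := eLpNorm_nnreal_pow_eq_lintegral (f := φ) (μ := volume) (p := 2) two_ne_zero
    simpa using this
  have hL : ∫⁻ w in Set.Ioi (0 : ℝ), ENNReal.ofReal (w ^ (-1 - 2 * σ)) * ‖summatory c w‖ₑ ^ 2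
      = ∫⁻ u, ‖h u‖ₑ ^ 2 := by
    have himg : (fun u : ℝ => Real.exp (-u)) '' Set.univ = Set.Ioi 0 := by
      rw [Set.image_univ]
      ext y
      simp only [Set.mem_range, Set.mem_Ioi]
      constructor
      · rintro ⟨u, rfl⟩; positivity
      · intro hy; exact ⟨-Real.log y, by simp [Real.exp_log hy]⟩
    rw [← himg, lintegral_image_eq_lintegral_abs_deriv_mul MeasurableSet.univ
      (f' := fun u => -Real.exp (-u))
      (fun u _ => by
        have := (Real.hasDerivAt_exp (-u)).comp u (hasDerivAt_neg u)
        simp only [mul_neg, mul_one] at this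
        exact this.hasDerivWithinAt)
      (fun u _ v _ huv => by simpa using huv)]
    rw [Measure.restrict_univ]
    refine lintegral_congr fun u => ?_
    simp only [hh]
    rw [enorm_smul, mul_pow, ← mul_assoc, ← ENNReal.ofReal_mul (abs_nonneg _)]
    congr 1
    rw [Real.enorm_of_nonneg (by positivity), ← ENNReal.ofReal_pow (by positivity), abs_neg,
      abs_of_pos (by positivity), ← Real.exp_mul, ← Real.exp_add, ← Real.exp_nat_mul]
    congr 2
    push_cast; ring
  rw [hL, ← hsq, ← hPl, hsq]
  refine lintegral_congr fun ξ => ?_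
  congr 2
  set s : ℂ := σ - 2 * Real.pi * ξ * Complex.I with hs
  have hsre : s.re = σ := by simp [hs]
  have hsim : s.im = -(2 * Real.pi * ξ) := by simp [hs]
  have hmel := mellin_eq_fourier (summatory c) (s := -s)
  have hfun : (fun u : ℝ => Real.exp (-(-s).re * u) • summatory c (Real.exp (-u))) = h := by
    funext u
    simp [hh, hsre]
  have harg : (-s).im / (2 * Real.pi) = ξ := by
    rw [Complex.neg_im, hsim, neg_neg]; field_simp
  rw [hfun, harg] at hmel
  rw [← hmel]
  have hs0 : s ≠ 0 := by
    intro h0; rw [h0] at hsre; simp at hsre; linarith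
  have hsummable : LSeriesSummable c s := by
    refine LSeriesSummable.of_re_le_re (s := 1) (by rw [hsre]; simpa using hσ.le) ?_
    refine Summable.of_norm_bounded hc fun n => ?_
    rw [LSeries.norm_term_eq]
    split_ifs with h0
    · positivity
    · simp
  have hLS := LSeries_eq_mul_integral c (r := 1) zero_le_one (s := s) (by rw [hsre]; exact hσ)
    hsummable (by
      refine Asymptotics.IsBigO.of_bound K (Filter.Eventually.of_forall fun n => ?_)
      have h3 := (norm_summatory_le c n).trans (summatory_norm_le_of_summable hc n.cast_nonneg)
      rw [summatory, Nat.floor_natCast] at h3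
      rw [Real.rpow_one, Real.norm_of_nonneg n.cast_nonneg, mul_comm]
      exact h3)
  rw [eq_div_iff hs0, mul_comm, hLS]
  congr 1
  rw [mellin, setIntegral_eq_of_subset_of_ae_sdiff_eq_zero (s := Set.Ioi 1)
    measurableSet_Ioi.nullMeasurableSet (Set.Ioi_subset_Ioi zero_le_one) ?_]
  · refine setIntegral_congr_fun measurableSet_Ioi fun t ht => ?_
    simp only [smul_eq_mul]
    rw [mul_comm, show -s - 1 = -(s + 1) by ring]
    rfl
  · filter_upwards [Measure.ae_ne volume (1 : ℝ)] with t ht1 ht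
    have : t < 1 := lt_of_le_of_ne (not_lt.1 ht.2) ht1
    rw [summatory_of_lt_one c this, smul_zero]

/-! ### Mean squares of Dirichlet polynomials over primes. -/

open MeasureTheory Complex in
theorem integrable_gaussian_mul_exp (c y : ℝ) :
    Integrable (fun ξ : ℝ => (Real.exp (-Real.pi * (ξ - c) ^ 2) : ℂ) *
      cexp (2 * Real.pi * ξ * y * I)) := by
  have h : Integrable (fun ξ : ℝ => (Real.exp (-Real.pi * (ξ - c) ^ 2) : ℂ)) :=
    ((integrable_exp_neg_mul_sq Real.pi_pos).comp_sub_right c).ofReal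
  refine h.mul_bdd (c := 1) (by fun_prop) (Filter.Eventually.of_forall fun ξ => ?_)
  have : (2 * Real.pi * ξ * y * I : ℂ) = ((2 * Real.pi * ξ * y : ℝ) : ℂ) * I := by push_cast; ring
  rw [this, Complex.norm_exp_ofReal_mul_I]

open MeasureTheory Complex in
-- The Gaussian is its own Fourier transform, and moving its centre to c changes only the phase.
theorem norm_integral_gaussian_mul_exp (c y : ℝ) :
    ‖∫ ξ : ℝ, (Real.exp (-Real.pi * (ξ - c) ^ 2) : ℂ) * cexp (2 * Real.pi * ξ * y * I)‖
      = Real.exp (-Real.pi * y ^ 2) := by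
  have h1 : ∫ ξ : ℝ, (Real.exp (-Real.pi * (ξ - c) ^ 2) : ℂ) * cexp (2 * Real.pi * ξ * y * I)
      = cexp ((2 * Real.pi * c * y : ℝ) * I) *
        ∫ ξ : ℝ, cexp (I * (2 * Real.pi * y) * ξ) * cexp (-Real.pi * ξ ^ 2) := by
    rw [← integral_add_right_eq_self _ c, ← integral_const_mul]
    refine integral_congr_ae (Filter.Eventually.of_forall fun ξ => ?_)
    simp only
    push_cast
    rw [← Complex.exp_add, ← Complex.exp_add, ← Complex.exp_add]
    congr 1
    ring
  have hpi : (Real.pi : ℂ) ≠ 0 := by exact_mod_cast Real.pi_ne_zero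
  rw [h1, fourierIntegral_gaussian (by simpa using Real.pi_pos), div_self hpi, one_cpow, one_mul,
    norm_mul, Complex.norm_exp_ofReal_mul_I, one_mul, Complex.norm_exp]
  congr 1
  have : (-(2 * Real.pi * y : ℂ) ^ 2 / (4 * Real.pi)) = ((-Real.pi * y ^ 2 : ℝ) : ℂ) := by
    push_cast; field_simp; ring
  rw [this, ofReal_re]

open MeasureTheory Complex in
-- Opening the square leaves one Gaussian transform for each pair of frequencies. Taking absolute
-- values suffices, since the decay in l_p - l_q already confines the double sum to nearby
-- frequencies.
theorem integral_gaussian_mul_norm_sq_le (S : Finset ℕ) (b : ℕ → ℂ) (l : ℕ → ℝ) (c : ℝ) :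
    ∫ ξ : ℝ, Real.exp (-Real.pi * (ξ - c) ^ 2) *
      ‖∑ p ∈ S, b p * cexp (2 * Real.pi * ξ * l p * I)‖ ^ 2
      ≤ ∑ p ∈ S, ∑ q ∈ S, ‖b p‖ * ‖b q‖ * Real.exp (-Real.pi * (l p - l q) ^ 2) := by
  have hexp : ∀ ξ : ℝ, ((Real.exp (-Real.pi * (ξ - c) ^ 2) *
      ‖∑ p ∈ S, b p * cexp (2 * Real.pi * ξ * l p * I)‖ ^ 2 : ℝ) : ℂ)
      = ∑ p ∈ S, ∑ q ∈ S, (b p * starRingEnd ℂ (b q)) *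
        ((Real.exp (-Real.pi * (ξ - c) ^ 2) : ℂ) *
          cexp (2 * Real.pi * ξ * (l p - l q : ℝ) * I)) := by
    intro ξ
    rw [Complex.ofReal_mul, Complex.ofReal_pow, ← Complex.mul_conj', map_sum, Finset.sum_mul_sum,
      Finset.mul_sum]
    refine Finset.sum_congr rfl fun p _ => ?_
    rw [Finset.mul_sum]
    refine Finset.sum_congr rfl fun q _ => ?_
    rw [map_mul, ← Complex.exp_conj]
    have : (starRingEnd ℂ) (2 * Real.pi * ξ * l q * I) = -(2 * Real.pi * ξ * l q * I) := by
      simp only [map_mul, conj_ofReal, conj_I]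
      have : (starRingEnd ℂ) 2 = 2 := by simpa using conj_ofReal 2
      rw [this]; ring
    rw [this, show (2 * Real.pi * ξ * (l p - l q : ℝ) * I : ℂ)
      = 2 * Real.pi * ξ * l p * I + -(2 * Real.pi * ξ * l q * I) by push_cast; ring,
      Complex.exp_add]
    ring
  have hint : ((∫ ξ : ℝ, Real.exp (-Real.pi * (ξ - c) ^ 2) *
      ‖∑ p ∈ S, b p * cexp (2 * Real.pi * ξ * l p * I)‖ ^ 2 : ℝ) : ℂ)
      = ∑ p ∈ S, ∑ q ∈ S, (b p * starRingEnd ℂ (b q)) *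
        ∫ ξ : ℝ, (Real.exp (-Real.pi * (ξ - c) ^ 2) : ℂ) *
          cexp (2 * Real.pi * ξ * (l p - l q : ℝ) * I) := by
    rw [← integral_complex_ofReal]
    simp_rw [hexp]
    rw [integral_finsetSum]
    · refine Finset.sum_congr rfl fun p _ => ?_
      rw [integral_finsetSum]
      · refine Finset.sum_congr rfl fun q _ => ?_
        rw [integral_const_mul]
      · exact fun q _ => (integrable_gaussian_mul_exp c _).const_mul _
    · exact fun p _ => integrable_finsetSum _ fun q _ =>
        (integrable_gaussian_mul_exp c _).const_mul _
  refine (Real.le_norm_self _).trans ?_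
  rw [← Complex.norm_real, hint]
  refine (norm_sum_le _ _).trans (Finset.sum_le_sum fun p _ => (norm_sum_le _ _).trans
    (Finset.sum_le_sum fun q _ => ?_))
  rw [norm_mul, norm_mul, norm_integral_gaussian_mul_exp, RCLike.norm_conj]

open MeasureTheory Complex in
theorem integrable_gaussian_mul_norm_sq (S : Finset ℕ) (b : ℕ → ℂ) (l : ℕ → ℝ) (c : ℝ) :
    Integrable (fun ξ : ℝ => Real.exp (-Real.pi * (ξ - c) ^ 2) *
      ‖∑ p ∈ S, b p * cexp (2 * Real.pi * ξ * l p * I)‖ ^ 2) := by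
  have h : Integrable (fun ξ : ℝ => Real.exp (-Real.pi * (ξ - c) ^ 2)) :=
    (integrable_exp_neg_mul_sq Real.pi_pos).comp_sub_right c
  refine h.mul_bdd (c := (∑ p ∈ S, ‖b p‖) ^ 2) (by fun_prop) (Filter.Eventually.of_forall fun ξ => ?_)
  rw [norm_pow, norm_norm]
  gcongr
  refine (norm_sum_le _ _).trans (Finset.sum_le_sum fun p _ => ?_)
  have : (2 * Real.pi * ξ * l p * I : ℂ) = ((2 * Real.pi * ξ * l p : ℝ) : ℂ) * I := by
    push_cast; ring
  rw [norm_mul, this, Complex.norm_exp_ofReal_mul_I, mul_one]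

/-- Primes interact only with primes of comparable size. -/
theorem sum_sum_prime_gaussian_le {α : ℝ} (hα : 0 < α) (hα1 : α ≤ 1) (S : Finset ℕ)
    (hS : ∀ p ∈ S, p.Prime) :
    ∑ p ∈ S, ∑ q ∈ S, (Real.log p / p * (p : ℝ) ^ (-α)) * (Real.log q / q * (q : ℝ) ^ (-α)) *
      Real.exp (-Real.pi * (Real.log p - Real.log q) ^ 2) ≤ 128 / α := by
  set w : ℕ → ℝ := fun p => Real.log p / p * (p : ℝ) ^ (-α) with hw
  have hw0 : ∀ p, 0 ≤ w p := fun p => by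
    have := Real.log_natCast_nonneg p
    positivity
  -- At y = log p - log q the majorant e^{-|y|} is min(p/q, q/p), so the double sum becomes
  -- arithmetic.
  have hexp : ∀ y : ℝ, Real.exp (-Real.pi * y ^ 2) ≤ 2 * Real.exp (-|y|) := by
    intro y
    have h2 : Real.exp (1 / 2) ≤ 2 := by
      have h3 : Real.exp (1 / 2) ^ 2 = Real.exp 1 := by
        rw [← Real.exp_nat_mul]; norm_num
      have := Real.exp_one_lt_d9
      nlinarith [Real.exp_pos (1 / 2 : ℝ)]
    calc Real.exp (-Real.pi * y ^ 2) ≤ Real.exp (1 / 2 + -|y|) := by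
          apply Real.exp_le_exp.2
          have := Real.pi_gt_three
          have h5 : |y| ^ 2 = y ^ 2 := sq_abs y
          nlinarith [sq_nonneg (|y| - 1 / 2), sq_nonneg y]
      _ = Real.exp (1 / 2) * Real.exp (-|y|) := Real.exp_add _ _
      _ ≤ _ := by gcongr
  have hmin : ∀ p ∈ S, ∀ q ∈ S, Real.exp (-|Real.log p - Real.log q|)
      ≤ (if q ≤ p then (q : ℝ) / p else 0) + (if p ≤ q then (p : ℝ) / q else 0) := by
    intro p hp q hq
    have hp0 : (0 : ℝ) < p := by exact_mod_cast (hS p hp).pos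
    have hq0 : (0 : ℝ) < q := by exact_mod_cast (hS q hq).pos
    have key : ∀ x y : ℝ, 0 < x → 0 < y → y ≤ x →
        Real.exp (-|Real.log x - Real.log y|) = y / x := by
      intro x y hx hy hxy
      rw [abs_of_nonneg (sub_nonneg.2 (Real.log_le_log hy hxy)), neg_sub, Real.exp_sub,
        Real.exp_log hx, Real.exp_log hy]
    rcases le_total q p with h | h
    · rw [key _ _ hp0 hq0 (by exact_mod_cast h), if_pos h]
      have : (0 : ℝ) ≤ if p ≤ q then (p : ℝ) / q else 0 := by positivity
      linarith
    · rw [abs_sub_comm, key _ _ hq0 hp0 (by exact_mod_cast h), if_pos h]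
      have : (0 : ℝ) ≤ if q ≤ p then (q : ℝ) / p else 0 := by positivity
      linarith
  -- The smaller prime q is summed first, by Chebyshev, and leaves O(w(p)); only the outer sum costs
  -- 1/α. Without the factor q/p the bound would be 1/α².
  have hhalf : ∑ p ∈ S, ∑ q ∈ S, w p * w q * (if q ≤ p then (q : ℝ) / p else 0) ≤ 32 / α := by
    calc _ ≤ ∑ p ∈ S, 2 * w p := by
          refine Finset.sum_le_sum fun p hp => ?_
          have hp0 : (0 : ℝ) < p := by exact_mod_cast (hS p hp).pos
          have h1 : ∑ q ∈ S, w p * w q * (if q ≤ p then (q : ℝ) / p else 0)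
              ≤ ∑ q ∈ S with q ≤ p, w p / p * Real.log q := by
            rw [Finset.sum_filter]
            refine Finset.sum_le_sum fun q hq => ?_
            split_ifs with h
            · have hq1 : (1 : ℝ) ≤ q := by exact_mod_cast (hS q hq).one_le
              have h3 : (q : ℝ) ^ (-α) ≤ 1 := Real.rpow_le_one_of_one_le_of_nonpos hq1 (by linarith)
              have h4 := Real.log_natCast_nonneg q
              calc w p * w q * ((q : ℝ) / p) = w p / p * (Real.log q * (q : ℝ) ^ (-α)) := by
                    simp only [hw]; field_simp
                _ ≤ w p / p * (Real.log q * 1) := by have := hw0 p; gcongr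
                _ = _ := by ring
            · simp
          refine h1.trans ?_
          rw [← Finset.mul_sum]
          have h2 : ∑ q ∈ S with q ≤ p, Real.log q ≤ 2 * p := by
            refine le_trans (Finset.sum_le_sum_of_subset_of_nonneg ?_
              fun q _ _ => Real.log_natCast_nonneg q) (sum_log_primesIoc_zero_le hp0.le)
            intro q hq
            obtain ⟨h3, h4⟩ := Finset.mem_filter.1 hq
            exact (mem_primesIoc le_rfl).2 ⟨hS q h3, by exact_mod_cast (hS q h3).pos,
              by exact_mod_cast h4⟩
          calc w p / p * _ ≤ w p / p * (2 * p) := by have := hw0 p; gcongr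
            _ = 2 * w p := by field_simp
      _ ≤ 2 * (16 / α) := by
          rw [← Finset.mul_sum]
          gcongr
          exact sum_prime_log_mul_rpow_le hα (by linarith) S hS
      _ = _ := by ring
  have hhalf' : ∑ p ∈ S, ∑ q ∈ S, w p * w q * (if p ≤ q then (p : ℝ) / q else 0) ≤ 32 / α := by
    rw [Finset.sum_comm]
    refine le_trans (le_of_eq ?_) hhalf
    refine Finset.sum_congr rfl fun p _ => Finset.sum_congr rfl fun q _ => by rw [mul_comm (w q)]
  calc _ ≤ ∑ p ∈ S, ∑ q ∈ S, (2 * (w p * w q * (if q ≤ p then (q : ℝ) / p else 0)) +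
        2 * (w p * w q * (if p ≤ q then (p : ℝ) / q else 0))) := by
        refine Finset.sum_le_sum fun p hp => Finset.sum_le_sum fun q hq => ?_
        have h1 := (hexp (Real.log p - Real.log q)).trans
          (mul_le_mul_of_nonneg_left (hmin p hp q hq) two_pos.le)
        have := mul_le_mul_of_nonneg_left h1 (mul_nonneg (hw0 p) (hw0 q))
        refine this.trans (le_of_eq (by ring))
    _ ≤ 2 * (32 / α) + 2 * (32 / α) := by
        simp_rw [Finset.sum_add_distrib, ← Finset.mul_sum]
        gcongr
    _ = _ := by ring

open MeasureTheory Complex in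
/-- Mean square of a Dirichlet polynomial over primes on an interval of length one. -/
theorem lintegral_unit_interval_prime_sum_le {α β : ℝ} (hα : 0 < α) (hα1 : α ≤ 1)
    (S : Finset ℕ) (hS : ∀ p ∈ S, p.Prime) {b : ℕ → ℂ}
    (hb : ∀ p ∈ S, ‖b p‖ ≤ β * (Real.log p / p * (p : ℝ) ^ (-α))) (m : ℝ) :
    ∫⁻ ξ in Set.Icc m (m + 1), ‖∑ p ∈ S, b p * cexp (2 * Real.pi * ξ * Real.log p * I)‖ₑ ^ 2
      ≤ ENNReal.ofReal (400 * β ^ 2 / α) := by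
  set c := m + 1 / 2 with hc
  set φ : ℝ → ℝ := fun ξ => Real.exp (-Real.pi * (ξ - c) ^ 2) *
      ‖∑ p ∈ S, b p * cexp (2 * Real.pi * ξ * Real.log p * I)‖ ^ 2 with hφ
  have h1 : ∫ ξ, φ ξ ≤ 128 * β ^ 2 / α := by
    refine (integral_gaussian_mul_norm_sq_le S b (fun p => Real.log p) c).trans ?_
    calc _ ≤ ∑ p ∈ S, ∑ q ∈ S, β ^ 2 * ((Real.log p / p * (p : ℝ) ^ (-α)) *
          (Real.log q / q * (q : ℝ) ^ (-α)) *
          Real.exp (-Real.pi * (Real.log p - Real.log q) ^ 2)) := by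
          refine Finset.sum_le_sum fun p hp => Finset.sum_le_sum fun q hq => ?_
          have := mul_le_mul (hb p hp) (hb q hq) (norm_nonneg _) ((norm_nonneg _).trans (hb p hp))
          calc _ ≤ (β * (Real.log p / p * (p : ℝ) ^ (-α))) * (β * (Real.log q / q * (q : ℝ) ^ (-α)))
                * Real.exp (-Real.pi * (Real.log p - Real.log q) ^ 2) := by gcongr
            _ = _ := by ring
      _ ≤ β ^ 2 * (128 / α) := by
          simp_rw [← Finset.mul_sum]
          gcongr
          exact sum_sum_prime_gaussian_le hα hα1 S hS
      _ = _ := by ring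
  have h2 : ∫⁻ ξ, ENNReal.ofReal (φ ξ) ≤ ENNReal.ofReal (128 * β ^ 2 / α) := by
    rw [← ofReal_integral_eq_lintegral_ofReal (integrable_gaussian_mul_norm_sq S b _ c)
      (Filter.Eventually.of_forall fun ξ => by positivity)]
    exact ENNReal.ofReal_le_ofReal h1
  calc _ ≤ ∫⁻ ξ in Set.Icc m (m + 1), ENNReal.ofReal 3 * ENNReal.ofReal (φ ξ) := by
        refine setLIntegral_mono (by fun_prop) fun ξ hξ => ?_
        rw [← ofReal_norm, ← ENNReal.ofReal_pow (norm_nonneg _),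
          ← ENNReal.ofReal_mul (by norm_num)]
        refine ENNReal.ofReal_le_ofReal ?_
        -- The Gaussian is centred at the midpoint, so on the interval its exponent is at least -π/4
        -- ≥ -1.
        have h3 : (1 / 3 : ℝ) ≤ Real.exp (-Real.pi * (ξ - c) ^ 2) := by
          have h4 : (ξ - c) ^ 2 ≤ 1 / 4 := by
            have h5 : |ξ - c| ≤ 1 / 2 := by rw [abs_le]; constructor <;> linarith [hξ.1, hξ.2]
            have := pow_le_pow_left₀ (abs_nonneg _) h5 2
            rw [sq_abs] at this
            linarith
          have h6 : Real.exp (-1) ≤ Real.exp (-Real.pi * (ξ - c) ^ 2) := by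
            apply Real.exp_le_exp.2
            have := Real.pi_lt_four
            have := Real.pi_pos
            nlinarith [sq_nonneg (ξ - c)]
          refine le_trans ?_ h6
          rw [Real.exp_neg, one_div]
          exact inv_anti₀ (Real.exp_pos 1) (by have := Real.exp_one_lt_d9; linarith)
        simp only [hφ]
        have := mul_le_mul_of_nonneg_right h3
          (sq_nonneg ‖∑ p ∈ S, b p * cexp (2 * Real.pi * ξ * Real.log p * I)‖)
        linarith
    _ ≤ ∫⁻ ξ, ENNReal.ofReal 3 * ENNReal.ofReal (φ ξ) := setLIntegral_le_lintegral _ _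
    _ = ENNReal.ofReal 3 * ∫⁻ ξ, ENNReal.ofReal (φ ξ) := lintegral_const_mul _ (by fun_prop)
    _ ≤ ENNReal.ofReal 3 * ENNReal.ofReal (128 * β ^ 2 / α) := by gcongr
    _ = ENNReal.ofReal (3 * (128 * β ^ 2 / α)) := (ENNReal.ofReal_mul (by norm_num)).symm
    _ ≤ _ := by
        refine ENNReal.ofReal_le_ofReal ?_
        calc 3 * (128 * β ^ 2 / α) = 384 * β ^ 2 / α := by ring
          _ ≤ _ := by gcongr; norm_num

open MeasureTheory Complex in
theorem norm_inv_vertical_le {σ ξ R : ℝ} (hR : 0 < R)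
    (h : R ≤ σ ∨ R ≤ |2 * Real.pi * ξ|) (hσ : 0 < σ) :
    ‖(σ - 2 * Real.pi * ξ * I : ℂ)⁻¹‖ ≤ R⁻¹ := by
  rw [norm_inv]
  refine inv_anti₀ hR ?_
  have hre : (σ - 2 * Real.pi * ξ * I : ℂ).re = σ := by simp
  have him : (σ - 2 * Real.pi * ξ * I : ℂ).im = -(2 * Real.pi * ξ) := by simp
  rcases h with h | h
  · refine h.trans ?_
    calc σ = |(σ - 2 * Real.pi * ξ * I : ℂ).re| := by rw [hre, abs_of_pos hσ]
      _ ≤ _ := abs_re_le_norm _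
  · refine h.trans ?_
    calc |2 * Real.pi * ξ| = |(σ - 2 * Real.pi * ξ * I : ℂ).im| := by rw [him, abs_neg]
      _ ≤ _ := abs_im_le_norm _

theorem tsum_ofReal_div_sq_le {D T : ℝ} (hD : 0 ≤ D) (hT : 1 ≤ T) :
    ∑' n : ℕ, ENNReal.ofReal (D / (T + n) ^ 2) ≤ ENNReal.ofReal (2 * D / T) := by
  refine ENNReal.tsum_le_of_sum_range_le fun N => ?_
  rw [← ENNReal.ofReal_sum_of_nonneg fun n _ => by positivity]
  refine ENNReal.ofReal_le_ofReal ?_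
  have h : ∑ n ∈ Finset.range N, D / (T + n) ^ 2 ≤ 2 * D * (1 / T - 1 / (T + N)) := by
    induction N with
    | zero => simp
    | succ N ih =>
      rw [Finset.sum_range_succ]
      have hTN : 0 < T + N := by positivity
      have : D / (T + N) ^ 2 ≤ 2 * D * (1 / (T + N) - 1 / (T + (N + 1 : ℕ))) := by
        push_cast
        rw [show 1 / (T + (N : ℝ)) - 1 / (T + (N + 1)) = 1 / ((T + N) * (T + (N + 1))) by
          field_simp; ring]
        rw [mul_one_div, div_le_div_iff₀ (by positivity) (by positivity)]
        have hN : (0 : ℝ) ≤ N := N.cast_nonneg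
        have : T + (N + 1) ≤ 2 * (T + N) := by linarith
        calc D * ((T + N) * (T + (N + 1))) ≤ D * ((T + N) * (2 * (T + N))) := by gcongr
          _ = _ := by ring
      linarith
  refine h.trans ?_
  have : 0 ≤ 1 / (T + (N : ℝ)) := by positivity
  calc 2 * D * (1 / T - 1 / (T + N)) ≤ 2 * D * (1 / T) := by gcongr; linarith
    _ = _ := by ring

open MeasureTheory Complex in
/-- A weighted mean square over the tail of a vertical line. -/
theorem lintegral_tail_div_sq_le {Q : ℝ → ℂ} {D σ T : ℝ} (hD : 0 ≤ D)
    (hσ : 0 < σ) (hT : 1 ≤ T)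
    (hunit : ∀ m : ℝ, ∫⁻ ξ in Set.Icc m (m + 1), ‖Q ξ‖ₑ ^ 2 ≤ ENNReal.ofReal D) :
    ∫⁻ ξ in {ξ : ℝ | T < |2 * Real.pi * ξ|}, ‖Q ξ / (σ - 2 * Real.pi * ξ * I)‖ₑ ^ 2
      ≤ ENNReal.ofReal (4 * D / T) := by
  set τ := T / (2 * Real.pi) with hτ
  have hpi := Real.pi_gt_three
  have hτT : 2 * Real.pi * τ = T := by rw [hτ]; field_simp
  have habs : ∀ ξ : ℝ, |2 * Real.pi * ξ| = 2 * Real.pi * |ξ| := fun ξ => by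
    rw [abs_mul, abs_of_pos (by positivity : 0 < 2 * Real.pi)]
  set I₁ : ℕ → Set ℝ := fun n => Set.Icc (τ + n) (τ + n + 1)
  set I₂ : ℕ → Set ℝ := fun n => Set.Icc (-τ - n - 1) (-τ - n - 1 + 1)
  have hcover : {ξ : ℝ | T < |2 * Real.pi * ξ|} ⊆ (⋃ n, I₁ n) ∪ ⋃ n, I₂ n := by
    intro ξ hξ
    have h1 : τ < |ξ| := by
      have : T < |2 * Real.pi * ξ| := hξ
      rw [habs, ← hτT] at this
      exact lt_of_mul_lt_mul_left this (by positivity)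
    have hfl1 := Nat.floor_le (by linarith : 0 ≤ |ξ| - τ)
    have hfl2 := Nat.lt_floor_add_one (|ξ| - τ)
    rcases le_total 0 ξ with h | h
    · rw [abs_of_nonneg h] at hfl1 hfl2
      exact Or.inl (Set.mem_iUnion.2 ⟨⌊ξ - τ⌋₊, by constructor <;> linarith⟩)
    · rw [abs_of_nonpos h] at hfl1 hfl2
      exact Or.inr (Set.mem_iUnion.2 ⟨⌊-ξ - τ⌋₊, by constructor <;> linarith⟩)
  have hpiece : ∀ (n : ℕ) (m : ℝ), (∀ ξ ∈ Set.Icc m (m + 1), T + n ≤ |2 * Real.pi * ξ|) →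
      ∫⁻ ξ in Set.Icc m (m + 1), ‖Q ξ / (σ - 2 * Real.pi * ξ * I)‖ₑ ^ 2
        ≤ ENNReal.ofReal (D / (T + n) ^ 2) := by
    intro n m hm
    have hTn : 0 < T + n := by positivity
    calc _ ≤ ∫⁻ ξ in Set.Icc m (m + 1), ENNReal.ofReal (((T + n)⁻¹) ^ 2) * ‖Q ξ‖ₑ ^ 2 := by
          refine setLIntegral_mono' measurableSet_Icc fun ξ hξ => ?_
          rw [div_eq_mul_inv, enorm_mul, mul_pow, mul_comm]
          gcongr
          rw [← ofReal_norm, ← ENNReal.ofReal_pow (norm_nonneg _)]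
          gcongr
          exact norm_inv_vertical_le hTn (Or.inr (hm ξ hξ)) hσ
      _ = ENNReal.ofReal (((T + n)⁻¹) ^ 2) * ∫⁻ ξ in Set.Icc m (m + 1), ‖Q ξ‖ₑ ^ 2 :=
          lintegral_const_mul' _ _ ENNReal.ofReal_ne_top
      _ ≤ ENNReal.ofReal (((T + n)⁻¹) ^ 2) * ENNReal.ofReal D := by gcongr; exact hunit m
      _ = _ := by
          rw [← ENNReal.ofReal_mul (by positivity)]
          congr 1
          rw [inv_pow]; field_simp
  have hsum := tsum_ofReal_div_sq_le hD hT
  have hU1 : ∫⁻ ξ in ⋃ n, I₁ n, ‖Q ξ / (σ - 2 * Real.pi * ξ * I)‖ₑ ^ 2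
      ≤ ENNReal.ofReal (2 * D / T) := by
    refine (lintegral_iUnion_le _ _).trans (le_trans (ENNReal.tsum_le_tsum fun n => ?_) hsum)
    refine hpiece n _ fun ξ hξ => ?_
    have hn : (0 : ℝ) ≤ n := n.cast_nonneg
    have h1 : τ + n ≤ |ξ| := hξ.1.trans (le_abs_self _)
    rw [habs, ← hτT]
    nlinarith
  have hU2 : ∫⁻ ξ in ⋃ n, I₂ n, ‖Q ξ / (σ - 2 * Real.pi * ξ * I)‖ₑ ^ 2
      ≤ ENNReal.ofReal (2 * D / T) := by
    refine (lintegral_iUnion_le _ _).trans (le_trans (ENNReal.tsum_le_tsum fun n => ?_) hsum)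
    refine hpiece n _ fun ξ hξ => ?_
    have hn : (0 : ℝ) ≤ n := n.cast_nonneg
    have h1 : τ + n ≤ |ξ| := by
      have := neg_abs_le ξ
      linarith [hξ.2, neg_le_abs ξ]
    rw [habs, ← hτT]
    nlinarith
  calc _ ≤ ∫⁻ ξ in (⋃ n, I₁ n) ∪ ⋃ n, I₂ n, ‖Q ξ / (σ - 2 * Real.pi * ξ * I)‖ₑ ^ 2 :=
        lintegral_mono_set hcover
    _ ≤ _ := lintegral_union_le _ _ _
    _ ≤ ENNReal.ofReal (2 * D / T) + ENNReal.ofReal (2 * D / T) := add_le_add hU1 hU2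
    _ = _ := by
        rw [← ENNReal.ofReal_add (by positivity) (by positivity)]
        congr 1; ring

open MeasureTheory Complex in
-- The unit-interval bound for Q makes the mean square of Q/s O(D) on the whole line and O(D/T) on
-- the tail |2πξ| > T. Bounding G by A on the central range and by B on the tail gives the two
-- terms; T^{-1/2} in the final estimate comes from B²/T.
theorem lintegral_mul_div_sq_le {G Q : ℝ → ℂ} {D σ T A B : ℝ} (hD : 0 ≤ D)
    (hσ : 1 ≤ σ) (hT : 1 ≤ T)
    (hunit : ∀ m : ℝ, ∫⁻ ξ in Set.Icc m (m + 1), ‖Q ξ‖ₑ ^ 2 ≤ ENNReal.ofReal D)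
    (hA : ∀ ξ : ℝ, |2 * Real.pi * ξ| ≤ T → ‖G ξ‖ ≤ A) (hB : ∀ ξ, ‖G ξ‖ ≤ B) :
    ∫⁻ ξ : ℝ, ‖G ξ * Q ξ / (σ - 2 * Real.pi * ξ * I)‖ₑ ^ 2
      ≤ ENNReal.ofReal (5 * D * (A ^ 2 + B ^ 2 / T)) := by
  have hmeas : ∀ T : ℝ, MeasurableSet {ξ : ℝ | T < |2 * Real.pi * ξ|} := fun T =>
    measurableSet_lt measurable_const (by fun_prop)
  have hbound : ∀ (s : Set ℝ) (K : ℝ), MeasurableSet s → (∀ ξ ∈ s, ‖G ξ‖ ≤ K) →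
      ∫⁻ ξ in s, ‖G ξ * Q ξ / (σ - 2 * Real.pi * ξ * I)‖ₑ ^ 2
      ≤ ENNReal.ofReal (K ^ 2) * ∫⁻ ξ in s, ‖Q ξ / (σ - 2 * Real.pi * ξ * I)‖ₑ ^ 2 := by
    intro s K hs hK
    rw [← lintegral_const_mul' _ _ ENNReal.ofReal_ne_top]
    refine setLIntegral_mono' hs fun ξ hξ => ?_
    rw [mul_div_assoc, enorm_mul, mul_pow, ← ofReal_norm, ← ENNReal.ofReal_pow (norm_nonneg _)]
    gcongr
    exact hK ξ hξ
  have hwhole : ∫⁻ ξ : ℝ, ‖Q ξ / (σ - 2 * Real.pi * ξ * I)‖ₑ ^ 2 ≤ ENNReal.ofReal (5 * D) := by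
    rw [← lintegral_add_compl _ (hmeas 1)]
    have h1 := lintegral_tail_div_sq_le hD (by linarith : 0 < σ) le_rfl hunit
    have h2 : ∫⁻ ξ in {ξ : ℝ | 1 < |2 * Real.pi * ξ|}ᶜ, ‖Q ξ / (σ - 2 * Real.pi * ξ * I)‖ₑ ^ 2
        ≤ ENNReal.ofReal D := by
      refine le_trans ?_ (hunit (-(1 / 2)))
      refine le_trans (lintegral_mono_set (t := Set.Icc (-(1 / 2)) (-(1 / 2) + 1)) ?_) ?_
      · intro ξ hξ
        have h3 : |2 * Real.pi * ξ| ≤ 1 := not_lt.1 hξ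
        rw [abs_le] at h3
        have := Real.pi_gt_three
        constructor <;> nlinarith [h3.1, h3.2]
      · refine setLIntegral_mono' measurableSet_Icc fun ξ _ => ?_
        gcongr
        rw [← ofReal_norm, ← ofReal_norm]
        gcongr
        rw [div_eq_mul_inv, norm_mul]
        refine mul_le_of_le_one_right (norm_nonneg _) ?_
        simpa using norm_inv_vertical_le (ξ := ξ) zero_lt_one (Or.inl hσ) (by linarith)
    calc _ ≤ ENNReal.ofReal (4 * D / 1) + ENNReal.ofReal D := add_le_add h1 h2
      _ = _ := by
          rw [← ENNReal.ofReal_add (by positivity) hD]; congr 1; ring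
  rw [← lintegral_add_compl _ (hmeas T)]
  have h1 := hbound _ B (hmeas T) (fun ξ _ => hB ξ)
  have h2 := hbound _ A (hmeas T).compl (fun ξ hξ => hA ξ (not_lt.1 hξ))
  calc _ ≤ ENNReal.ofReal (B ^ 2) * ENNReal.ofReal (4 * D / T)
        + ENNReal.ofReal (A ^ 2) * ENNReal.ofReal (5 * D) := by
        refine add_le_add (h1.trans ?_) (h2.trans ?_)
        · gcongr
          exact lintegral_tail_div_sq_le hD (by linarith) hT hunit
        · gcongr
          exact (setLIntegral_le_lintegral _ _).trans hwhole
    _ = ENNReal.ofReal (B ^ 2 * (4 * D / T) + A ^ 2 * (5 * D)) := by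
        rw [← ENNReal.ofReal_mul (by positivity), ← ENNReal.ofReal_mul (by positivity),
          ← ENNReal.ofReal_add (by positivity) (by positivity)]
    _ ≤ _ := by
        refine ENNReal.ofReal_le_ofReal ?_
        have : 0 ≤ B ^ 2 * (D / T) := by positivity
        calc _ = 4 * (B ^ 2 * (D / T)) + 5 * D * A ^ 2 := by ring
          _ ≤ 5 * (B ^ 2 * (D / T)) + 5 * D * A ^ 2 := by linarith
          _ = _ := by ring

/-! ### The mean square of ∑ f(n) log n. -/

open Complex in
theorem lseriesHasSum_expMul {a : ℕ → ℂ} {S : Finset ℕ} (hS : ∀ p ∈ S, p.Prime)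
    (ha : ∀ p : ℕ, p.Prime → p ∉ S → a p = 0) {s : ℂ} (hs : s ≠ 0) :
    LSeriesHasSum (fun n => expMul a n) s (cexp (∑ p ∈ S, a p * (p : ℂ) ^ (-s))) := by
  have h := (hasSum_expMul (fun p => a p * riemannZetaSummandHom hs p) S
    (fun p hp hpS => by simp [ha p hp hpS])).2
  rw [Finset.filter_true_of_mem hS] at h
  have hterm : LSeries.term (fun n => expMul a n) s
      = fun n => expMul (fun p => a p * riemannZetaSummandHom hs p) n := by
    funext n
    rw [expMul_mul_monoidHom, LSeries.term]
    split_ifs with h0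
    · simp [h0]
    · change _ = _ * (n : ℂ) ^ (-s)
      rw [cpow_neg, div_eq_mul_inv]
  rw [LSeriesHasSum, hterm]
  exact h

open Complex in
theorem lseriesHasSum_primeLog {a : ℕ → ℂ} {S : Finset ℕ} (hS : ∀ p ∈ S, p.Prime)
    (ha : ∀ p : ℕ, p.Prime → p ∉ S → a p = 0) (s : ℂ) :
    LSeriesHasSum (fun n => primeLog a n) s
      (∑ p ∈ S, a p * (Real.log p : ℂ) * (p : ℂ) ^ (-s)) := by
  have h : HasSum (LSeries.term (fun n => primeLog a n) s)
      (∑ p ∈ S, LSeries.term (fun n => primeLog a n) s p) := by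
    refine hasSum_sum_of_ne_finset_zero fun n hn => ?_
    rw [LSeries.term]
    split_ifs with h0
    · rfl
    · rw [primeLog_apply]
      split_ifs with hp
      · rw [ha n hp hn]; simp
      · simp
  have e : ∑ p ∈ S, a p * (Real.log p : ℂ) * (p : ℂ) ^ (-s)
      = ∑ p ∈ S, LSeries.term (fun n => primeLog a n) s p := by
    refine Finset.sum_congr rfl fun p hp => ?_
    rw [LSeries.term, if_neg (hS p hp).ne_zero, primeLog_apply, if_pos (hS p hp), cpow_neg,
      div_eq_mul_inv]
  rw [LSeriesHasSum, e]
  exact h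

open MeasureTheory Complex in
/-- The mean square of `∑_{n ≤ w} f(n) log n`, for an exponentially multiplicative `f`. -/
theorem lintegral_summatory_expMul_log_sq_le {a : ℕ → ℂ} {S : Finset ℕ} (hS : ∀ p ∈ S, p.Prime)
    (ha : ∀ p : ℕ, p.Prime → p ∉ S → a p = 0) {β α T A B : ℝ} (hα : 0 < α) (hα1 : α ≤ 1)
    (hT : 1 ≤ T) (hβ : ∀ p ∈ S, ‖a p‖ ≤ β)
    (hA : ∀ t : ℝ, |t| ≤ T →
      Real.exp (∑ p ∈ S, (a p * (p : ℂ) ^ ((t : ℂ) * I)).re * (p : ℝ) ^ (-(1 + α))) ≤ A)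
    (hB : ∀ t : ℝ,
      Real.exp (∑ p ∈ S, (a p * (p : ℂ) ^ ((t : ℂ) * I)).re * (p : ℝ) ^ (-(1 + α))) ≤ B) :
    ∫⁻ w in Set.Ioi (0 : ℝ), ENNReal.ofReal (w ^ (-1 - 2 * (1 + α))) *
        ‖summatory (fun n => expMul a n * (Real.log n : ℂ)) w‖ₑ ^ 2
      ≤ ENNReal.ofReal (2000 * β ^ 2 / α * (A ^ 2 + B ^ 2 / T)) := by
  set σ := 1 + α with hσ
  have hsf : ∀ s : ℂ, s ≠ 0 → LSeriesHasSum (fun n => (primeLog a * expMul a) n) s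
      ((∑ p ∈ S, a p * (Real.log p : ℂ) * (p : ℂ) ^ (-s)) *
        cexp (∑ p ∈ S, a p * (p : ℂ) ^ (-s))) := fun s hs =>
    ArithmeticFunction.LSeriesHasSum_mul (lseriesHasSum_primeLog hS ha s) (lseriesHasSum_expMul hS ha hs)
  have hceq : (fun n => expMul a n * (Real.log n : ℂ)) = fun n => (primeLog a * expMul a) n := by
    funext n; rw [primeLog_mul_expMul]
  rw [hceq]
  have hc : Summable fun n => ‖(primeLog a * expMul a) n‖ / n := by
    have h1 := (hsf 1 one_ne_zero).summable.norm
    refine h1.congr fun n => ?_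
    rw [LSeries.norm_term_eq]
    split_ifs with h0
    · simp [h0]
    · simp
  rw [lintegral_summatory_sq_eq hc (by linarith : 1 < σ)]
  -- The L-series of f log is G Q. G, the series of f, is bounded pointwise through its real
  -- exponent; Q, the series over primes, is bounded in mean square. Since s = σ - 2πiξ, the
  -- variable t of p^{it} is 2πξ.
  set G : ℝ → ℂ := fun ξ => cexp (∑ p ∈ S, a p * (p : ℂ) ^ (-(σ - 2 * Real.pi * ξ * I : ℂ))) with hG
  set b : ℕ → ℂ := fun p => a p * (Real.log p : ℂ) * ((p : ℝ) ^ (-σ) : ℝ) with hb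
  set Q : ℝ → ℂ := fun ξ => ∑ p ∈ S, b p * cexp (2 * Real.pi * ξ * Real.log p * I) with hQ
  have hpow : ∀ p ∈ S, ∀ ξ : ℝ, (p : ℂ) ^ (-(σ - 2 * Real.pi * ξ * I : ℂ))
      = ((p : ℝ) ^ (-σ) : ℝ) * (p : ℂ) ^ (((2 * Real.pi * ξ : ℝ) : ℂ) * I) := by
    intro p hp ξ
    have hp0 : (p : ℂ) ≠ 0 := by exact_mod_cast (hS p hp).ne_zero
    rw [Complex.ofReal_cpow p.cast_nonneg, ofReal_natCast, ← cpow_add _ _ hp0]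
    congr 1
    push_cast; ring
  have hpow' : ∀ p ∈ S, ∀ ξ : ℝ, (p : ℂ) ^ (((2 * Real.pi * ξ : ℝ) : ℂ) * I)
      = cexp (2 * Real.pi * ξ * Real.log p * I) := by
    intro p hp ξ
    have hp0 : (p : ℂ) ≠ 0 := by exact_mod_cast (hS p hp).ne_zero
    rw [cpow_def_of_ne_zero hp0, natCast_log]
    congr 1
    push_cast; ring
  have hGn : ∀ ξ : ℝ, ‖G ξ‖ = Real.exp (∑ p ∈ S,
      (a p * (p : ℂ) ^ (((2 * Real.pi * ξ : ℝ) : ℂ) * I)).re * (p : ℝ) ^ (-σ)) := by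
    intro ξ
    rw [hG, Complex.norm_exp, Complex.re_sum]
    congr 1
    refine Finset.sum_congr rfl fun p hp => ?_
    rw [hpow p hp ξ, show a p * ((((p : ℝ) ^ (-σ) : ℝ) : ℂ) *
      (p : ℂ) ^ (((2 * Real.pi * ξ : ℝ) : ℂ) * I)) = (((p : ℝ) ^ (-σ) : ℝ) : ℂ) *
      (a p * (p : ℂ) ^ (((2 * Real.pi * ξ : ℝ) : ℂ) * I)) by ring, re_ofReal_mul]
    ring
  have hunit := lintegral_unit_interval_prime_sum_le (β := β) hα hα1 S hS (b := b) (by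
    intro p hp
    have hp0 : (0 : ℝ) < p := by exact_mod_cast (hS p hp).pos
    have hl := Real.log_natCast_nonneg p
    simp only [hb]
    rw [norm_mul, norm_mul, norm_real, norm_real, Real.norm_of_nonneg hl,
      Real.norm_of_nonneg (by positivity), hσ, neg_add, Real.rpow_add hp0, Real.rpow_neg_one]
    have := hβ p hp
    calc ‖a p‖ * Real.log p * ((p : ℝ)⁻¹ * (p : ℝ) ^ (-α))
        ≤ β * Real.log p * ((p : ℝ)⁻¹ * (p : ℝ) ^ (-α)) := by gcongr
      _ = _ := by ring)
  have hD : 0 ≤ 400 * β ^ 2 / α := by positivity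
  have hfin := lintegral_mul_div_sq_le (G := G) (Q := Q) (A := A) (B := B) (σ := σ) hD
    (by linarith) hT hunit
    (fun ξ hξ => by rw [hGn]; exact hA _ hξ) (fun ξ => by rw [hGn]; exact hB _)
  refine le_trans (le_of_eq (lintegral_congr fun ξ => ?_)) (hfin.trans (le_of_eq ?_))
  · congr 3
    have hs0 : (σ - 2 * Real.pi * ξ * I : ℂ) ≠ 0 := by
      intro h0
      have := congrArg Complex.re h0
      simp at this
      linarith
    rw [(hsf _ hs0).LSeries_eq, mul_comm]
    congr 1
    refine Finset.sum_congr rfl fun p hp => ?_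
    rw [hpow p hp ξ, hpow' p hp ξ]
    simp only [hb]
    ring
  · congr 1; ring


/-! ### Averaging S(u/p) over short intervals. -/

/-- Brun–Titchmarsh on an interval of relative length about η. Its length is at least ηt/2, and the
condition t ≥ 4/η² says precisely that this is at least √t. -/
theorem sum_log_primesIoc_div_le {η t : ℝ} (hη : 0 < η) (hη1 : η ≤ 1) (ht : 4 / η ^ 2 ≤ t) :
    ∑ p ∈ primesIoc (t / (1 + η)) t, Real.log p ≤ 300 * (η * t) := by
  have ht4 : 4 ≤ t := by
    refine le_trans ?_ ht
    rw [le_div_iff₀ (by positivity)]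
    nlinarith
  have h1 : t - t / (1 + η) = t * η / (1 + η) := by field_simp; ring
  have hlow : t * η / 2 ≤ t - t / (1 + η) := by
    rw [h1]; gcongr; linarith
  have hup : t - t / (1 + η) ≤ η * t := by
    rw [h1, div_le_iff₀ (by linarith)]
    nlinarith [mul_pos hη (by linarith : 0 < t)]
  have h := sum_log_primesIoc_sub_le (t := t) (h := t - t / (1 + η)) (by linarith) (by
    refine le_trans ?_ hlow
    refine Real.sqrt_le_iff.2 ⟨by positivity, ?_⟩
    rw [div_le_iff₀ (by positivity)] at ht
    nlinarith) (by
    have : 0 ≤ t / (1 + η) := by positivity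
    linarith)
  rw [sub_sub_cancel] at h
  linarith

open MeasureTheory in
theorem integrableOn_norm_summatory_div_sq (f : ℕ → ℂ) {v : ℝ} (hv : 0 < v) (u : ℝ) :
    IntegrableOn (fun w => ‖summatory f w‖ / w ^ 2) (Set.Ioc v u) := by
  refine Measure.integrableOn_of_bounded (M := summatory (fun n => ‖f n‖) u / v ^ 2)
    measure_Ioc_lt_top.ne ?_ ?_
  · exact ((measurable_summatory f).norm.div (measurable_id.pow_const 2)).aestronglyMeasurable
  · refine (ae_restrict_iff' measurableSet_Ioc).2 (.of_forall fun w hw => ?_)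
    rw [Real.norm_of_nonneg (by positivity)]
    have := (norm_summatory_le f w).trans (summatory_mono (fun n => norm_nonneg (f n)) hw.2)
    have h2 := hw.1.le
    gcongr
    exact summatory_nonneg (fun n => norm_nonneg (f n)) u

open MeasureTheory in
-- On (a/(1+η), a] the summatory function differs from its value at a by at most the sum of |f| over
-- that interval; integrate against dw/w², of total mass η/a.
theorem norm_summatory_le_average (f : ℕ → ℂ) {a η : ℝ} (ha : 0 < a) (hη : 0 < η) :
    ‖summatory f a‖ * (η / a) ≤ (∫ w in Set.Ioc (a / (1 + η)) a, ‖summatory f w‖ / w ^ 2)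
      + (∑ n ∈ Finset.Ioc ⌊a / (1 + η)⌋₊ ⌊a⌋₊, ‖f n‖) * (η / a) := by
  set D := ∑ n ∈ Finset.Ioc ⌊a / (1 + η)⌋₊ ⌊a⌋₊, ‖f n‖ with hD
  have hb0 : 0 < a / (1 + η) := by positivity
  have hba : a / (1 + η) ≤ a := div_le_self ha.le (by linarith)
  have hone : ∫ w in Set.Ioc (a / (1 + η)) a, (w ^ 2)⁻¹ = η / a := by
    rw [← intervalIntegral.integral_of_le hba]
    rw [intervalIntegral.integral_eq_sub_of_hasDerivAt (f := fun w => -w⁻¹)]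
    · field_simp; ring
    · intro w hw
      rw [Set.uIcc_of_le hba] at hw
      have hw0 : w ≠ 0 := by linarith [hw.1]
      exact (hasDerivAt_inv hw0).fun_neg.congr_deriv (neg_neg _)
    · refine ContinuousOn.intervalIntegrable fun w hw => ?_
      rw [Set.uIcc_of_le hba] at hw
      have hw0 : w ^ 2 ≠ 0 := pow_ne_zero 2 (by linarith [hw.1])
      exact (((continuous_pow 2).continuousAt).inv₀ hw0).continuousWithinAt
  have hint : IntegrableOn (fun w : ℝ => (w ^ 2)⁻¹) (Set.Ioc (a / (1 + η)) a) := by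
    by_contra hcon
    rw [integral_undef hcon] at hone
    have : 0 < η / a := by positivity
    linarith
  have hS := integrableOn_norm_summatory_div_sq f hb0 a
  have hle : ∀ w ∈ Set.Ioc (a / (1 + η)) a,
      ‖summatory f a‖ * (w ^ 2)⁻¹ ≤ ‖summatory f w‖ / w ^ 2 + D * (w ^ 2)⁻¹ := by
    intro w hw
    have hsplit : summatory f a = summatory f w + ∑ n ∈ Finset.Ioc ⌊w⌋₊ ⌊a⌋₊, f n := by
      unfold summatory
      rw [← Finset.sum_union (Finset.Ioc_disjoint_Ioc_of_le le_rfl),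
        Finset.Ioc_union_Ioc_eq_Ioc (Nat.zero_le _) (Nat.floor_le_floor hw.2)]
    have h2 : ‖∑ n ∈ Finset.Ioc ⌊w⌋₊ ⌊a⌋₊, f n‖ ≤ D :=
      (norm_sum_le _ _).trans (Finset.sum_le_sum_of_subset_of_nonneg
        (Finset.Ioc_subset_Ioc_left (Nat.floor_le_floor hw.1.le)) fun n _ _ => norm_nonneg _)
    have h3 : ‖summatory f a‖ ≤ ‖summatory f w‖ + D := by
      rw [hsplit]; exact (norm_add_le _ _).trans (by gcongr)
    calc ‖summatory f a‖ * (w ^ 2)⁻¹ ≤ (‖summatory f w‖ + D) * (w ^ 2)⁻¹ := by gcongr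
      _ = _ := by ring
  have := setIntegral_mono_on (hint.const_mul ‖summatory f a‖) (hS.add (hint.const_mul D))
    measurableSet_Ioc hle
  simp only [Pi.add_apply] at this
  rw [integral_const_mul, integral_add hS (hint.const_mul D), integral_const_mul, hone] at this
  exact this

open MeasureTheory in
/-- Averaging `S(u/p)` over short intervals, by means of the Brun–Titchmarsh bound. -/
theorem sum_log_mul_norm_summatory_div_le (f : ℕ → ℂ) {η P u : ℝ} (hη : 0 < η) (hη1 : η ≤ 1)
    (hP : 4 / η ^ 2 ≤ P) (hu : 1 ≤ u) :
    ∑ p ∈ primesIoc P u, Real.log p * ‖summatory f (u / p)‖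
      ≤ 600 * u * (∫ w in Set.Ioc (1 / 2) u, ‖summatory f w‖ / w ^ 2)
        + 300 * η * u * summatory (fun n => ‖f n‖ / n) u := by
  have hP4 : 4 ≤ P := by
    refine le_trans ?_ hP
    rw [le_div_iff₀ (by positivity)]
    nlinarith
  have hu0 : 0 < u := by linarith
  have hmem : ∀ p ∈ primesIoc P u, p.Prime ∧ P < p ∧ (p : ℝ) ≤ u := fun p hp =>
    (mem_primesIoc (by linarith)).1 hp
  set φ : ℝ → ℝ := fun w => ‖summatory f w‖ / w ^ 2 with hφ
  have hφ0 : ∀ w, 0 ≤ φ w := fun w => by positivity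
  have hφi : IntegrableOn φ (Set.Ioc (1 / 2) u) :=
    integrableOn_norm_summatory_div_sq f (by norm_num) u
  set D : ℕ → ℝ := fun p => ∑ n ∈ Finset.Ioc ⌊u / p / (1 + η)⌋₊ ⌊u / p⌋₊, ‖f n‖ with hD
  set J : ℕ → Set ℝ := fun p => Set.Ioc (u / p / (1 + η)) (u / p) with hJ
  -- The lower limit 1/2 is forced by u/p ≥ 1 and 1 + η ≤ 2.
  have hJsub : ∀ p ∈ primesIoc P u, J p ⊆ Set.Ioc (1 / 2) u := by
    intro p hp w hw
    obtain ⟨hpp, hPp, hpu⟩ := hmem p hp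
    have hp0 : (0 : ℝ) < p := by linarith
    have h1 : 1 ≤ u / p := by rwa [le_div_iff₀ hp0, one_mul]
    have h2 : u / p ≤ u := div_le_self hu0.le (by linarith)
    refine ⟨lt_of_le_of_lt ?_ hw.1, hw.2.trans h2⟩
    rw [div_le_div_iff₀ (by norm_num) (by linarith)]
    nlinarith
  have hterm : ∀ p ∈ primesIoc P u, Real.log p * ‖summatory f (u / p)‖
      ≤ u / η * (∫ w in Set.Ioc (1 / 2) u, Real.log p / p * (J p).indicator φ w)
        + Real.log p * D p := by
    intro p hp
    obtain ⟨hpp, hPp, hpu⟩ := hmem p hp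
    have hp0 : (0 : ℝ) < p := by linarith
    have h := norm_summatory_le_average f (a := u / p) (by positivity) hη
    rw [integral_const_mul, setIntegral_indicator measurableSet_Ioc,
      Set.inter_eq_self_of_subset_right (hJsub p hp)]
    have hl : 0 ≤ Real.log p := Real.log_natCast_nonneg p
    have e : η / (u / p) = η * p / u := by field_simp
    rw [e] at h
    have h' := mul_le_mul_of_nonneg_left h (by positivity : 0 ≤ Real.log p * (u / (η * p)))
    have e1 : Real.log p * (u / (η * p)) * (‖summatory f (u / p)‖ * (η * p / u))
        = Real.log p * ‖summatory f (u / p)‖ := by field_simp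
    rw [e1] at h'
    refine h'.trans (le_of_eq ?_)
    simp only [hD, hJ, hφ]
    field_simp
  refine (Finset.sum_le_sum hterm).trans ?_
  rw [Finset.sum_add_distrib, ← Finset.mul_sum]
  refine add_le_add ?_ ?_
  · rw [← integral_finsetSum _ fun p hp =>
      (hφi.indicator measurableSet_Ioc).const_mul _]
    -- For fixed w the primes that see w lie in (u/(w(1+η)), u/w], so their total weight is at most
    -- 600η by Brun–Titchmarsh. This cancels the factor 1/η of the averaging.
    have hb : ∫ w in Set.Ioc (1 / 2) u,
        ∑ p ∈ primesIoc P u, Real.log p / p * (J p).indicator φ w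
        ≤ ∫ w in Set.Ioc (1 / 2) u, 600 * η * φ w := by
      refine setIntegral_mono_on (integrable_finsetSum _ fun p hp =>
        (hφi.indicator measurableSet_Ioc).const_mul _) (hφi.const_mul _) measurableSet_Ioc ?_
      intro w hw
      have hw0 : 0 < w := by linarith [hw.1]
      have hfil : ∑ p ∈ primesIoc P u, Real.log p / p * (J p).indicator φ w
          = ∑ p ∈ primesIoc P u with w ∈ J p, Real.log p / p * φ w := by
        rw [Finset.sum_filter]
        refine Finset.sum_congr rfl fun p _ => ?_
        split_ifs with h
        · rw [Set.indicator_of_mem h]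
        · rw [Set.indicator_of_notMem h, mul_zero]
      rw [hfil, ← Finset.sum_mul]
      refine mul_le_mul_of_nonneg_right ?_ (hφ0 w)
      have hin : ∀ p ∈ (primesIoc P u).filter (fun p => w ∈ J p),
          p.Prime ∧ P < p ∧ u / w / (1 + η) < p ∧ (p : ℝ) ≤ u / w := by
        intro p hp
        obtain ⟨hp, hwp⟩ := Finset.mem_filter.1 hp
        obtain ⟨hpp, hPp, hpu⟩ := hmem p hp
        have hp0 : (0 : ℝ) < p := by linarith
        refine ⟨hpp, hPp, ?_, ?_⟩
        · have := hwp.1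
          rw [div_div, div_lt_iff₀ (by positivity)] at this ⊢
          linarith
        · have := hwp.2
          rw [le_div_iff₀ hp0] at this
          rw [le_div_iff₀ hw0]
          linarith
      rcases lt_or_ge (u / w) P with ht | ht
      · rw [Finset.sum_eq_zero]
        · positivity
        · intro p hp
          have := hin p hp
          linarith [this.2.1, this.2.2.2]
      · have ht0 : 0 < u / w := by positivity
        have hbt := sum_log_primesIoc_div_le hη hη1 (hP.trans ht)
        calc ∑ p ∈ primesIoc P u with w ∈ J p, Real.log p / p
            ≤ ∑ p ∈ primesIoc P u with w ∈ J p, (1 + η) / (u / w) * Real.log p := by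
              refine Finset.sum_le_sum fun p hp => ?_
              have h3 := (hin p hp).2.2.1
              have hp0 : (0 : ℝ) < p := by linarith [(hin p hp).2.1]
              rw [div_lt_iff₀ (by linarith)] at h3
              have hl : 0 ≤ Real.log p := Real.log_natCast_nonneg p
              rw [div_le_iff₀ hp0, div_mul_eq_mul_div, div_mul_eq_mul_div, le_div_iff₀ ht0]
              nlinarith
          _ ≤ ∑ p ∈ primesIoc (u / w / (1 + η)) (u / w), (1 + η) / (u / w) * Real.log p := by
              refine Finset.sum_le_sum_of_subset_of_nonneg (fun p hp => ?_) fun p _ _ => ?_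
              · rw [mem_primesIoc (by positivity)]
                exact ⟨(hin p hp).1, (hin p hp).2.2⟩
              · have hl : 0 ≤ Real.log p := Real.log_natCast_nonneg p
                positivity
          _ ≤ (1 + η) / (u / w) * (300 * (η * (u / w))) := by
              rw [← Finset.mul_sum]; gcongr
          _ = 300 * η * (1 + η) := by field_simp
          _ ≤ 600 * η := by nlinarith
    calc _ ≤ u / η * ∫ w in Set.Ioc (1 / 2) u, 600 * η * φ w := by gcongr
      _ = _ := by rw [integral_const_mul]; field_simp
  · set K : ℕ → Finset ℕ := fun p => Finset.Ioc ⌊u / p / (1 + η)⌋₊ ⌊u / p⌋₊ with hK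
    -- The averaging error is treated dually: for fixed n the admissible primes lie in (u/(n(1+η)),
    -- u/n].
    have hswap : ∑ p ∈ primesIoc P u, Real.log p * D p
        = ∑ n ∈ Finset.Ioc 0 ⌊u⌋₊, ‖f n‖ * ∑ p ∈ primesIoc P u with n ∈ K p, Real.log p := by
      have e1 : ∀ p ∈ primesIoc P u, Real.log p * D p
          = ∑ n ∈ Finset.Ioc 0 ⌊u⌋₊, if n ∈ K p then ‖f n‖ * Real.log p else 0 := by
        intro p hp
        obtain ⟨hpp, hPp, hpu⟩ := hmem p hp
        have h2 : u / p ≤ u := div_le_self hu0.le (by linarith)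
        rw [Finset.sum_ite_mem, Finset.inter_eq_right.2
          (Finset.Ioc_subset_Ioc (Nat.zero_le _) (Nat.floor_le_floor h2)), ← Finset.sum_mul,
          mul_comm]
      rw [Finset.sum_congr rfl e1, Finset.sum_comm]
      refine Finset.sum_congr rfl fun n _ => ?_
      rw [Finset.mul_sum, Finset.sum_filter]
    rw [hswap, summatory, Finset.mul_sum]
    refine Finset.sum_le_sum fun n hn => ?_
    have hn0 : (0 : ℝ) < n := by exact_mod_cast (Finset.mem_Ioc.1 hn).1
    have hin : ∀ p ∈ (primesIoc P u).filter (fun p => n ∈ K p),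
        p.Prime ∧ P < p ∧ u / n / (1 + η) < p ∧ (p : ℝ) ≤ u / n := by
      intro p hp
      obtain ⟨hp, hwp⟩ := Finset.mem_filter.1 hp
      obtain ⟨hpp, hPp, hpu⟩ := hmem p hp
      have hp0 : (0 : ℝ) < p := by linarith
      obtain ⟨h1, h2⟩ := Finset.mem_Ioc.1 hwp
      rw [Nat.floor_lt (by positivity), div_div, div_lt_iff₀ (by positivity)] at h1
      rw [Nat.le_floor_iff (by positivity), le_div_iff₀ hp0] at h2
      refine ⟨hpp, hPp, ?_, ?_⟩
      · rw [div_div, div_lt_iff₀ (by positivity)]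
        linarith
      · rw [le_div_iff₀ hn0]
        linarith
    have hinner : ∑ p ∈ primesIoc P u with n ∈ K p, Real.log p ≤ 300 * (η * (u / n)) := by
      rcases lt_or_ge (u / n) P with ht | ht
      · rw [Finset.sum_eq_zero]
        · positivity
        · intro p hp
          have := hin p hp
          linarith [this.2.1, this.2.2.2]
      · refine le_trans (Finset.sum_le_sum_of_subset_of_nonneg (fun p hp => ?_) fun p _ _ =>
          Real.log_natCast_nonneg p) (sum_log_primesIoc_div_le hη hη1 (hP.trans ht))
        rw [mem_primesIoc (by positivity)]
        exact ⟨(hin p hp).1, (hin p hp).2.2⟩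
    calc _ ≤ ‖f n‖ * (300 * (η * (u / n))) := by gcongr
      _ = _ := by field_simp


/-! ### Partial summation and the logarithmic mean of |S|. -/

theorem sum_Icc_zero_floor_eq_summatory {E : Type*} [AddCommMonoid E] {f : ℕ → E} (hf : f 0 = 0)
    (u : ℝ) : ∑ n ∈ Finset.Icc 0 ⌊u⌋₊, f n = summatory f u := by
  rw [Finset.Icc_eq_cons_Ioc (Nat.zero_le _), Finset.sum_cons, hf, zero_add, summatory]

open MeasureTheory in
theorem integrableOn_norm_summatory_div (f : ℕ → ℂ) {v : ℝ} (hv : 0 < v) (u : ℝ) :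
    IntegrableOn (fun w => ‖summatory f w‖ / w) (Set.Ioc v u) := by
  refine Measure.integrableOn_of_bounded (M := summatory (fun n => ‖f n‖) u / v)
    measure_Ioc_lt_top.ne ?_ ?_
  · exact ((measurable_summatory f).norm.div measurable_id).aestronglyMeasurable
  · refine (ae_restrict_iff' measurableSet_Ioc).2 (.of_forall fun w hw => ?_)
    have hw0 : 0 < w := hv.trans hw.1
    rw [Real.norm_of_nonneg (by positivity)]
    have := (norm_summatory_le f w).trans (summatory_mono (fun n => norm_nonneg (f n)) hw.2)
    have h2 := hw.1.le
    gcongr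
    exact summatory_nonneg (fun n => norm_nonneg (f n)) u

open MeasureTheory in
-- Partial summation against log. Starting at 1/2, below the first integer, leaves no boundary term
-- at the lower end.
theorem norm_summatory_mul_log_le {f : ℕ → ℂ} (hf : f 0 = 0) {u : ℝ} (hu : 1 ≤ u) :
    ‖summatory f u‖ * Real.log u ≤ ‖summatory (fun n => f n * (Real.log n : ℂ)) u‖
      + ∫ v in Set.Ioc (1 / 2) u, ‖summatory f v‖ / v := by
  have hd : ∀ t ∈ Set.Icc (1 / 2) u, HasDerivAt (fun t : ℝ => (Real.log t : ℂ)) ((t⁻¹ : ℝ) : ℂ) t :=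
    fun t ht => (Real.hasDerivAt_log (by linarith [ht.1] : t ≠ 0)).ofReal_comp
  have hcont : ContinuousOn (fun t : ℝ => ((t⁻¹ : ℝ) : ℂ)) (Set.Icc (1 / 2) u) :=
    Complex.continuous_ofReal.comp_continuousOn
      (continuousOn_inv₀.mono fun t ht => by
        have : t ≠ 0 := by linarith [ht.1]
        exact this)
  have habel := sum_mul_eq_sub_sub_integral_mul (f := fun t : ℝ => (Real.log t : ℂ)) f
    (a := 1 / 2) (b := u) (by norm_num) (by linarith) (fun t ht => (hd t ht).differentiableAt)
    ((hcont.integrableOn_compact isCompact_Icc).congr_fun (fun t ht => (hd t ht).deriv.symm)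
      measurableSet_Icc)
  rw [show ⌊(1 / 2 : ℝ)⌋₊ = 0 by rw [Nat.floor_eq_zero]; norm_num] at habel
  simp only [Finset.Icc_self, Finset.sum_singleton, hf, mul_zero, sub_zero,
    sum_Icc_zero_floor_eq_summatory hf] at habel
  have hN : summatory (fun n => f n * (Real.log n : ℂ)) u
      = ∑ k ∈ Finset.Ioc 0 ⌊u⌋₊, (Real.log k : ℂ) * f k :=
    Finset.sum_congr rfl fun n _ => mul_comm _ _
  rw [← hN] at habel
  have hlog : 0 ≤ Real.log u := Real.log_nonneg hu
  have e : (Real.log u : ℂ) * summatory f u = summatory (fun n => f n * (Real.log n : ℂ)) u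
      + ∫ t in Set.Ioc (1 / 2) u, deriv (fun t : ℝ => (Real.log t : ℂ)) t * summatory f t := by
    rw [habel]; ring
  have h1 : ‖summatory f u‖ * Real.log u = ‖(Real.log u : ℂ) * summatory f u‖ := by
    rw [norm_mul, Complex.norm_real, Real.norm_of_nonneg hlog, mul_comm]
  rw [h1, e]
  refine (norm_add_le _ _).trans (add_le_add le_rfl ?_)
  refine (norm_integral_le_integral_norm _).trans (le_of_eq ?_)
  refine setIntegral_congr_fun measurableSet_Ioc fun t ht => ?_
  have ht0 : 0 < t := by linarith [ht.1]
  rw [(hd t ⟨ht.1.le, ht.2⟩).deriv, norm_mul, Complex.norm_real, Real.norm_of_nonneg (by positivity)]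
  field_simp

open MeasureTheory in
-- Partial summation of ∑ |f(n)|/n against 1/t gives a nonnegative boundary term plus the integral
-- of the summatory function of |f|, which majorizes |S|.
theorem setIntegral_norm_summatory_div_sq_le {f : ℕ → ℂ} (hf : f 0 = 0) {u : ℝ} (hu : 1 ≤ u) :
    ∫ w in Set.Ioc (1 / 2) u, ‖summatory f w‖ / w ^ 2 ≤ summatory (fun n => ‖f n‖ / n) u := by
  set f' : ℕ → ℝ := fun n => ‖f n‖ with hf'
  have hf0 : f' 0 = 0 := by simp [hf', hf]
  have hd : ∀ t ∈ Set.Icc (1 / 2) u, HasDerivAt (fun t : ℝ => t⁻¹) (-(t ^ 2)⁻¹) t :=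
    fun t ht => hasDerivAt_inv (by linarith [ht.1] : t ≠ 0)
  have hcont : ContinuousOn (fun t : ℝ => -(t ^ 2)⁻¹) (Set.Icc (1 / 2) u) :=
    ((continuous_pow 2).continuousOn.inv₀ fun t ht => by
      have : t ≠ 0 := by linarith [ht.1]
      positivity).neg
  have habel := sum_mul_eq_sub_sub_integral_mul (f := fun t : ℝ => t⁻¹) f'
    (a := 1 / 2) (b := u) (by norm_num) (by linarith) (fun t ht => (hd t ht).differentiableAt)
    ((hcont.integrableOn_compact isCompact_Icc).congr_fun (fun t ht => (hd t ht).deriv.symm)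
      measurableSet_Icc)
  rw [show ⌊(1 / 2 : ℝ)⌋₊ = 0 by rw [Nat.floor_eq_zero]; norm_num] at habel
  simp only [Finset.Icc_self, Finset.sum_singleton, hf0, mul_zero, sub_zero,
    sum_Icc_zero_floor_eq_summatory hf0] at habel
  have hN : summatory (fun n => ‖f n‖ / n) u = ∑ k ∈ Finset.Ioc 0 ⌊u⌋₊, (k : ℝ)⁻¹ * f' k :=
    Finset.sum_congr rfl fun n _ => (div_eq_mul_inv _ _).trans (mul_comm _ _)
  rw [hN, habel]
  have hnn : 0 ≤ u⁻¹ * summatory f' u :=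
    mul_nonneg (by positivity) (summatory_nonneg (fun n => norm_nonneg (f n)) u)
  have hcongr : ∫ t in Set.Ioc (1 / 2) u, deriv (fun t : ℝ => t⁻¹) t * summatory f' t
      = -∫ t in Set.Ioc (1 / 2) u, summatory f' t / t ^ 2 := by
    rw [← integral_neg]
    refine setIntegral_congr_fun measurableSet_Ioc fun t ht => ?_
    rw [(hd t ⟨ht.1.le, ht.2⟩).deriv]
    ring
  rw [hcongr, sub_neg_eq_add]
  refine le_trans ?_ (le_add_of_nonneg_left hnn)
  refine setIntegral_mono_on (integrableOn_norm_summatory_div_sq f (by norm_num) u) ?_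
    measurableSet_Ioc fun w hw => ?_
  · refine Measure.integrableOn_of_bounded (M := summatory f' u / (1 / 2) ^ 2)
      measure_Ioc_lt_top.ne ?_ ?_
    · exact ((measurable_summatory f').div (measurable_id.pow_const 2)).aestronglyMeasurable
    · refine (ae_restrict_iff' measurableSet_Ioc).2 (.of_forall fun w hw => ?_)
      have h0 : 0 ≤ summatory f' w := summatory_nonneg (fun n => norm_nonneg (f n)) w
      rw [Real.norm_of_nonneg (by positivity)]
      have := summatory_mono (fun n => norm_nonneg (f n)) hw.2
      have h2 := hw.1.le
      have h3 := summatory_nonneg (fun n => norm_nonneg (f n)) u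
      gcongr
  · have := norm_summatory_le f w
    gcongr

open MeasureTheory in
-- A Hardy-type inequality: exchange the integrals by Tonelli and use that w^{-2} has integral 1/v
-- over (v, ∞).
theorem lintegral_inv_sq_mul_lintegral_le {φ : ℝ → ENNReal} (hφ : Measurable φ) {b x : ℝ}
    (hb : 0 < b) :
    ∫⁻ w in Set.Ioc b x, ENNReal.ofReal ((w ^ 2)⁻¹) * ∫⁻ v in Set.Ioc b w, φ v
      ≤ ∫⁻ v in Set.Ioc b x, φ v * ENNReal.ofReal v⁻¹ := by
  set Δ : Set (ℝ × ℝ) := {z | z.2 ≤ z.1} with hΔ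
  have hΔm : MeasurableSet Δ := measurableSet_le measurable_snd measurable_fst
  set k : ℝ → ℝ → ENNReal := fun w v =>
    Δ.indicator (fun z => ENNReal.ofReal ((z.1 ^ 2)⁻¹) * φ z.2) (w, v) with hk
  have hkm : Measurable (Function.uncurry k) := by
    have : Measurable (fun z : ℝ × ℝ => ENNReal.ofReal ((z.1 ^ 2)⁻¹) * φ z.2) :=
      ((measurable_fst.pow_const 2).inv.ennreal_ofReal).mul (hφ.comp measurable_snd)
    exact this.indicator hΔm
  have h1 : ∀ w ∈ Set.Ioc b x, ENNReal.ofReal ((w ^ 2)⁻¹) * ∫⁻ v in Set.Ioc b w, φ v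
      = ∫⁻ v in Set.Ioc b x, k w v := by
    intro w hw
    rw [← lintegral_const_mul _ hφ]
    have : ∀ v, k w v = (Set.Iic w).indicator (fun v => ENNReal.ofReal ((w ^ 2)⁻¹) * φ v) v :=
      fun v => rfl
    simp_rw [this]
    rw [lintegral_indicator measurableSet_Iic, Measure.restrict_restrict measurableSet_Iic,
      Set.inter_comm, Set.Ioc_inter_Iic, min_eq_right hw.2]
  rw [setLIntegral_congr_fun measurableSet_Ioc h1, lintegral_lintegral_swap hkm.aemeasurable]
  refine setLIntegral_mono' measurableSet_Ioc fun v hv => ?_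
  have hv0 : 0 < v := hb.trans hv.1
  have h2 : ∀ w, k w v = φ v * (Set.Ici v).indicator (fun w => ENNReal.ofReal ((w ^ 2)⁻¹)) w := by
    intro w
    by_cases h : v ≤ w
    · have : (w, v) ∈ Δ := h
      simp only [hk]
      rw [Set.indicator_of_mem this, Set.indicator_of_mem (show w ∈ Set.Ici v from h), mul_comm]
    · have : (w, v) ∉ Δ := h
      simp only [hk]
      rw [Set.indicator_of_notMem this, Set.indicator_of_notMem (show w ∉ Set.Ici v from h),
        mul_zero]
  simp_rw [h2]
  have hm : Measurable fun w : ℝ => ENNReal.ofReal ((w ^ 2)⁻¹) :=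
    (measurable_id.pow_const 2).inv.ennreal_ofReal
  rw [lintegral_const_mul _ (hm.indicator measurableSet_Ici)]
  gcongr
  refine (setLIntegral_le_lintegral _ _).trans ?_
  rw [lintegral_indicator measurableSet_Ici, setLIntegral_congr Ioi_ae_eq_Ici.symm]
  have e : ∀ w ∈ Set.Ioi v, (w ^ 2)⁻¹ = w ^ (-2 : ℝ) := fun w hw => by
    rw [Real.rpow_neg (hv0.trans hw).le]; norm_cast
  rw [setLIntegral_congr_fun measurableSet_Ioi (fun w hw => by rw [e w hw]),
    ← ofReal_integral_eq_lintegral_ofReal (integrableOn_Ioi_rpow_of_lt (by norm_num) hv0)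
      ((ae_restrict_iff' measurableSet_Ioi).2 (.of_forall fun w hw =>
        Real.rpow_nonneg (hv0.trans hw).le _)), integral_Ioi_rpow_of_lt (by norm_num) hv0]
  refine le_of_eq ?_
  congr 1
  norm_num [Real.rpow_neg_one]

open MeasureTheory in
/-- The logarithmic mean of `|S|` is controlled by the mean of `∑ f(n) log n` beyond `U`. -/
theorem setIntegral_norm_summatory_div_sq_le_two_mul {f : ℕ → ℂ} (hf : f 0 = 0) {U x : ℝ}
    (hU : 2 ≤ Real.log U) (hU1 : 1 ≤ U) (hUx : U ≤ x) :
    ∫ w in Set.Ioc (1 / 2) x, ‖summatory f w‖ / w ^ 2 ≤ 2 * (summatory (fun n => ‖f n‖ / n) U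
      + ∫ w in Set.Ioc U x,
          ‖summatory (fun n => f n * (Real.log n : ℂ)) w‖ / (w ^ 2 * Real.log w)) := by
  set I := ∫ w in Set.Ioc (1 / 2) x, ‖summatory f w‖ / w ^ 2 with hI
  set N := summatory (fun n => f n * (Real.log n : ℂ)) with hN
  have hi := integrableOn_norm_summatory_div_sq f (v := 1 / 2) (by norm_num) x
  have hI0 : 0 ≤ I := integral_nonneg fun w => by positivity
  have hsplit : I = (∫ w in Set.Ioc (1 / 2) U, ‖summatory f w‖ / w ^ 2)
      + ∫ w in Set.Ioc U x, ‖summatory f w‖ / w ^ 2 := by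
    rw [← setIntegral_union (Set.Ioc_disjoint_Ioc_of_le le_rfl) measurableSet_Ioc
      (hi.mono_set (Set.Ioc_subset_Ioc_right hUx))
      (hi.mono_set (Set.Ioc_subset_Ioc_left (by linarith))),
      Set.Ioc_union_Ioc_eq_Ioc (by linarith) hUx]
  set r : ℝ → ℝ := fun w => ∫ v in Set.Ioc (1 / 2) w, ‖summatory f v‖ / v with hr
  have hr0 : ∀ w, 0 ≤ r w := fun w => setIntegral_nonneg measurableSet_Ioc fun v hv => by
    have := hv.1
    positivity
  have hrmono : ∀ w w', w ≤ w' → r w ≤ r w' := fun w w' h => by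
    refine setIntegral_mono_set (integrableOn_norm_summatory_div f (by norm_num) w') ?_
      (Set.Ioc_subset_Ioc_right h).eventuallyLE
    refine (ae_restrict_iff' measurableSet_Ioc).2 (.of_forall fun v hv => ?_)
    have := hv.1
    simp only [Pi.zero_apply]
    positivity
  have hrm : Measurable r := Monotone.measurable hrmono
  have hri : IntegrableOn (fun w => r w / w ^ 2) (Set.Ioc (1 / 2) x) := by
    refine Measure.integrableOn_of_bounded (M := r x / (1 / 2) ^ 2) measure_Ioc_lt_top.ne
      (hrm.div (measurable_id.pow_const 2)).aestronglyMeasurable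
      ((ae_restrict_iff' measurableSet_Ioc).2 (.of_forall fun w hw => ?_))
    have h1 := hr0 w
    rw [Real.norm_of_nonneg (by positivity)]
    have := hrmono w x hw.2
    have h2 := hw.1.le
    have h3 := hr0 x
    gcongr
  have hrI : ∫ w in Set.Ioc (1 / 2) x, r w / w ^ 2 ≤ I := by
    rw [integral_eq_lintegral_of_nonneg_ae (.of_forall fun w => div_nonneg (hr0 w) (sq_nonneg w))
      hri.aestronglyMeasurable]
    refine ENNReal.toReal_le_of_le_ofReal hI0 ?_
    rw [hI, ofReal_integral_eq_lintegral_ofReal hi (.of_forall fun w => by positivity)]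
    have hφm : Measurable fun v => ENNReal.ofReal (‖summatory f v‖ / v) :=
      ((measurable_summatory f).norm.div measurable_id).ennreal_ofReal
    refine le_trans (le_of_eq ?_) ((lintegral_inv_sq_mul_lintegral_le hφm (x := x)
      (by norm_num : (0 : ℝ) < 1 / 2)).trans (le_of_eq ?_))
    · refine setLIntegral_congr_fun measurableSet_Ioc fun w hw => ?_
      rw [← ofReal_integral_eq_lintegral_ofReal
        (integrableOn_norm_summatory_div f (by norm_num) w)
        ((ae_restrict_iff' measurableSet_Ioc).2 (.of_forall fun v hv => by
          have := hv.1
          simp only [Pi.zero_apply]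
          positivity)), ← ENNReal.ofReal_mul (by positivity)]
      congr 1
      rw [div_eq_mul_inv, mul_comm]
    · refine setLIntegral_congr_fun measurableSet_Ioc fun w hw => ?_
      have hw0 : 0 < w := by linarith [hw.1]
      rw [← ENNReal.ofReal_mul (by positivity)]
      congr 1
      field_simp
  have hNi : IntegrableOn (fun w => ‖N w‖ / (w ^ 2 * Real.log w)) (Set.Ioc U x) := by
    have hb : IntegrableOn (fun w => ‖N w‖ / w ^ 2) (Set.Ioc U x) :=
      integrableOn_norm_summatory_div_sq _ (by linarith) x
    refine Integrable.mono' hb ((measurable_summatory _).norm.div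
      ((measurable_id.pow_const 2).mul Real.measurable_log)).aestronglyMeasurable
      ((ae_restrict_iff' measurableSet_Ioc).2 (.of_forall fun w hw => ?_))
    have hw0 : 0 < w := by linarith [hw.1]
    have hl : 2 ≤ Real.log w := hU.trans (Real.log_le_log (by linarith) hw.1.le)
    rw [Real.norm_of_nonneg (by positivity)]
    gcongr
    nlinarith [sq_nonneg w]
  -- Since log w ≥ 2, the correction term r from partial summation enters with coefficient 1/2. Its
  -- mean is at most I by the Hardy-type inequality, so it can be absorbed on the left; this costs
  -- the factor 2.
  have hpt : ∀ w ∈ Set.Ioc U x, ‖summatory f w‖ / w ^ 2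
      ≤ ‖N w‖ / (w ^ 2 * Real.log w) + 1 / 2 * (r w / w ^ 2) := by
    intro w hw
    have hw0 : 0 < w := by linarith [hw.1]
    have hl : 2 ≤ Real.log w := hU.trans (Real.log_le_log (by linarith) hw.1.le)
    have h := norm_summatory_mul_log_le hf (u := w) (by linarith [hw.1])
    have h2 : ‖summatory f w‖ ≤ ‖N w‖ / Real.log w + 1 / 2 * r w := by
      have h3 : ‖summatory f w‖ ≤ (‖N w‖ + r w) / Real.log w := by
        rwa [le_div_iff₀ (by linarith)]
      refine h3.trans ?_
      rw [add_div]
      gcongr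
      rw [div_le_iff₀ (by linarith)]
      nlinarith [hr0 w]
    calc ‖summatory f w‖ / w ^ 2 ≤ (‖N w‖ / Real.log w + 1 / 2 * r w) / w ^ 2 := by gcongr
      _ = _ := by field_simp
  have hU2 : IntegrableOn (fun w => r w / w ^ 2) (Set.Ioc U x) :=
    hri.mono_set (Set.Ioc_subset_Ioc_left (by linarith))
  have hmain := setIntegral_mono_on (hi.mono_set (Set.Ioc_subset_Ioc_left (by linarith)))
    (hNi.add (hU2.const_mul (1 / 2))) measurableSet_Ioc hpt
  simp only [Pi.add_apply] at hmain
  rw [integral_add hNi (hU2.const_mul (1 / 2)), integral_const_mul] at hmain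
  have hlast : ∫ w in Set.Ioc U x, r w / w ^ 2 ≤ I :=
    (setIntegral_mono_set hri (.of_forall fun w => div_nonneg (hr0 w) (sq_nonneg w))
      (Set.Ioc_subset_Ioc_left (by linarith : (1 / 2 : ℝ) ≤ U)).eventuallyLE).trans hrI
  have h1 := setIntegral_norm_summatory_div_sq_le hf hU1
  linarith


/-! ### Prime masses and pointwise bounds for the generating series. -/

/-- The sum `∑_{w < p ≤ x} |g(p)| / p`. -/
noncomputable def primeMass (g : ℕ → ℂ) (w x : ℝ) : ℝ := ∑ p ∈ primesIoc w x, ‖g p‖ / p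

theorem primeMass_add (g : ℕ → ℂ) {w v x : ℝ} (h1 : w ≤ v) (h2 : v ≤ x) :
    primeMass g w v + primeMass g v x = primeMass g w x := sum_primesIoc_add h1 h2 _

theorem primeMass_mono (g : ℕ → ℂ) {w v x : ℝ} (h : v ≤ x) :
    primeMass g w v ≤ primeMass g w x :=
  Finset.sum_le_sum_of_subset_of_nonneg (primesIoc_subset le_rfl h) fun p _ _ => by positivity

/-- The hypotheses on `g` under which the Halász-type estimate is proved; `lam` is a lower bound
for the pretentious sums over `|t| ≤ T`. -/
structure HalaszHyp (β c c₁ : ℝ) (g : ℕ → ℂ) (Y x T lam : ℝ) : Prop where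
  norm_le : ∀ p : ℕ, p.Prime → ‖g p‖ ≤ β
  le_Y : 3 / 2 ≤ Y
  Y_le : Y ≤ x
  lower : ∀ w : ℝ, Y ≤ w → w ≤ x → -c₁ ≤ ∑ p ∈ primesIoc w x, (‖g p‖ - c) / (p : ℝ)
  one_le_T : 1 ≤ T
  lam_nonneg : 0 ≤ lam
  lam_le : ∀ t : ℝ, |t| ≤ T → lam ≤ pretentiousSum g Y x t

open Complex in
-- The mean of g(p) p^{it} over 0 < t < 1 is O(|g(p)|/log p), so on average over t the twisted terms
-- nearly disappear. The mean value theorem for the primitive H then produces a suitable t.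
theorem exists_pretentiousSum_le (g : ℕ → ℂ) (Y x : ℝ) : ∃ t ∈ Set.Ioo (0 : ℝ) 1,
    pretentiousSum g Y x t ≤ ∑ p ∈ primesIoc Y x, (‖g p‖ + 2 * ‖g p‖ / Real.log p) / p := by
  have hpr : ∀ p ∈ primesIoc Y x, p.Prime := fun p hp => (Finset.mem_filter.1 hp).2
  set H : ℝ → ℝ := fun t => ∑ p ∈ primesIoc Y x,
    (‖g p‖ * t - (g p / (Real.log p * I) * (p : ℂ) ^ ((t : ℂ) * I)).re) / p with hH
  have hd : ∀ t : ℝ, HasDerivAt H (pretentiousSum g Y x t) t := by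
    intro t
    refine HasDerivAt.fun_sum fun p hp => HasDerivAt.div_const ?_ _
    have hp0 : (p : ℂ) ≠ 0 := by exact_mod_cast (hpr p hp).ne_zero
    have hl : (Real.log p : ℂ) ≠ 0 := by
      exact_mod_cast (Real.log_pos (by exact_mod_cast (hpr p hp).one_lt)).ne'
    have h1 : HasDerivAt (fun t : ℝ => (p : ℂ) ^ ((t : ℂ) * I))
        ((p : ℂ) ^ ((t : ℂ) * I) * Complex.log p * (1 * I)) t :=
      (((hasDerivAt_id (t : ℂ)).mul_const I).const_cpow (Or.inl hp0)).comp_ofReal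
    have h2 := Complex.reCLM.hasFDerivAt.comp_hasDerivAt t
      (h1.const_mul (g p / (Real.log p * I)))
    have h3 := ((hasDerivAt_id t).const_mul ‖g p‖).sub h2
    refine h3.congr_deriv ?_
    rw [mul_one, Complex.reCLM_apply, ← natCast_log, ← ofReal_natCast]
    congr 2
    push_cast at hl ⊢
    field_simp
  obtain ⟨t, ht, he⟩ := exists_hasDerivAt_eq_slope H (pretentiousSum g Y x) one_pos
    (fun t _ => (hd t).continuousAt.continuousWithinAt) (fun t _ => hd t)
  refine ⟨t, ht, ?_⟩
  rw [he, sub_zero, div_one, hH]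
  simp only
  rw [← Finset.sum_sub_distrib]
  refine Finset.sum_le_sum fun p hp => ?_
  rw [← sub_div]
  have hp0 : (0 : ℝ) < p := by exact_mod_cast (hpr p hp).pos
  have hl : 0 < Real.log p := Real.log_pos (by exact_mod_cast (hpr p hp).one_lt)
  have hb : ∀ t : ℝ, |(g p / (Real.log p * I) * (p : ℂ) ^ ((t : ℂ) * I)).re|
      ≤ ‖g p‖ / Real.log p := by
    intro t
    refine (abs_re_le_norm _).trans (le_of_eq ?_)
    rw [norm_mul, norm_div, norm_mul, norm_I, mul_one, norm_real, Real.norm_of_nonneg hl.le,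
      ← ofReal_natCast, norm_cpow_eq_rpow_re_of_pos hp0]
    simp
  have e0 := (abs_le.1 (hb 0)).2
  have e1 := (abs_le.1 (hb 1)).1
  gcongr
  have : 2 * ‖g p‖ / Real.log p = ‖g p‖ / Real.log p + ‖g p‖ / Real.log p := by ring
  linarith

/-- Mertens' theorem combined with |g(p)| ≤ β gives the upper bounds; combined with the lower
hypothesis on |g(p)| - c it gives the lower bound. The bound on λ comes from the averaged value of t
and keeps the cut U above Y. -/
theorem exists_primeMass_bounds {β c c₁ : ℝ} (hβ : 0 < β) (hc : 0 < c) (hc₁ : 0 < c₁) :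
    ∃ C : ℝ, 0 < C ∧ ∀ (g : ℕ → ℂ) (Y x T lam : ℝ), HalaszHyp β c c₁ g Y x T lam →
      lam ≤ β * Real.log (Real.log x / Real.log Y) + C ∧
      ∀ w : ℝ, Y ≤ w → w ≤ x →
        primeMass g w x ≤ β * Real.log (Real.log x / Real.log w) + C ∧
        c * Real.log (Real.log x / Real.log w) - C ≤ primeMass g w x := by
  obtain ⟨C₁, hC₁, h₁⟩ := exists_sum_prime_inv_mul_log_le
  obtain ⟨C₂, hC₂, h₂⟩ := exists_abs_sum_prime_inv_sub_log_le
  refine ⟨β * C₂ + 2 * β * C₁ + c * C₂ + c₁, by positivity, fun g Y x T lam H => ?_⟩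
  have hub : ∀ w : ℝ, ∑ p ∈ primesIoc w x, ‖g p‖ / p ≤ β * ∑ p ∈ primesIoc w x, (1 : ℝ) / p := by
    intro w
    rw [Finset.mul_sum]
    refine Finset.sum_le_sum fun p hp => ?_
    have := H.norm_le p (prime_of_mem_primesIoc hp)
    rw [mul_one_div]
    gcongr
  constructor
  · obtain ⟨t, ht, hle⟩ := exists_pretentiousSum_le g Y x
    have h3 := H.lam_le t (by rw [abs_of_pos ht.1]; linarith [ht.2, H.one_le_T])
    have h4 : ∑ p ∈ primesIoc Y x, (‖g p‖ + 2 * ‖g p‖ / Real.log p) / p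
        ≤ ∑ p ∈ primesIoc Y x, ‖g p‖ / p
          + 2 * β * ∑ p ∈ primesIoc Y x, 1 / ((p : ℝ) * Real.log p) := by
      rw [Finset.mul_sum, ← Finset.sum_add_distrib]
      refine Finset.sum_le_sum fun p hp => ?_
      have hpp := prime_of_mem_primesIoc hp
      have := H.norm_le p hpp
      have hp0 : (0 : ℝ) < p := by exact_mod_cast hpp.pos
      have hl : 0 < Real.log p := Real.log_pos (by exact_mod_cast hpp.one_lt)
      rw [add_div]
      gcongr
      rw [mul_one_div, div_div, mul_comm (Real.log p)]
      gcongr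
    have h5 := (abs_le.1 (h₂ Y x H.le_Y H.Y_le)).2
    have h6 := h₁ (primesIoc Y x) (fun p hp => prime_of_mem_primesIoc hp)
    have h7 := hub Y
    have h8 : 0 < c * C₂ := by positivity
    nlinarith
  · intro w hYw hwx
    have hm := abs_le.1 (h₂ w x (H.le_Y.trans hYw) hwx)
    have h8 : 0 < β * C₁ := by positivity
    have h9 : 0 < c * C₂ := by positivity
    have h10 : 0 < β * C₂ := by positivity
    constructor
    · have := hub w
      unfold primeMass
      nlinarith [hm.2]
    · have := H.lower w hYw hwx
      have e : ∑ p ∈ primesIoc w x, (‖g p‖ - c) / (p : ℝ)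
          = primeMass g w x - c * ∑ p ∈ primesIoc w x, (1 : ℝ) / p := by
        rw [primeMass, Finset.mul_sum, ← Finset.sum_sub_distrib]
        exact Finset.sum_congr rfl fun p _ => by ring
      rw [e] at this
      nlinarith [hm.1]

open Complex in
/-- Bounds for the logarithm of the generating Dirichlet series at `1 + 1 / log X + it`. -/
theorem exists_sum_re_mul_rpow_le {β : ℝ} (hβ : 0 < β) :
    ∃ C : ℝ, 0 < C ∧ ∀ (c c₁ : ℝ) (g : ℕ → ℂ) (Y x T lam : ℝ), HalaszHyp β c c₁ g Y x T lam →
      ∀ X : ℝ, Y ≤ X → X ≤ x → ∀ t : ℝ,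
        (|t| ≤ T → ∑ p ∈ primesIoc 0 x, (g p * (p : ℂ) ^ ((t : ℂ) * I)).re *
            (p : ℝ) ^ (-(1 + 1 / Real.log X)) ≤ primeMass g 0 x - lam + primeMass g X x + C) ∧
        ∑ p ∈ primesIoc 0 x, (g p * (p : ℂ) ^ ((t : ℂ) * I)).re *
            (p : ℝ) ^ (-(1 + 1 / Real.log X)) ≤ primeMass g 0 x - primeMass g X x + C := by
  obtain ⟨C, hC, h⟩ := exists_sum_prime_rpow_compare
  refine ⟨2 * β * C, by positivity, fun c c₁ g Y x T lam H X hYX hXx t => ?_⟩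
  have hX := H.le_Y.trans hYX
  obtain ⟨hc1, hc2⟩ := h X hX
  have hc2 := hc2 x
  have hlX : 0 < Real.log X := Real.log_pos (by linarith)
  set e := -(1 + 1 / Real.log X) with he
  set ρ : ℕ → ℝ := fun p => (g p * (p : ℂ) ^ ((t : ℂ) * I)).re with hρ
  have hρg : ∀ p : ℕ, p.Prime → |ρ p| ≤ ‖g p‖ := by
    intro p hp
    have hp0 : (0 : ℝ) < p := by exact_mod_cast hp.pos
    refine (abs_re_le_norm _).trans (le_of_eq ?_)
    rw [norm_mul, ← ofReal_natCast, norm_cpow_eq_rpow_re_of_pos hp0]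
    simp
  have hρβ : ∀ p : ℕ, p.Prime → |ρ p| ≤ β := fun p hp => (hρg p hp).trans (H.norm_le p hp)
  have hle1 : ∑ p ∈ primesIoc 0 X, ρ p * (p : ℝ) ^ e
      ≤ ∑ p ∈ primesIoc 0 X, ρ p / p + β * C := by
    have : ∑ p ∈ primesIoc 0 X, ρ p * (p : ℝ) ^ e ≤ ∑ p ∈ primesIoc 0 X, ρ p / p
        + β * ∑ p ∈ primesIoc 0 X, (1 / (p : ℝ) - (p : ℝ) ^ e) := by
      rw [Finset.mul_sum, ← Finset.sum_add_distrib]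
      refine Finset.sum_le_sum fun p hp => ?_
      have hpp := prime_of_mem_primesIoc hp
      have hp1 : (1 : ℝ) ≤ p := by exact_mod_cast hpp.one_le
      have h1 : (p : ℝ) ^ e ≤ 1 / p := by
        rw [one_div, ← Real.rpow_neg_one]
        refine Real.rpow_le_rpow_of_exponent_le hp1 ?_
        rw [he]
        have : 0 < 1 / Real.log X := by positivity
        linarith
      have h2 := abs_le.1 (hρβ p hpp)
      have : ρ p / p = ρ p * (1 / p) := by ring
      rw [this]
      nlinarith [h2.1]
    refine this.trans ?_
    gcongr
  have hle2 : ∑ p ∈ primesIoc X x, ρ p * (p : ℝ) ^ e ≤ β * C := by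
    have : ∑ p ∈ primesIoc X x, ρ p * (p : ℝ) ^ e ≤ β * ∑ p ∈ primesIoc X x, (p : ℝ) ^ e := by
      rw [Finset.mul_sum]
      refine Finset.sum_le_sum fun p hp => ?_
      have h2 := abs_le.1 (hρβ p (prime_of_mem_primesIoc hp))
      gcongr
      exact h2.2
    refine this.trans ?_
    gcongr
  have hsplit := sum_primesIoc_add (w := 0) (v := X) (x := x) (by linarith) hXx
    (fun p => ρ p * (p : ℝ) ^ e)
  have hm0 := primeMass_add g (w := 0) (v := X) (x := x) (by linarith) hXx
  have hρmass : ∑ p ∈ primesIoc 0 X, ρ p / p ≤ primeMass g 0 X := by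
    refine Finset.sum_le_sum fun p hp => ?_
    have h2 := abs_le.1 (hρg p (prime_of_mem_primesIoc hp))
    gcongr
    exact h2.2
  refine ⟨fun ht => ?_, by linarith⟩
  have hlam := H.lam_le t ht
  set δ : ℕ → ℝ := fun p => (‖g p‖ - ρ p) / p with hδ
  have hδ0 : ∀ p : ℕ, p.Prime → 0 ≤ δ p := by
    intro p hp
    have h2 := abs_le.1 (hρg p hp)
    exact div_nonneg (by linarith [h2.2]) p.cast_nonneg
  have hs1 : ∑ p ∈ primesIoc Y X, δ p + ∑ p ∈ primesIoc X x, δ p = pretentiousSum g Y x t :=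
    sum_primesIoc_add hYX hXx δ
  -- λ counts the deficit over (Y, x], but only p ≤ X is visible at 1 + 1/log X. The missing deficit
  -- is at most twice the mass of (X, x], which turns the gain -M(X) of the truncation into a loss
  -- +M(X).
  have hs2 : ∑ p ∈ primesIoc X x, δ p ≤ 2 * primeMass g X x := by
    rw [primeMass, Finset.mul_sum]
    refine Finset.sum_le_sum fun p hp => ?_
    have h2 := abs_le.1 (hρg p (prime_of_mem_primesIoc hp))
    rw [hδ, mul_div_assoc']
    simp only
    gcongr
    linarith [h2.1]
  have hs3 : ∑ p ∈ primesIoc Y X, δ p ≤ ∑ p ∈ primesIoc 0 X, δ p :=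
    Finset.sum_le_sum_of_subset_of_nonneg (primesIoc_subset (by linarith [H.le_Y]) le_rfl)
      fun p hp _ => hδ0 p (prime_of_mem_primesIoc hp)
  have hs4 : ∑ p ∈ primesIoc 0 X, δ p = primeMass g 0 X - ∑ p ∈ primesIoc 0 X, ρ p / p := by
    rw [primeMass, ← Finset.sum_sub_distrib]
    exact Finset.sum_congr rfl fun p _ => sub_div _ _ _
  linarith


/-! ### The logarithmic mean of |S|, block by block. -/

theorem summatory_congr {E : Type*} [AddCommMonoid E] {f f' : ℕ → E} {u : ℝ}
    (h : ∀ n : ℕ, 0 < n → n ≤ ⌊u⌋₊ → f n = f' n) : summatory f u = summatory f' u :=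
  Finset.sum_congr rfl fun n hn => h n (Finset.mem_Ioc.1 hn).1 (Finset.mem_Ioc.1 hn).2

open MeasureTheory in
theorem integrableOn_norm_summatory_div_sq_mul_log (f : ℕ → ℂ) {v : ℝ} (hv : 1 < v) (u : ℝ) :
    IntegrableOn (fun w => ‖summatory f w‖ / (w ^ 2 * Real.log w)) (Set.Ioc v u) := by
  have hv0 : 0 < Real.log v := Real.log_pos hv
  have hb : IntegrableOn (fun w => ‖summatory f w‖ / w ^ 2 * (Real.log v)⁻¹) (Set.Ioc v u) :=
    (integrableOn_norm_summatory_div_sq _ (by linarith) u).mul_const _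
  refine Integrable.mono' hb ((measurable_summatory _).norm.div
    ((measurable_id.pow_const 2).mul Real.measurable_log)).aestronglyMeasurable
    ((ae_restrict_iff' measurableSet_Ioc).2 (.of_forall fun w hw => ?_))
  have hw0 : 0 < w := by linarith [hw.1]
  have hl : Real.log v ≤ Real.log w := Real.log_le_log (by linarith) hw.1.le
  have hl0 : 0 < Real.log w := hv0.trans_le hl
  rw [Real.norm_of_nonneg (by positivity), ← div_div, div_eq_mul_inv _ (Real.log w)]
  gcongr

open MeasureTheory in
theorem setIntegral_le_of_lintegral_le {φ : ℝ → ℝ} {s : Set ℝ} {K : ℝ} (hs : MeasurableSet s)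
    (hφ : Measurable φ) (h0 : ∀ w ∈ s, 0 ≤ φ w) (hK : 0 ≤ K)
    (h : ∫⁻ w in s, ENNReal.ofReal (φ w) ≤ ENNReal.ofReal K) :
    IntegrableOn φ s ∧ ∫ w in s, φ w ≤ K := by
  have h0' : 0 ≤ᵐ[volume.restrict s] φ := (ae_restrict_iff' hs).2 (.of_forall h0)
  refine ⟨⟨hφ.aestronglyMeasurable, ?_⟩, ?_⟩
  · rw [hasFiniteIntegral_iff_ofReal h0']
    exact h.trans_lt ENNReal.ofReal_lt_top
  · rw [integral_eq_lintegral_of_nonneg_ae h0' hφ.aestronglyMeasurable]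
    exact ENNReal.toReal_le_of_le_ofReal hK h

open MeasureTheory in
/-- The contribution of a block `(exp (log X / e), X]`. -/
theorem exists_setIntegral_block_le {β : ℝ} (hβ : 0 < β) :
    ∃ C : ℝ, 0 < C ∧ ∀ (c c₁ : ℝ) (g : ℕ → ℂ) (Y x T lam : ℝ), HalaszHyp β c c₁ g Y x T lam →
      ∀ X : ℝ, Y ≤ X → X ≤ x → 2 ≤ Real.log X →
        ∫ w in Set.Ioc (Real.exp (Real.exp (-1) * Real.log X)) X,
          ‖summatory (fun n => expMul g n * (Real.log n : ℂ)) w‖ / (w ^ 2 * Real.log w)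
        ≤ C * (Real.exp (primeMass g 0 x) * (Real.exp (-lam + primeMass g X x)
            + T ^ (-(1 / 2) : ℝ) * Real.exp (-primeMass g X x))) := by
  obtain ⟨C₀, hC₀, h₀⟩ := exists_sum_re_mul_rpow_le hβ
  refine ⟨Real.exp 1 / 2 * (2000 * Real.exp 2 * β ^ 2 + 1) * Real.exp C₀, by positivity,
    fun c c₁ g Y x T lam H X hYX hXx hℓ => ?_⟩
  set ℓ := Real.log X with hℓd
  set M := primeMass g X x with hM
  set F := primeMass g 0 x with hF
  set N := summatory (fun n => expMul g n * (Real.log n : ℂ)) with hN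
  set A := Real.exp (F - lam + M + C₀) with hA
  set B := Real.exp (F - M + C₀) with hB
  have hT := H.one_le_T
  have hX0 : 0 < X := by linarith [H.le_Y]
  -- Truncation at x makes the Dirichlet series entire and leaves the summatory function unchanged
  -- for w ≤ X ≤ x.
  set a : ℕ → ℂ := fun p => if p ∈ primesIoc 0 x then g p else 0 with ha
  have hag : ∀ p ∈ primesIoc 0 x, a p = g p := fun p hp => if_pos hp
  have hms := lintegral_summatory_expMul_log_sq_le (a := a) (S := primesIoc 0 x)
    (β := β) (α := 1 / ℓ) (T := T) (A := A) (B := B)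
    (fun p hp => prime_of_mem_primesIoc hp) (fun p _ hp => if_neg hp) (by positivity)
    (by rw [div_le_one (by linarith)]; linarith) hT
    (fun p hp => by rw [hag p hp]; exact H.norm_le p (prime_of_mem_primesIoc hp))
    (fun t ht => by
      refine Real.exp_le_exp.2 (le_trans (le_of_eq ?_) ((h₀ c c₁ g Y x T lam H X hYX hXx t).1 ht))
      exact Finset.sum_congr rfl fun p hp => by rw [hag p hp])
    (fun t => by
      refine Real.exp_le_exp.2 (le_trans (le_of_eq ?_) (h₀ c c₁ g Y x T lam H X hYX hXx t).2)
      exact Finset.sum_congr rfl fun p hp => by rw [hag p hp])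
  set X' := Real.exp (Real.exp (-1) * ℓ) with hX'
  have hX'1 : 1 < X' := Real.one_lt_exp_iff.2 (by positivity)
  set e := -1 - 2 * (1 + 1 / ℓ) with he
  set τ := T ^ (-(1 / 2) : ℝ) with hτ
  have hτ0 : 0 < τ := Real.rpow_pos_of_pos (by linarith) _
  have hτ2 : τ ^ 2 = 1 / T := by
    rw [hτ, ← Real.rpow_natCast, ← Real.rpow_mul (by linarith)]
    norm_num [Real.rpow_neg_one]
  set D := A + B * τ with hD
  have hA0 : 0 < A := Real.exp_pos _
  have hB0 : 0 < B := Real.exp_pos _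
  have hD0 : 0 < D := by positivity
  have hAB : A ^ 2 + B ^ 2 / T ≤ D ^ 2 := by
    have : B ^ 2 / T = B ^ 2 * τ ^ 2 := by rw [hτ2]; ring
    rw [this, hD]
    nlinarith [mul_pos hA0 (mul_pos hB0 hτ0)]
  have hNN : ∀ w ∈ Set.Ioc X' X,
      summatory (fun n => expMul a n * (Real.log n : ℂ)) w = N w := by
    intro w hw
    refine summatory_congr fun n hn0 hn => ?_
    have hw0 : 0 ≤ w := by linarith [hw.1]
    rw [expMul_congr (a' := g) fun p hp hpn => hag p ?_]
    rw [mem_primesIoc le_rfl]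
    refine ⟨hp, by exact_mod_cast hp.pos, ?_⟩
    have h1 : (p : ℝ) ≤ n := by exact_mod_cast Nat.le_of_dvd hn0 hpn
    have h2 : (n : ℝ) ≤ w := (Nat.le_floor_iff hw0).1 hn
    linarith [hw.2]
  have hNm : Measurable N := measurable_summatory _
  have hsq := setIntegral_le_of_lintegral_le (φ := fun w => w ^ e * ‖N w‖ ^ 2)
    (s := Set.Ioc X' X) (K := 2000 * β ^ 2 * ℓ * D ^ 2) measurableSet_Ioc
    ((measurable_id.pow_const e).mul (hNm.norm.pow_const 2))
    (fun w hw => by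
      have hw0 : 0 ≤ w := by linarith [hw.1]
      positivity) (by positivity) (by
      refine le_trans (le_trans (le_of_eq ?_) (lintegral_mono_set (s := Set.Ioc X' X)
        fun w hw => (by linarith [hw.1] : (0 : ℝ) < w))) (hms.trans ?_)
      · refine setLIntegral_congr_fun measurableSet_Ioc fun w hw => ?_
        have hw0 : 0 ≤ w := by linarith [hw.1]
        rw [hNN w hw, ENNReal.ofReal_mul (by positivity), ENNReal.ofReal_pow (norm_nonneg _),
          ofReal_norm]
      · refine ENNReal.ofReal_le_ofReal ?_
        calc 2000 * β ^ 2 / (1 / ℓ) * (A ^ 2 + B ^ 2 / T)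
            = 2000 * β ^ 2 * ℓ * (A ^ 2 + B ^ 2 / T) := by rw [div_div_eq_mul_div, div_one]
          _ ≤ _ := by gcongr)
  have hX'X : X' ≤ X := by
    rw [hX', ← Real.exp_log hX0]
    refine Real.exp_le_exp.2 ?_
    have : Real.exp (-1) ≤ 1 := Real.exp_le_one_iff.2 (by norm_num)
    nlinarith
  have hinvi : IntegrableOn (fun w : ℝ => w⁻¹) (Set.Ioc X' X) :=
    ((continuousOn_inv₀.mono fun t (ht : t ∈ Set.Icc X' X) => by
      have : t ≠ 0 := by linarith [ht.1]
      exact this).integrableOn_compact isCompact_Icc).mono_set Set.Ioc_subset_Icc_self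
  have hinv : ∫ w in Set.Ioc X' X, w⁻¹ ≤ ℓ := by
    rw [← intervalIntegral.integral_of_le hX'X, integral_inv_of_pos (by linarith) hX0,
      Real.log_div hX0.ne' (by linarith), hX', Real.log_exp]
    have : 0 < Real.exp (-1) * ℓ := by positivity
    linarith
  -- In place of Cauchy–Schwarz, 2|N|/w² ≤ |N|²/(D w³) + D/w with D = A + B T^{-1/2}; both terms
  -- then integrate to order ℓ D. On the block 1/log w ≤ e/ℓ, and w^{2/ℓ} ≤ e² converts w^{-3} to
  -- the Plancherel weight.
  have hpt : ∀ w ∈ Set.Ioc X' X, ‖N w‖ / (w ^ 2 * Real.log w)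
      ≤ Real.exp 1 / (2 * ℓ) * (Real.exp 2 / D * (w ^ e * ‖N w‖ ^ 2) + D * w⁻¹) := by
    intro w hw
    have hw0 : 0 < w := by linarith [hw.1]
    have hlw : Real.exp (-1) * ℓ ≤ Real.log w := by
      rw [Real.le_log_iff_exp_le hw0]; exact hw.1.le
    have hwX : w ^ (2 / ℓ) ≤ Real.exp 2 := by
      rw [Real.rpow_def_of_pos hw0]
      refine Real.exp_le_exp.2 ?_
      have := Real.log_le_log hw0 hw.2
      rw [mul_div_assoc', div_le_iff₀ (by linarith)]
      linarith
    have hw3 : (w ^ 3)⁻¹ ≤ Real.exp 2 * w ^ e := by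
      have : (w ^ 3)⁻¹ = w ^ (2 / ℓ) * w ^ e := by
        rw [← Real.rpow_add hw0, show 2 / ℓ + e = -(3 : ℕ) by rw [he]; push_cast; ring,
          Real.rpow_neg hw0.le, Real.rpow_natCast]
      rw [this]
      gcongr
    have h1 : ‖N w‖ / (w ^ 2 * Real.log w) ≤ ‖N w‖ / (w ^ 2 * (Real.exp (-1) * ℓ)) := by gcongr
    refine h1.trans ?_
    have h2 : ‖N w‖ / (w ^ 2 * (Real.exp (-1) * ℓ))
        = Real.exp 1 / (2 * ℓ) * (2 * ‖N w‖ / w ^ 2) := by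
      rw [Real.exp_neg]; field_simp
    rw [h2]
    gcongr
    have h3 : 2 * ‖N w‖ / w ^ 2 ≤ 1 / D * ((w ^ 3)⁻¹ * ‖N w‖ ^ 2) + D * w⁻¹ := by
      have h4 : 1 / D * ((w ^ 3)⁻¹ * ‖N w‖ ^ 2) + D * w⁻¹ - 2 * ‖N w‖ / w ^ 2
          = (‖N w‖ - D * w) ^ 2 / (D * w ^ 3) := by
        field_simp
        ring
      have h5 : 0 ≤ (‖N w‖ - D * w) ^ 2 / (D * w ^ 3) := by positivity
      linarith
    refine h3.trans ?_
    have h6 : 1 / D * ((w ^ 3)⁻¹ * ‖N w‖ ^ 2) ≤ 1 / D * (Real.exp 2 * w ^ e * ‖N w‖ ^ 2) := by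
      gcongr
    have h7 : Real.exp 2 / D * (w ^ e * ‖N w‖ ^ 2) = 1 / D * (Real.exp 2 * w ^ e * ‖N w‖ ^ 2) := by
      ring
    linarith
  have hmono := setIntegral_mono_on (integrableOn_norm_summatory_div_sq_mul_log _ hX'1 X)
    (((hsq.1.const_mul (Real.exp 2 / D)).add (hinvi.const_mul D)).const_mul
      (Real.exp 1 / (2 * ℓ))) measurableSet_Ioc hpt
  simp only [Pi.add_apply] at hmono
  rw [integral_const_mul, integral_add (hsq.1.const_mul (Real.exp 2 / D)) (hinvi.const_mul D),
    integral_const_mul, integral_const_mul] at hmono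
  refine hmono.trans ?_
  have hsq2 := hsq.2
  calc Real.exp 1 / (2 * ℓ) * (Real.exp 2 / D * (∫ w in Set.Ioc X' X, w ^ e * ‖N w‖ ^ 2)
        + D * ∫ w in Set.Ioc X' X, w⁻¹)
      ≤ Real.exp 1 / (2 * ℓ) * (Real.exp 2 / D * (2000 * β ^ 2 * ℓ * D ^ 2) + D * ℓ) := by
        gcongr
    _ = Real.exp 1 / 2 * (2000 * Real.exp 2 * β ^ 2 + 1) * D := by
        field_simp
    _ = _ := by
        rw [hD, hA, hB, show F - lam + M + C₀ = C₀ + (F + (-lam + M)) by ring,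
          show F - M + C₀ = C₀ + (F + -M) by ring, Real.exp_add C₀, Real.exp_add C₀,
          Real.exp_add F, Real.exp_add F]
        ring


open MeasureTheory in
theorem setIntegral_Ioc_eq_sum {h : ℝ → ℝ} {X : ℕ → ℝ} (hX : Antitone X) (K : ℕ)
    (hi : IntegrableOn h (Set.Ioc (X K) (X 0))) :
    ∫ w in Set.Ioc (X K) (X 0), h w
      = ∑ k ∈ Finset.range K, ∫ w in Set.Ioc (X (k + 1)) (X k), h w := by
  induction K with
  | zero => simp
  | succ K ih =>
    have h1 : X (K + 1) ≤ X K := hX (Nat.le_succ K)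
    have h2 : X K ≤ X 0 := hX (Nat.zero_le K)
    rw [Finset.sum_range_succ, ← ih (hi.mono_set (Set.Ioc_subset_Ioc_left h1)),
      add_comm (∫ w in Set.Ioc (X K) (X 0), h w),
      ← setIntegral_union (Set.Ioc_disjoint_Ioc_of_le le_rfl) measurableSet_Ioc
        (hi.mono_set (Set.Ioc_subset_Ioc_right h2))
        (hi.mono_set (Set.Ioc_subset_Ioc_left h1)), Set.Ioc_union_Ioc_eq_Ioc h1 h2]

theorem sum_range_exp_mul_le {b : ℝ} (hb : 0 < b) (K : ℕ) :
    ∑ k ∈ Finset.range (K + 1), Real.exp (b * k)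
      ≤ Real.exp b / (Real.exp b - 1) * Real.exp (b * K) := by
  have h1 : 1 < Real.exp b := Real.one_lt_exp_iff.2 hb
  have h2 : ∀ k : ℕ, Real.exp (b * k) = Real.exp b ^ k := fun k => by
    rw [← Real.exp_nat_mul, mul_comm]
  simp_rw [h2]
  rw [geom_sum_eq h1.ne', div_mul_eq_mul_div, pow_succ']
  have h3 : 0 < Real.exp b - 1 := by linarith
  gcongr
  linarith

theorem sum_range_exp_neg_mul_le {b : ℝ} (hb : 0 < b) (K : ℕ) :
    ∑ k ∈ Finset.range K, Real.exp (-(b * k)) ≤ 1 / (1 - Real.exp (-b)) := by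
  have h1 : Real.exp (-b) < 1 := Real.exp_lt_one_iff.2 (by linarith)
  have h2 : ∀ k : ℕ, Real.exp (-(b * k)) = Real.exp (-b) ^ k := fun k => by
    rw [← Real.exp_nat_mul]; ring_nf
  simp_rw [h2]
  have h3 : 0 < 1 - Real.exp (-b) := by linarith
  rw [geom_sum_eq h1.ne, ← neg_div_neg_eq, neg_sub, neg_sub]
  gcongr
  have : 0 < Real.exp (-b) ^ K := by positivity
  linarith

open MeasureTheory in
-- With log X_k = e^{-k} log x the k-th block costs e^{-λ+βk} + T^{-1/2} e^{-ck}. The first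
-- geometric series is dominated by its last term, at k ≤ λ/(c+β), where it is at most
-- e^{-λc/(c+β)}; the second converges.
theorem exists_setIntegral_summatory_log_le {β c c₁ : ℝ} (hβ : 0 < β) (hc : 0 < c) (hc₁ : 0 < c₁) :
    ∃ C : ℝ, 0 < C ∧ ∀ (g : ℕ → ℂ) (Y x T lam : ℝ), HalaszHyp β c c₁ g Y x T lam →
      ∀ U : ℝ, Real.log U = Real.exp (-(lam / (c + β))) * Real.log x → Y ≤ U → 2 ≤ Real.log U →
        ∫ w in Set.Ioc U x,
          ‖summatory (fun n => expMul g n * (Real.log n : ℂ)) w‖ / (w ^ 2 * Real.log w)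
        ≤ C * (Real.exp (primeMass g 0 x) *
            (Real.exp (-(lam * c / (c + β))) + T ^ (-(1 / 2) : ℝ))) := by
  obtain ⟨C₀, hC₀, h₀⟩ := exists_setIntegral_block_le hβ
  obtain ⟨C₁, hC₁, h₁⟩ := exists_primeMass_bounds hβ hc hc₁
  have hβ1 : 0 < Real.exp β - 1 := by linarith [Real.one_lt_exp_iff.2 hβ]
  have hc1 : 0 < 1 - Real.exp (-c) := by linarith [Real.exp_lt_one_iff.2 (by linarith : -c < 0)]
  refine ⟨C₀ * Real.exp C₁ * (Real.exp β / (Real.exp β - 1) + 1 / (1 - Real.exp (-c))),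
    by positivity, fun g Y x T lam H U hU hYU hU2 => ?_⟩
  obtain ⟨-, h₁⟩ := h₁ g Y x T lam H
  have h₀ := h₀ c c₁ g Y x T lam H
  set τ := T ^ (-(1 / 2) : ℝ) with hτ
  have hτ0 : 0 < τ := Real.rpow_pos_of_pos (by linarith [H.one_le_T]) _
  set v := lam / (c + β) with hv
  have hv0 : 0 ≤ v := div_nonneg H.lam_nonneg (by linarith)
  set L := Real.log x with hL
  have hx0 : 0 < x := by linarith [H.le_Y, H.Y_le]
  have hU0 : 0 < U := by linarith [H.le_Y]
  have hL0 : 0 < L := Real.log_pos (by linarith [H.le_Y, H.Y_le])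
  set X : ℕ → ℝ := fun k => Real.exp (Real.exp (-k) * L) with hX
  have hX0 : X 0 = x := by simp [hX, hL, Real.exp_log hx0]
  have hXanti : Antitone X := fun i j hij => by
    simp only [hX]
    gcongr
  have hX1 : ∀ k, 1 < X k := fun k => Real.one_lt_exp_iff.2 (by positivity)
  set K := ⌊v⌋₊ with hK
  have hKv : (K : ℝ) ≤ v := Nat.floor_le hv0
  have hUexp : U = Real.exp (Real.exp (-v) * L) := by rw [← hU, Real.exp_log hU0]
  have hXU : X (K + 1) ≤ U := by
    rw [hUexp]
    have : v ≤ ((K + 1 : ℕ) : ℝ) := by push_cast; exact (Nat.lt_floor_add_one v).le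
    simp only [hX]
    gcongr
  set h : ℝ → ℝ := fun w =>
    ‖summatory (fun n => expMul g n * (Real.log n : ℂ)) w‖ / (w ^ 2 * Real.log w) with hh
  have hint : IntegrableOn h (Set.Ioc (X (K + 1)) (X 0)) :=
    integrableOn_norm_summatory_div_sq_mul_log _ (hX1 _) _
  have hle : ∫ w in Set.Ioc U x, h w ≤ ∫ w in Set.Ioc (X (K + 1)) (X 0), h w := by
    refine setIntegral_mono_set hint ((ae_restrict_iff' measurableSet_Ioc).2
      (.of_forall fun w hw => ?_)) ?_
    · have hw1 : 1 < w := (hX1 _).trans hw.1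
      have := Real.log_pos hw1
      simp only [hh, Pi.zero_apply]
      positivity
    · rw [hX0]
      exact (Set.Ioc_subset_Ioc_left hXU).eventuallyLE
  refine hle.trans ?_
  rw [setIntegral_Ioc_eq_sum hXanti (K + 1) hint]
  set F := primeMass g 0 x with hF
  have hblock : ∀ k ∈ Finset.range (K + 1), ∫ w in Set.Ioc (X (k + 1)) (X k), h w
      ≤ C₀ * Real.exp C₁ * Real.exp F *
        (Real.exp (-lam) * Real.exp (β * k) + τ * Real.exp (-(c * k))) := by
    intro k hk
    have hkv : (k : ℝ) ≤ v := by
      have : k ≤ K := Nat.lt_succ_iff.1 (Finset.mem_range.1 hk)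
      exact le_trans (by exact_mod_cast this) hKv
    have hUX : U ≤ X k := by
      rw [hUexp]
      simp only [hX]
      gcongr
    have hlX : Real.log (X k) = Real.exp (-k) * L := by simp only [hX]; rw [Real.log_exp]
    have hXx : X k ≤ x := hX0 ▸ hXanti (Nat.zero_le k)
    have hXsucc : X (k + 1) = Real.exp (Real.exp (-1) * Real.log (X k)) := by
      rw [hlX, ← mul_assoc, ← Real.exp_add]
      simp only [hX]
      push_cast
      ring_nf
    rw [hXsucc]
    refine (h₀ (X k) (hYU.trans hUX) hXx (hU2.trans (Real.log_le_log hU0 hUX))).trans ?_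
    obtain ⟨hm1, hm2⟩ := h₁ (X k) (hYU.trans hUX) hXx
    have hlog : Real.log (L / Real.log (X k)) = k := by
      rw [hlX, Real.exp_neg, ← div_div, div_inv_eq_mul, mul_comm L, mul_div_assoc,
        div_self hL0.ne', mul_one, Real.log_exp]
    rw [hlog] at hm1 hm2
    set M := primeMass g (X k) x with hM
    have e1 : Real.exp (-lam + M) ≤ Real.exp C₁ * (Real.exp (-lam) * Real.exp (β * k)) := by
      rw [← Real.exp_add, ← Real.exp_add]
      exact Real.exp_le_exp.2 (by linarith)
    have e2 : Real.exp (-M) ≤ Real.exp C₁ * Real.exp (-(c * k)) := by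
      rw [← Real.exp_add]
      exact Real.exp_le_exp.2 (by linarith)
    calc C₀ * (Real.exp F * (Real.exp (-lam + M) + τ * Real.exp (-M)))
        ≤ C₀ * (Real.exp F * (Real.exp C₁ * (Real.exp (-lam) * Real.exp (β * k))
          + τ * (Real.exp C₁ * Real.exp (-(c * k))))) := by gcongr
      _ = _ := by ring
  refine (Finset.sum_le_sum hblock).trans ?_
  rw [← Finset.mul_sum, Finset.sum_add_distrib, ← Finset.mul_sum, ← Finset.mul_sum]
  have g1 := sum_range_exp_mul_le hβ K
  have g2 := sum_range_exp_neg_mul_le hc (K + 1)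
  set E := Real.exp (-(lam * c / (c + β))) with hE
  have g3 : Real.exp (-lam) * Real.exp (β * K) ≤ E := by
    rw [← Real.exp_add, hE]
    refine Real.exp_le_exp.2 ?_
    have h1 : β * K ≤ β * v := by gcongr
    have h2 : -lam + β * v = -(lam * c / (c + β)) := by rw [hv]; field_simp; ring
    linarith
  have hE0 : 0 < E := Real.exp_pos _
  set a := Real.exp β / (Real.exp β - 1) with ha
  set b := 1 / (1 - Real.exp (-c)) with hb
  have ha0 : 0 < a := by positivity
  have hb0 : 0 < b := by positivity
  have g4 : Real.exp (-lam) * ∑ k ∈ Finset.range (K + 1), Real.exp (β * k) ≤ a * E := by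
    calc _ ≤ Real.exp (-lam) * (a * Real.exp (β * K)) := by gcongr
      _ = a * (Real.exp (-lam) * Real.exp (β * K)) := by ring
      _ ≤ _ := by gcongr
  calc C₀ * Real.exp C₁ * Real.exp F * (Real.exp (-lam) *
        ∑ k ∈ Finset.range (K + 1), Real.exp (β * k)
          + τ * ∑ k ∈ Finset.range (K + 1), Real.exp (-(c * k)))
      ≤ C₀ * Real.exp C₁ * Real.exp F * (a * E + τ * b) := by gcongr
    _ ≤ C₀ * Real.exp C₁ * Real.exp F * ((a + b) * (E + τ)) := by
        gcongr
        nlinarith [mul_pos ha0 hτ0, mul_pos hb0 hE0]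
    _ = _ := by ring

open MeasureTheory in
-- The range below U is bounded by exp(M(0) - M(U)), M(w) the mass of (w, x]. As log(log x/log U) =
-- λ/(c+β), the lower bound for M(U) saves e^{-λc/(c+β)}, the same as the blocks above U.
theorem exists_setIntegral_summatory_le {β c c₁ : ℝ} (hβ : 0 < β) (hc : 0 < c) (hc₁ : 0 < c₁) :
    ∃ C : ℝ, 0 < C ∧ ∀ (g : ℕ → ℂ) (Y x T lam : ℝ), HalaszHyp β c c₁ g Y x T lam →
      ∀ U : ℝ, Real.log U = Real.exp (-(lam / (c + β))) * Real.log x → Y ≤ U → 2 ≤ Real.log U →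
        ∫ w in Set.Ioc (1 / 2) x, ‖summatory (expMul g) w‖ / w ^ 2
        ≤ C * (Real.exp (primeMass g 0 x) *
            (Real.exp (-(lam * c / (c + β))) + T ^ (-(1 / 2) : ℝ))) := by
  obtain ⟨C₀, hC₀, h₀⟩ := exists_setIntegral_summatory_log_le hβ hc hc₁
  obtain ⟨C₁, hC₁, h₁⟩ := exists_primeMass_bounds hβ hc hc₁
  refine ⟨2 * (Real.exp C₁ + C₀), by positivity, fun g Y x T lam H U hU hYU hU2 => ?_⟩
  have h₀ := h₀ g Y x T lam H U hU hYU hU2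
  set v := lam / (c + β) with hv
  have hv0 : 0 ≤ v := div_nonneg H.lam_nonneg (by linarith)
  have hx0 : 0 < x := by linarith [H.le_Y, H.Y_le]
  have hU0 : 0 < U := by linarith [H.le_Y]
  have hL0 : 0 < Real.log x := Real.log_pos (by linarith [H.le_Y, H.Y_le])
  have hUx : U ≤ x := by
    rw [← Real.log_le_log_iff hU0 hx0, hU]
    have : Real.exp (-v) ≤ 1 := Real.exp_le_one_iff.2 (by linarith)
    nlinarith
  have hlog : Real.log (Real.log x / Real.log U) = v := by
    rw [hU, Real.exp_neg, ← div_div, div_inv_eq_mul, mul_comm (Real.log x), mul_div_assoc,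
      div_self hL0.ne', mul_one, Real.log_exp]
  have hm := ((h₁ g Y x T lam H).2 U hYU hUx).2
  rw [hlog] at hm
  have hadd := primeMass_add g (w := 0) (v := U) (x := x) hU0.le hUx
  have hS := summatory_norm_expMul_div_le g U
  change _ ≤ Real.exp (primeMass g 0 U) at hS
  have hexp : Real.exp (primeMass g 0 U) ≤ Real.exp C₁ *
      (Real.exp (primeMass g 0 x) * Real.exp (-(lam * c / (c + β)))) := by
    rw [← Real.exp_add, ← Real.exp_add]
    refine Real.exp_le_exp.2 ?_
    have : lam * c / (c + β) = c * v := by rw [hv]; ring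
    rw [this]
    linarith
  have hI := setIntegral_norm_summatory_div_sq_le_two_mul (f := expMul g) (by simp) hU2
    (by linarith [H.le_Y]) hUx
  refine hI.trans ?_
  set τ := T ^ (-(1 / 2) : ℝ) with hτ
  have hτ0 : 0 < τ := Real.rpow_pos_of_pos (by linarith [H.one_le_T]) _
  have h3 : 0 < Real.exp C₁ * (Real.exp (primeMass g 0 x) * τ) := by positivity
  nlinarith


/-! ### From the logarithmic mean to a pointwise bound: the bootstrap. -/

theorem norm_summatory_expMul_le (g : ℕ → ℂ) {u x : ℝ} (hu : 0 ≤ u) (hux : u ≤ x) :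
    ‖summatory (expMul g) u‖ ≤ u * Real.exp (primeMass g 0 x) := by
  refine (norm_summatory_le _ u).trans ((summatory_norm_le_mul _ hu).trans ?_)
  have h := summatory_norm_expMul_div_le g u
  have h2 : Real.exp (primeMass g 0 u) ≤ Real.exp (primeMass g 0 x) :=
    Real.exp_le_exp.2 (primeMass_mono g hux)
  exact mul_le_mul_of_nonneg_left (h.trans h2) hu

/-- The elementary bound saves log u; writing log x = log u + log(x/u), with the trivial bound for
the second term, makes it uniform in u ≤ x. -/
theorem norm_summatory_expMul_mul_log_le {β : ℝ} {g : ℕ → ℂ}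
    (hg : ∀ p : ℕ, p.Prime → ‖g p‖ ≤ β) {u x : ℝ} (hu : 1 ≤ u) (hux : u ≤ x) :
    ‖summatory (expMul g) u‖ * Real.log x
      ≤ (2 * β + 1) * (u * (1 + Real.log (x / u)) * Real.exp (primeMass g 0 x)) := by
  have hβ : 0 ≤ β := (norm_nonneg _).trans (hg 2 Nat.prime_two)
  have hlog : 0 ≤ Real.log (x / u) := Real.log_nonneg (by rwa [le_div_iff₀ (by linarith), one_mul])
  have hsplit : Real.log x = Real.log u + Real.log (x / u) := by
    rw [Real.log_div (by linarith) (by linarith)]; ring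
  have h1 := norm_summatory_expMul_le g (u := u) (x := x) (by linarith) hux
  have h2 := summatory_norm_expMul_mul_log_le hg hu
  have h3 : ‖summatory (expMul g) u‖ * Real.log u
      ≤ (2 * β + 1) * u * Real.exp (primeMass g 0 x) := by
    refine le_trans (mul_le_mul_of_nonneg_right (norm_summatory_le _ u) (Real.log_nonneg hu))
      (h2.trans ?_)
    have : Real.exp (primeMass g 0 u) ≤ Real.exp (primeMass g 0 x) :=
      Real.exp_le_exp.2 (primeMass_mono g hux)
    exact mul_le_mul_of_nonneg_left this (by positivity)
  set E := Real.exp (primeMass g 0 x) with hE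
  have hE0 : 0 < E := Real.exp_pos _
  rw [hsplit, mul_add]
  have h4 : ‖summatory (expMul g) u‖ * Real.log (x / u) ≤ u * E * Real.log (x / u) := by gcongr
  have h5 : 0 ≤ 2 * β * (u * E * Real.log (x / u)) := by positivity
  nlinarith

/-- Submultiplicativity of the weight: it lets the bootstrap pass from u to u/p and, later, lets an
Euler product handle the weighted sum of h. -/
theorem one_add_log_mul_rpow_le {γ v w : ℝ} (hγ : 0 ≤ γ) (hv : 1 ≤ v) (hw : 1 ≤ w) :
    (1 + Real.log (v * w)) ^ γ ≤ (1 + Real.log v) ^ γ * (1 + Real.log w) ^ γ := by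
  have h1 := Real.log_nonneg hv
  have h2 := Real.log_nonneg hw
  rw [Real.log_mul (by linarith) (by linarith), ← Real.mul_rpow (by linarith) (by linarith)]
  refine Real.rpow_le_rpow (by linarith) ?_ hγ
  nlinarith

open MeasureTheory in
/-- One step of the bootstrap: from a bound for `S` with constant `M` to a bound for `S(u) log u`
where `M` occurs with a factor that is only a power of `log P`. -/
theorem exists_norm_summatory_mul_log_le_of_bound :
    ∃ C : ℝ, 0 < C ∧ ∀ (β : ℝ) (g : ℕ → ℂ), (∀ p : ℕ, p.Prime → ‖g p‖ ≤ β) →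
      ∀ γ x M η P : ℝ, 0 ≤ γ → 0 ≤ M → 0 < η → η ≤ 1 → 4 / η ^ 2 ≤ P →
      (∀ v : ℝ, 1 ≤ v → v ≤ x →
        ‖summatory (expMul g) v‖ ≤ M * (v * (1 + Real.log (x / v)) ^ γ)) →
      ∀ u : ℝ, 1 ≤ u → u ≤ x → ‖summatory (expMul g) u‖ * Real.log u ≤
        (1 + 600 * β) * u * (∫ w in Set.Ioc (1 / 2) x, ‖summatory (expMul g) w‖ / w ^ 2)
          + 300 * β * η * u * Real.exp (primeMass g 0 x)
          + β * M * u * (1 + Real.log (x / u)) ^ γ * ((1 + Real.log P) ^ γ * (Real.log P + C)) := by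
  obtain ⟨C, hC, hmert⟩ := exists_abs_sum_prime_log_div_sub_log_le
  refine ⟨C, hC, fun β g hg γ x M η P hγ hM hη hη1 hP hbd u hu hux => ?_⟩
  have hβ : 0 ≤ β := (norm_nonneg _).trans (hg 2 Nat.prime_two)
  set S := summatory (expMul g) with hS
  set I := ∫ w in Set.Ioc (1 / 2) x, ‖S w‖ / w ^ 2 with hI
  have hu0 : 0 < u := by linarith
  have hP4 : 4 ≤ P := by
    refine le_trans ?_ hP
    rw [le_div_iff₀ (by positivity)]
    nlinarith
  have hIu : ∫ w in Set.Ioc (1 / 2) u, ‖S w‖ / w ^ 2 ≤ I :=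
    setIntegral_mono_set (integrableOn_norm_summatory_div_sq _ (by norm_num) x)
      (.of_forall fun w => by positivity) (Set.Ioc_subset_Ioc_right hux).eventuallyLE
  have h1 := norm_summatory_mul_log_le (f := expMul g) (by simp) hu
  have hR : ∫ v in Set.Ioc (1 / 2) u, ‖S v‖ / v ≤ u * I := by
    refine le_trans ?_ (mul_le_mul_of_nonneg_left hIu hu0.le)
    rw [← integral_const_mul]
    refine setIntegral_mono_on (integrableOn_norm_summatory_div _ (by norm_num) u)
      ((integrableOn_norm_summatory_div_sq _ (by norm_num) u).const_mul u) measurableSet_Ioc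
      fun w hw => ?_
    have hw0 : 0 < w := by linarith [hw.1]
    rw [mul_div_assoc', div_le_div_iff₀ hw0 (by positivity)]
    have : ‖S w‖ * w * w ≤ ‖S w‖ * w * u := by
      have := hw.2
      gcongr
    nlinarith
  have hlog0 : ∀ p : ℕ, 0 ≤ Real.log p := fun p => Real.log_natCast_nonneg p
  have hN : ‖summatory (fun n => expMul g n * (Real.log n : ℂ)) u‖
      ≤ β * ∑ p ∈ primesIoc 0 u, Real.log p * ‖S (u / p)‖ := by
    rw [summatory_expMul_mul_log, Finset.mul_sum]
    refine (norm_sum_le _ _).trans (Finset.sum_le_sum fun p hp => ?_)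
    rw [norm_mul, norm_mul, Complex.norm_real, Real.norm_of_nonneg (hlog0 p), mul_assoc]
    exact mul_le_mul_of_nonneg_right (hg p (prime_of_mem_primesIoc hp))
      (mul_nonneg (hlog0 p) (norm_nonneg _))
  -- Only an inequality, since P may exceed u.
  have hsplit : ∑ p ∈ primesIoc 0 u, Real.log p * ‖S (u / p)‖
      ≤ ∑ p ∈ primesIoc 0 P, Real.log p * ‖S (u / p)‖
        + ∑ p ∈ primesIoc P u, Real.log p * ‖S (u / p)‖ := by
    have hnn : ∀ p : ℕ, 0 ≤ Real.log p * ‖S (u / p)‖ := fun p =>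
      mul_nonneg (hlog0 p) (norm_nonneg _)
    rw [← Finset.sum_union_inter]
    refine le_trans (Finset.sum_le_sum_of_subset_of_nonneg (fun p hp => ?_) fun p _ _ => hnn p)
      (le_add_of_nonneg_right (Finset.sum_nonneg fun p _ => hnn p))
    rw [mem_primesIoc le_rfl] at hp
    rw [Finset.mem_union, mem_primesIoc le_rfl, mem_primesIoc (by linarith)]
    rcases le_or_gt (p : ℝ) P with h | h
    · exact Or.inl ⟨hp.1, hp.2.1, h⟩
    · exact Or.inr ⟨hp.1, h, hp.2.2⟩
  set ω := (1 + Real.log (x / u)) ^ γ with hω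
  have hxu : 1 ≤ x / u := by rwa [le_div_iff₀ hu0, one_mul]
  have hω0 : 0 ≤ ω := Real.rpow_nonneg (by linarith [Real.log_nonneg hxu]) _
  have hlP : 0 ≤ Real.log P := Real.log_nonneg (by linarith)
  have hsmall : ∑ p ∈ primesIoc 0 P, Real.log p * ‖S (u / p)‖
      ≤ M * u * ω * ((1 + Real.log P) ^ γ * (Real.log P + C)) := by
    have hm := (abs_le.1 (hmert P (by linarith))).2
    calc _ ≤ ∑ p ∈ primesIoc 0 P, M * u * ω * (1 + Real.log P) ^ γ * (Real.log p / p) := by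
          refine Finset.sum_le_sum fun p hp => ?_
          obtain ⟨hpp, -, hpP⟩ := (mem_primesIoc le_rfl).1 hp
          have hp1 : (1 : ℝ) ≤ p := by exact_mod_cast hpp.one_le
          have hp0 : (0 : ℝ) < p := by linarith
          have hb : ‖S (u / p)‖ ≤ M * (u / p * (ω * (1 + Real.log P) ^ γ)) := by
            rcases lt_or_ge (u / p) 1 with h | h
            · rw [hS, summatory_of_lt_one _ h, norm_zero]
              positivity
            · refine (hbd _ h ((div_le_self hu0.le hp1).trans hux)).trans ?_
              have e : x / (u / p) = x / u * p := by field_simp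
              rw [e]
              have h2 := one_add_log_mul_rpow_le hγ hxu hp1
              have h3 : (1 + Real.log p) ^ γ ≤ (1 + Real.log P) ^ γ :=
                Real.rpow_le_rpow (by linarith [hlog0 p])
                  (by linarith [Real.log_le_log hp0 hpP]) hγ
              have h4 : (1 + Real.log (x / u * p)) ^ γ ≤ ω * (1 + Real.log P) ^ γ :=
                h2.trans (mul_le_mul_of_nonneg_left h3 hω0)
              gcongr
          calc Real.log p * ‖S (u / p)‖
              ≤ Real.log p * (M * (u / p * (ω * (1 + Real.log P) ^ γ))) :=
                mul_le_mul_of_nonneg_left hb (hlog0 p)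
            _ = _ := by field_simp
      _ = M * u * ω * (1 + Real.log P) ^ γ * ∑ p ∈ primesIoc 0 P, Real.log p / p := by
          rw [Finset.mul_sum]
      _ ≤ M * u * ω * (1 + Real.log P) ^ γ * (Real.log P + C) := by
          gcongr
          linarith
      _ = _ := by ring
  have hlarge := sum_log_mul_norm_summatory_div_le (expMul g) hη hη1 hP hu
  have hsum : summatory (fun n => ‖expMul g n‖ / n) u ≤ Real.exp (primeMass g 0 x) :=
    (summatory_norm_expMul_div_le g u).trans (Real.exp_le_exp.2 (primeMass_mono g hux))
  have hlarge' : ∑ p ∈ primesIoc P u, Real.log p * ‖S (u / p)‖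
      ≤ 600 * u * I + 300 * η * u * Real.exp (primeMass g 0 x) := by
    refine hlarge.trans ?_
    gcongr
  calc ‖S u‖ * Real.log u
      ≤ β * (M * u * ω * ((1 + Real.log P) ^ γ * (Real.log P + C))
        + (600 * u * I + 300 * η * u * Real.exp (primeMass g 0 x))) + u * I := by
        refine h1.trans (add_le_add (hN.trans (mul_le_mul_of_nonneg_left ?_ hβ)) hR)
        exact hsplit.trans (add_le_add hsmall hlarge')
    _ = _ := by ring

open Filter Asymptotics in
-- With η = L^{-θ} and P = 4/η² the logarithm of P is O(log L), so the cost of the small primes is a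
-- power of log L and hence o(L).
theorem exists_log_rpow_mul_le (γ θ C ε : ℝ) (hγ : 0 < γ) (hθ : 0 < θ) (hC : 0 < C) (hε : 0 < ε) :
    ∃ L₀ : ℝ, 1 ≤ L₀ ∧ ∀ L : ℝ, L₀ ≤ L →
      (1 + Real.log (4 / (L ^ (-θ)) ^ 2)) ^ γ * (Real.log (4 / (L ^ (-θ)) ^ 2) + C) ≤ ε * L := by
  set D := 1 + Real.log 4 + C + 2 * θ with hD
  have hl4 : 0 < Real.log 4 := Real.log_pos (by norm_num)
  have hD0 : 0 < D := by positivity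
  have ho := (isLittleO_log_rpow_rpow_atTop (γ + 1) one_pos).bound
    (show 0 < ε / D ^ (γ + 1) by positivity)
  obtain ⟨L₁, hL₁⟩ := eventually_atTop.1 ho
  refine ⟨max L₁ (Real.exp 1), le_max_of_le_right (Real.one_le_exp (by norm_num)),
    fun L hL => ?_⟩
  have hLe : Real.exp 1 ≤ L := (le_max_right _ _).trans hL
  have hL0 : 0 < L := (Real.exp_pos 1).trans_le hLe
  have hlog : 1 ≤ Real.log L := by rwa [Real.le_log_iff_exp_le hL0]
  have h1 := hL₁ L ((le_max_left _ _).trans hL)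
  rw [Real.rpow_one, Real.norm_of_nonneg (by positivity), Real.norm_of_nonneg hL0.le] at h1
  have e : Real.log (4 / (L ^ (-θ)) ^ 2) = Real.log 4 + 2 * θ * Real.log L := by
    rw [Real.log_div (by norm_num) (by positivity), Real.log_pow, Real.log_rpow hL0]
    push_cast; ring
  rw [e]
  set ℓ := Real.log L with hℓ
  have ha : 1 + (Real.log 4 + 2 * θ * ℓ) ≤ D * ℓ := by rw [hD]; nlinarith
  have hb : Real.log 4 + 2 * θ * ℓ + C ≤ D * ℓ := by rw [hD]; nlinarith
  have h0 : 0 ≤ Real.log 4 + 2 * θ * ℓ := by positivity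
  calc (1 + (Real.log 4 + 2 * θ * ℓ)) ^ γ * (Real.log 4 + 2 * θ * ℓ + C)
      ≤ (D * ℓ) ^ γ * (D * ℓ) := by gcongr
    _ = D ^ (γ + 1) * ℓ ^ (γ + 1) := by
        rw [← Real.mul_rpow hD0.le (by linarith), Real.rpow_add_one (by positivity)]
    _ ≤ D ^ (γ + 1) * (ε / D ^ (γ + 1) * L) := by gcongr
    _ = ε * L := by field_simp


theorem one_third_le_log {Y : ℝ} (hY : 3 / 2 ≤ Y) : 1 / 3 ≤ Real.log Y := by
  have h1 := Real.one_sub_inv_le_log_of_pos (x := Y) (by linarith)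
  have h2 : Y⁻¹ ≤ (3 / 2)⁻¹ := inv_anti₀ (by norm_num) hY
  norm_num at h2
  linarith

/-- A quantity bounded by `R + M / 2` as soon as it is bounded by `M` is bounded by `2 R`. -/
theorem le_two_mul_of_bootstrap {ι : Type*} {φ : ι → ℝ} {R M₀ : ℝ} (hφ : ∀ i, 0 ≤ φ i)
    (h₀ : ∀ i, φ i ≤ M₀)
    (h : ∀ M : ℝ, 0 ≤ M → (∀ i, φ i ≤ M) → ∀ i, φ i ≤ R + M / 2) (i : ι) : φ i ≤ 2 * R := by
  have hb : BddAbove (Set.range φ) := ⟨M₀, by rintro _ ⟨j, rfl⟩; exact h₀ j⟩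
  have hne : (Set.range φ).Nonempty := ⟨_, i, rfl⟩
  have h1 : ∀ j, φ j ≤ sSup (Set.range φ) := fun j => le_csSup hb ⟨j, rfl⟩
  have h2 : sSup (Set.range φ) ≤ R + sSup (Set.range φ) / 2 := by
    refine csSup_le hne ?_
    rintro _ ⟨j, rfl⟩
    exact h _ ((hφ i).trans (h1 i)) h1 j
  linarith [h1 i]

/-- The bootstrap argument, for a function `S` with `|S(u)| ≤ F u`. -/
theorem norm_le_of_bootstrap_step {S : ℝ → ℂ} {β θ κ C₂ x I F E τ Z : ℝ} (hβ : 0 < β)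
    (hθ : 0 < θ) (hκ : 0 < κ) (hC₂ : 0 < C₂) (hF : 0 < F) (hE : 0 < E) (hτ : 0 < τ)
    (hL : 0 < Real.log x)
    (htriv : ∀ u, 1 ≤ u → u ≤ x → ‖S u‖ ≤ u * F)
    (hI : I ≤ C₂ * (F * (E + τ))) (hκE : κ * Real.log x ^ (-θ) ≤ E)
    (hZ : Z ≤ 1 / (4 * β) * Real.log x)
    (hstep : ∀ M : ℝ, 0 ≤ M →
      (∀ v : ℝ, 1 ≤ v → v ≤ x → ‖S v‖ ≤ M * (v * (1 + Real.log (x / v)) ^ (1 + θ))) →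
      ∀ u : ℝ, 1 ≤ u → u ≤ x → ‖S u‖ * Real.log u ≤ (1 + 600 * β) * u * I
        + 300 * β * Real.log x ^ (-θ) * u * F
        + β * M * u * (1 + Real.log (x / u)) ^ (1 + θ) * Z)
    {u : ℝ} (hu : 1 ≤ u) (hux : u ≤ x) :
    ‖S u‖ ≤ 2 * (2 * ((1 + 600 * β) * C₂ + 300 * β / κ) + 2 ^ (1 + θ) / κ) *
      (u * (1 + Real.log (x / u)) ^ (1 + θ) * (F / Real.log x * (E + τ))) := by
  set K₁ := (1 + 600 * β) * C₂ + 300 * β / κ with hK₁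
  have hK₁0 : 0 < K₁ := by positivity
  set K₂ := 2 ^ (1 + θ) / κ with hK₂
  have hK₂0 : 0 < K₂ := by positivity
  set L := Real.log x with hLd
  set η := L ^ (-θ) with hη
  have hη0 : 0 < η := Real.rpow_pos_of_pos hL _
  have hηE : η ≤ E / κ := by rw [le_div_iff₀ hκ]; linarith
  set ω : ℝ → ℝ := fun w => (1 + Real.log (x / w)) ^ (1 + θ) with hω
  have hlw : ∀ w, 1 ≤ w → w ≤ x → 0 ≤ Real.log (x / w) := fun w h1 h2 =>
    Real.log_nonneg (by rwa [le_div_iff₀ (by linarith), one_mul])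
  have hω1 : ∀ w, 1 ≤ w → w ≤ x → 1 ≤ ω w := fun w h1 h2 =>
    Real.one_le_rpow (by linarith [hlw w h1 h2]) (by linarith)
  set G := F / L * (E + τ) with hG
  have hG0 : 0 < G := by positivity
  -- For log w ≥ L/2, the bound Z ≤ L/(4β) makes the returned multiple of M exactly (L/4)/(L/2) =
  -- 1/2.
  have hlarge : ∀ M : ℝ, 0 ≤ M → (∀ v : ℝ, 1 ≤ v → v ≤ x → ‖S v‖ ≤ M * (v * ω v)) →
      ∀ w : ℝ, 1 ≤ w → w ≤ x → L / 2 ≤ Real.log w →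
      ‖S w‖ ≤ 2 * K₁ * G * w + M / 2 * (w * ω w) := by
    intro M hM hbd w hw1 hwx hcase
    have hw0 : 0 < w := by linarith
    have hωw := hω1 w hw1 hwx
    have h := hstep M hM hbd w hw1 hwx
    have hA : (1 + 600 * β) * w * I ≤ (1 + 600 * β) * w * (C₂ * (F * (E + τ))) := by gcongr
    have hB : 300 * β * η * w * F ≤ 300 * β / κ * w * (F * (E + τ)) := by
      calc 300 * β * η * w * F ≤ 300 * β * (E / κ) * w * F := by gcongr
        _ = 300 * β / κ * w * (F * E) := by ring
        _ ≤ _ := by gcongr; linarith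
    have hC : β * M * w * ω w * Z ≤ β * M * w * ω w * (1 / (4 * β) * L) := by gcongr
    have hCe : β * M * w * ω w * (1 / (4 * β) * L) = M * w * ω w * L / 4 := by field_simp
    have hlow : ‖S w‖ * (L / 2) ≤ ‖S w‖ * Real.log w := by gcongr
    have hsum : ‖S w‖ * (L / 2) ≤ K₁ * w * (F * (E + τ)) + M * w * ω w * L / 4 := by
      have : K₁ * w * (F * (E + τ)) = (1 + 600 * β) * w * (C₂ * (F * (E + τ)))
        + 300 * β / κ * w * (F * (E + τ)) := by rw [hK₁]; ring
      linarith
    rw [← mul_le_mul_iff_left₀ (by positivity : 0 < L / 2)]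
    refine hsum.trans (le_of_eq ?_)
    rw [hG]
    field_simp
    ring
  -- For log w < L/2 the weight is at least (L/2)^(1+θ). The factor L recovers the logarithm missing
  -- from the trivial bound, and L^θ ≥ κ/E supplies E; this fixes the exponent 1 + θ.
  have hsmall : ∀ w : ℝ, 1 ≤ w → w ≤ x → Real.log w < L / 2 → ‖S w‖ ≤ K₂ * G * (w * ω w) := by
    intro w hw1 hwx hcase
    have hw0 : 0 < w := by linarith
    have hωw := hω1 w hw1 hwx
    have hlogw : L = Real.log w + Real.log (x / w) := by
      rw [Real.log_div (by linarith) (by linarith)]; ring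
    have h2 : (L / 2) ^ (1 + θ) ≤ ω w :=
      Real.rpow_le_rpow (by positivity) (by linarith) (by linarith)
    have h3 : (L / 2) ^ (1 + θ) = L / (2 ^ (1 + θ) * η) := by
      rw [Real.div_rpow hL.le (by norm_num), Real.rpow_add hL, Real.rpow_one, hη,
        Real.rpow_neg hL.le]
      field_simp
    rw [h3, div_le_iff₀ (by positivity)] at h2
    have h5 : L ≤ ω w * (2 ^ (1 + θ) * (E / κ)) := h2.trans (by gcongr)
    calc ‖S w‖ ≤ w * F := htriv w hw1 hwx
      _ = w * (F / L * L) := by field_simp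
      _ ≤ w * (F / L * (ω w * (2 ^ (1 + θ) * (E / κ)))) := by gcongr
      _ = K₂ * (F / L * E) * (w * ω w) := by rw [hK₂]; ring
      _ ≤ _ := by rw [hG]; gcongr; linarith
  -- The trivial bound |S(w)| ≤ wF provides the finite initial constant M₀ = F that the absorption
  -- argument requires.
  have hres := le_two_mul_of_bootstrap (φ := fun w : Set.Icc 1 x => ‖S w‖ / (w * ω w))
    (R := (2 * K₁ + K₂) * G) (M₀ := F) (fun ⟨w, hw1, hwx⟩ => by
      have := hω1 w hw1 hwx
      have hw0 : 0 < w := by linarith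
      exact div_nonneg (norm_nonneg _) (by positivity)) (fun ⟨w, hw1, hwx⟩ => by
      have := hω1 w hw1 hwx
      have hw0 : 0 < w := by linarith
      change ‖S w‖ / (w * ω w) ≤ F
      rw [div_le_iff₀ (by positivity)]
      calc ‖S w‖ ≤ F * (w * 1) := by linarith [htriv w hw1 hwx]
        _ ≤ F * (w * ω w) := by gcongr) (fun M hM hbd ⟨w, hw1, hwx⟩ => by
      have hωw := hω1 w hw1 hwx
      have hw0 : 0 < w := by linarith
      change ‖S w‖ / (w * ω w) ≤ (2 * K₁ + K₂) * G + M / 2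
      rw [div_le_iff₀ (by positivity), add_mul]
      rcases le_or_gt (L / 2) (Real.log w) with hcase | hcase
      · refine (hlarge M hM (fun v hv1 hvx => ?_) w hw1 hwx hcase).trans ?_
        · have hωv := hω1 v hv1 hvx
          have := hbd ⟨v, hv1, hvx⟩
          change ‖S v‖ / (v * ω v) ≤ M at this
          rwa [div_le_iff₀ (by positivity)] at this
        · gcongr
          · linarith
          · exact le_mul_of_one_le_right hw0.le hωw
      · have h1 := hsmall w hw1 hwx hcase
        have h2 : 0 ≤ 2 * K₁ * G * (w * ω w) := by positivity
        have h3 : 0 ≤ M / 2 * (w * ω w) := by positivity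
        linarith) ⟨u, hu, hux⟩
  have hωu := hω1 u hu hux
  change ‖S u‖ / (u * ω u) ≤ _ at hres
  rw [div_le_iff₀ (by positivity)] at hres
  refine hres.trans (le_of_eq ?_)
  ring

/-! ### Choice of parameters and the estimate for exponentially multiplicative functions. -/

/-- Everything follows from λ ≤ βV + C₁, V = log(log x/log Y). Then V - λ/(c+β) ≥ Vc/(c+β) - O(1),
so U clears Y once V is large, and λc/(c+β) ≤ θV + O(1), which gives e^{-λc/(c+β)} ≫ L^{-θ}. -/
theorem exists_parameters {β c c₁ : ℝ} (hβ : 0 < β) (hc : 0 < c) (hc₁ : 0 < c₁) :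
    ∃ κ : ℝ, 0 < κ ∧ ∀ L₀ : ℝ, 1 ≤ L₀ → ∃ V₀ : ℝ, 0 ≤ V₀ ∧ ∀ (g : ℕ → ℂ) (Y x T lam : ℝ),
      HalaszHyp β c c₁ g Y x T lam → V₀ ≤ Real.log (Real.log x / Real.log Y) →
        L₀ ≤ Real.log x ∧
        κ * Real.log x ^ (-(c * β / (c + β))) ≤ Real.exp (-(lam * c / (c + β))) ∧
        ∃ U : ℝ, Real.log U = Real.exp (-(lam / (c + β))) * Real.log x ∧ Y ≤ U ∧
          2 ≤ Real.log U := by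
  obtain ⟨C₁, hC₁, h₁⟩ := exists_primeMass_bounds hβ hc hc₁
  set θ := c * β / (c + β) with hθ
  have hθ0 : 0 < θ := by positivity
  have hcβ : 0 < c + β := by linarith
  -- The log 3 comes from log Y ≥ 1/3, that is, V ≤ log L + log 3.
  refine ⟨Real.exp (-(θ * Real.log 3 + C₁ * c / (c + β))), Real.exp_pos _, fun L₀ hL₀1 =>
    ⟨max ((2 + C₁ / (c + β)) * ((c + β) / c)) (Real.log (3 * L₀)),
    le_max_of_le_left (by positivity), fun g Y x T lam H hV => ?_⟩⟩
  set L := Real.log x with hL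
  set V := Real.log (L / Real.log Y) with hVd
  have hx1 : 3 / 2 ≤ x := H.le_Y.trans H.Y_le
  have hlY := one_third_le_log H.le_Y
  have hlY0 : 0 < Real.log Y := by linarith
  have hLpos : 0 < L := by linarith [one_third_le_log hx1]
  have hLV : L = Real.exp V * Real.log Y := by
    rw [hVd, Real.exp_log (by positivity)]; field_simp
  have hLL : L₀ ≤ L := by
    have h1 : Real.log (3 * L₀) ≤ V := (le_max_right _ _).trans hV
    rw [Real.log_le_iff_le_exp (by linarith)] at h1
    rw [hLV]
    nlinarith [Real.exp_pos V]
  obtain ⟨hlam, -⟩ := h₁ g Y x T lam H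
  set v := lam / (c + β) with hv
  -- A margin of 2 gives log U ≥ e² log Y ≥ 6 · (1/3) = 2.
  have hVv : 2 ≤ V - v := by
    have h1 : (2 + C₁ / (c + β)) * ((c + β) / c) ≤ V := (le_max_left _ _).trans hV
    have h2 : v ≤ (β * V + C₁) / (c + β) := by
      rw [hv]
      gcongr
    have h3 : 2 + C₁ / (c + β) ≤ V * (c / (c + β)) := by
      have := mul_le_mul_of_nonneg_right h1 (by positivity : 0 ≤ c / (c + β))
      refine le_trans (le_of_eq ?_) this
      field_simp
    have h4 : (β * V + C₁) / (c + β) = V - V * (c / (c + β)) + C₁ / (c + β) := by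
      field_simp; ring
    linarith
  refine ⟨hLL, ?_, Real.exp (Real.exp (-v) * L), Real.log_exp _, ?_⟩
  · rw [Real.rpow_def_of_pos hLpos, ← Real.exp_add]
    refine Real.exp_le_exp.2 ?_
    have hVle : V ≤ Real.log L + Real.log 3 := by
      rw [hVd, ← Real.log_mul hLpos.ne' (by norm_num)]
      refine Real.log_le_log (by positivity) ?_
      rw [div_le_iff₀ hlY0]
      nlinarith
    have h5 : lam * c / (c + β) ≤ θ * V + C₁ * c / (c + β) := by
      have : (β * V + C₁) * c / (c + β) = θ * V + C₁ * c / (c + β) := by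
        rw [hθ]; field_simp
      rw [← this]
      gcongr
    nlinarith
  · rw [Real.log_exp]
    have hlU2 : Real.exp 2 * Real.log Y ≤ Real.exp (-v) * L := by
      rw [hLV, ← mul_assoc, ← Real.exp_add]
      gcongr
      linarith
    have he2 : 6 ≤ Real.exp 2 := by
      have h1 := Real.exp_one_gt_d9
      have h2 : Real.exp 2 = Real.exp 1 * Real.exp 1 := by rw [← Real.exp_add]; norm_num
      rw [h2]
      nlinarith
    refine ⟨?_, by nlinarith⟩
    rw [← Real.log_le_log_iff (by linarith [H.le_Y]) (Real.exp_pos _), Real.log_exp]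
    nlinarith

theorem exists_norm_summatory_expMul_le_of_large {β c c₁ : ℝ} (hβ : 0 < β) (hc : 0 < c)
    (hc₁ : 0 < c₁) :
    ∃ C V₀ : ℝ, 0 < C ∧ 0 ≤ V₀ ∧ ∀ (g : ℕ → ℂ) (Y x T lam : ℝ), HalaszHyp β c c₁ g Y x T lam →
      V₀ ≤ Real.log (Real.log x / Real.log Y) → ∀ u : ℝ, 1 ≤ u → u ≤ x →
        ‖summatory (expMul g) u‖ ≤ C * (u * (1 + Real.log (x / u)) ^ (1 + c * β / (c + β)) *
          (Real.exp (primeMass g 0 x) / Real.log x *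
            (Real.exp (-(lam * c / (c + β))) + T ^ (-(1 / 2) : ℝ)))) := by
  obtain ⟨κ, hκ, hpar⟩ := exists_parameters hβ hc hc₁
  obtain ⟨C₂, hC₂, h₂⟩ := exists_setIntegral_summatory_le hβ hc hc₁
  obtain ⟨C₃, hC₃, h₃⟩ := exists_norm_summatory_mul_log_le_of_bound
  set θ := c * β / (c + β) with hθ
  have hθ0 : 0 < θ := by positivity
  obtain ⟨L₀, hL₀1, hL₀⟩ := exists_log_rpow_mul_le (1 + θ) θ C₃ (1 / (4 * β)) (by linarith) hθ0
    hC₃ (by positivity)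
  obtain ⟨V₀, hV₀, hpar⟩ := hpar L₀ hL₀1
  refine ⟨2 * (2 * ((1 + 600 * β) * C₂ + 300 * β / κ) + 2 ^ (1 + θ) / κ), V₀, by positivity, hV₀,
    fun g Y x T lam H hV u hu hux => ?_⟩
  obtain ⟨hLL, hκE, U, hlU, hYU, hlU2⟩ := hpar g Y x T lam H hV
  have hL1 := hL₀1.trans hLL
  have hL0 : 0 < Real.log x := by linarith
  refine norm_le_of_bootstrap_step hβ hθ0 hκ hC₂ (Real.exp_pos _) (Real.exp_pos _)
    (Real.rpow_pos_of_pos (by linarith [H.one_le_T]) _) hL0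
    (fun w hw1 hwx => norm_summatory_expMul_le g (by linarith) hwx)
    (h₂ g Y x T lam H U hlU hYU hlU2) hκE (hL₀ _ hLL) (fun M hM hbd w hw1 hwx => ?_) hu hux
  -- The side conditions fix η = (log x)^(-θ), and `le_rfl` fixes P = 4/η².
  exact h₃ β g H.norm_le (1 + θ) x M _ _ (by linarith) hM (Real.rpow_pos_of_pos hL0 _)
    (Real.rpow_le_one_of_one_le_of_nonpos hL1 (by linarith)) le_rfl hbd w hw1 hwx

/-- The Halász-type estimate for exponentially multiplicative functions. -/
theorem exists_norm_summatory_expMul_le {β c c₁ : ℝ} (hβ : 0 < β) (hc : 0 < c) (hc₁ : 0 < c₁) :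
    ∃ C : ℝ, 0 < C ∧ ∀ g : ℕ → ℂ, (∀ p : ℕ, p.Prime → ‖g p‖ ≤ β) →
      ∀ Y x : ℝ, 3 / 2 ≤ Y → Y ≤ x →
      (∀ w : ℝ, Y ≤ w → w ≤ x → -c₁ ≤ ∑ p ∈ primesIoc w x, (‖g p‖ - c) / (p : ℝ)) →
      ∀ T : ℝ, 0 < T → ∀ u : ℝ, 1 ≤ u → u ≤ x →
        ‖summatory (expMul g) u‖ ≤ C * (u * (1 + Real.log (x / u)) ^ (1 + c * β / (c + β)) *
          (Real.exp (primeMass g 0 x) / Real.log x *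
            (Real.exp (-(pretentiousMin g Y x T * c / (c + β))) + T ^ (-(1 / 2) : ℝ)))) := by
  obtain ⟨C₀, V₀, hC₀, hV₀, h₀⟩ := exists_norm_summatory_expMul_le_of_large hβ hc hc₁
  obtain ⟨C₁, hC₁, h₁⟩ := exists_primeMass_bounds hβ hc hc₁
  set κ := Real.exp (-((β * V₀ + C₁) * c / (c + β))) with hκ
  have hκ0 : 0 < κ := Real.exp_pos _
  refine ⟨C₀ + (2 * β + 1) * (1 + 1 / κ), by positivity,
    fun g hg Y x hY hYx hlow T hT u hu hux => ?_⟩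
  set lam := pretentiousMin g Y x T with hlam
  have hleast := isLeast_pretentiousMin g Y x hT.le
  set θ := c * β / (c + β) with hθ
  have hθ0 : 0 < θ := by positivity
  have hL0 : 0 < Real.log x := Real.log_pos (by linarith)
  have hlw : 0 ≤ Real.log (x / u) := Real.log_nonneg (by rwa [le_div_iff₀ (by linarith), one_mul])
  set τ := T ^ (-(1 / 2) : ℝ) with hτ
  have hτ0 : 0 < τ := Real.rpow_pos_of_pos hT _
  set E := Real.exp (-(lam * c / (c + β))) with hE
  have hE0 : 0 < E := Real.exp_pos _
  set Q := u * (1 + Real.log (x / u)) ^ (1 + θ) * (Real.exp (primeMass g 0 x) / Real.log x) with hQ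
  have hQ0 : 0 ≤ Q := by positivity
  have htriv : ‖summatory (expMul g) u‖ ≤ (2 * β + 1) * Q := by
    have h := norm_summatory_expMul_mul_log_le hg hu hux
    rw [← le_div_iff₀ hL0] at h
    refine h.trans ?_
    rw [hQ, mul_div_assoc, mul_div_assoc]
    have : 1 + Real.log (x / u) ≤ (1 + Real.log (x / u)) ^ (1 + θ) :=
      Real.self_le_rpow_of_one_le (by linarith) (by linarith)
    gcongr
  -- When the bracket E + τ is bounded below the elementary estimate suffices. This covers T < 1,
  -- where τ ≥ 1, and bounded log x/log Y, where λ is bounded and E ≥ κ.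
  have hsmall : 1 ≤ (1 + 1 / κ) * (E + τ) → ‖summatory (expMul g) u‖
      ≤ (C₀ + (2 * β + 1) * (1 + 1 / κ)) * (Q * (E + τ)) := by
    intro h
    have h1 : 0 ≤ C₀ * (Q * (E + τ)) := by positivity
    have h2 : (2 * β + 1) * Q * 1 ≤ (2 * β + 1) * Q * ((1 + 1 / κ) * (E + τ)) := by gcongr
    nlinarith
  rw [show ∀ a b d : ℝ, a * (b * d) = a * b * d from fun a b d => (mul_assoc a b d).symm]
  rw [mul_assoc, ← mul_assoc (u * _), ← hQ]
  rcases lt_or_ge T 1 with hT1 | hT1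
  · refine hsmall ?_
    have : 1 ≤ τ := Real.one_le_rpow_of_pos_of_le_one_of_nonpos hT hT1.le (by norm_num)
    have h2 : 0 < 1 / κ * (E + τ) := by positivity
    nlinarith
  · have H : HalaszHyp β c c₁ g Y x T lam :=
      { norm_le := hg
        le_Y := hY
        Y_le := hYx
        lower := hlow
        one_le_T := hT1
        lam_nonneg := by
          obtain ⟨t, -, ht⟩ := hleast.1
          rw [hlam, ← ht]
          refine Finset.sum_nonneg fun p hp => div_nonneg ?_ p.cast_nonneg
          have hp0 : (0 : ℝ) < p := by exact_mod_cast (prime_of_mem_primesIoc hp).pos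
          have h1 := Complex.re_le_norm (g p * (p : ℂ) ^ ((t : ℂ) * Complex.I))
          rw [norm_mul, ← Complex.ofReal_natCast, Complex.norm_cpow_eq_rpow_re_of_pos hp0] at h1
          simp only [Complex.mul_re, Complex.ofReal_re, Complex.I_re, mul_zero,
            Complex.ofReal_im, Complex.I_im, mul_one, sub_self, Real.rpow_zero] at h1
          simp only [Complex.mul_re, Complex.ofReal_natCast] at h1 ⊢
          linarith
        lam_le := fun t ht => hleast.2 ⟨t, ht, rfl⟩ }
    rcases lt_or_ge (Real.log (Real.log x / Real.log Y)) V₀ with hV | hV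
    · refine hsmall ?_
      have hκE : κ ≤ E := by
        rw [hκ, hE]
        refine Real.exp_le_exp.2 (neg_le_neg ?_)
        have := (h₁ g Y x T lam H).1
        gcongr
        refine this.trans ?_
        gcongr
      have h1 : 1 ≤ 1 / κ * E := by
        rw [one_div_mul_eq_div, le_div_iff₀ hκ0]; linarith
      have h2 : 0 < E + τ + 1 / κ * τ := by positivity
      nlinarith
    · have := h₀ g Y x T lam H hV u hu hux
      refine this.trans ?_
      have e : u * (1 + Real.log (x / u)) ^ (1 + θ) *
          (Real.exp (primeMass g 0 x) / Real.log x * (E + τ)) = Q * (E + τ) := by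
        rw [hQ]; ring
      rw [e]
      gcongr
      have : 0 < (2 * β + 1) * (1 + 1 / κ) := by positivity
      linarith


/-! ### The convolution quotient h of g by f, in weighted mean. -/

theorem arithmeticFunction_mul_apply_prime_pow {R : Type*} [CommSemiring R]
    (f g : ArithmeticFunction R) {p : ℕ} (hp : p.Prime) (k : ℕ) :
    (f * g) (p ^ k) = ∑ x ∈ Finset.HasAntidiagonal.antidiagonal k, f (p ^ x.1) * g (p ^ x.2) := by
  rw [ArithmeticFunction.mul_apply, ← Nat.map_div_right_divisors, Finset.sum_map,
    Nat.divisors_prime_pow hp, Finset.sum_map,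
    Finset.Nat.sum_antidiagonal_eq_sum_range_succ (fun i j => f (p ^ i) * g (p ^ j))]
  refine Finset.sum_congr rfl fun i hi => ?_
  change f (p ^ i) * g (p ^ k / p ^ i) = _
  rw [Nat.pow_div (Nat.lt_succ_iff.1 (Finset.mem_range.1 hi)) hp.pos]

/-- At each prime this is exp(a(p)z) exp(-a(p)z) = 1, that is, the binomial theorem for (a - a)^k.
It supplies the convolution inverse that defines h. -/
theorem expMul_mul_expMul_neg (a : ℕ → ℂ) : expMul a * expMul (fun p => -a p) = 1 := by
  rw [ArithmeticFunction.IsMultiplicative.eq_iff_eq_on_prime_powers _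
    ((isMultiplicative_expMul a).mul (isMultiplicative_expMul _)) _
    ArithmeticFunction.isMultiplicative_one]
  intro p k hp
  rw [arithmeticFunction_mul_apply_prime_pow _ _ hp]
  have h1 : ∑ x ∈ Finset.HasAntidiagonal.antidiagonal k, expMul a (p ^ x.1) * expMul (fun p => -a p) (p ^ x.2)
      = (a p + -a p) ^ k / (k.factorial : ℂ) := by
    rw [add_pow, ← Finset.Nat.sum_antidiagonal_eq_sum_range_succ
      (fun i j => a p ^ i * (-a p) ^ j * (k.choose i : ℂ)), Finset.sum_div]
    refine Finset.sum_congr rfl fun x hx => ?_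
    obtain rfl := Finset.HasAntidiagonal.mem_antidiagonal.1 hx
    rw [expMul_prime_pow _ hp, expMul_prime_pow _ hp, Nat.cast_add_choose]
    have h1 : ((x.1).factorial : ℂ) ≠ 0 := by exact_mod_cast (Nat.factorial_pos _).ne'
    have h2 : ((x.2).factorial : ℂ) ≠ 0 := by exact_mod_cast (Nat.factorial_pos _).ne'
    have h3 : ((x.1 + x.2).factorial : ℂ) ≠ 0 := by exact_mod_cast (Nat.factorial_pos _).ne'
    field_simp
  rw [h1, add_neg_cancel]
  rcases eq_or_ne k 0 with rfl | hk
  · simp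
  · rw [zero_pow hk, zero_div, ArithmeticFunction.one_apply_ne]
    exact fun h => hk ((Nat.pow_eq_one.1 h).resolve_left hp.ne_one)

/-- A finite Euler product bound for sums of nonnegative multiplicative functions. -/
theorem sum_factorization_prod_le {φ : ℕ → ℕ → ℝ} (h0 : ∀ p, φ p 0 = 1)
    (hφ : ∀ p k, 0 ≤ φ p k) (N : ℕ) :
    ∑ n ∈ Finset.Ioc 0 N, n.factorization.prod φ
      ≤ ∏ p ∈ Finset.range (N + 1) with p.Prime, ∑ k ∈ Finset.range (N + 1), φ p k := by
  -- Exponents are cut off at N so that no convergence is needed in the local factors; an n ≤ N has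
  -- all exponents below n, hence is unaffected.
  obtain ⟨ψ, hψ⟩ : ∃ ψ : ℕ → ℕ → ℝ, ∀ p k, ψ p k = if k ≤ N then φ p k else 0 :=
    ⟨_, fun p k => rfl⟩
  have hψ0 : ∀ p, ψ p 0 = 1 := fun p => by simp [hψ, h0]
  have hψn : ∀ p k, 0 ≤ ψ p k := fun p k => by
    rw [hψ]; split_ifs
    exacts [hφ p k, le_rfl]
  obtain ⟨H, hH⟩ : ∃ H : ℕ → ℝ, ∀ n, H n = if n = 0 then 0 else n.factorization.prod ψ :=
    ⟨_, fun n => rfl⟩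
  have hHn : ∀ n, 0 ≤ H n := fun n => by
    rw [hH]; split_ifs
    exacts [le_rfl, Finset.prod_nonneg fun p _ => hψn _ _]
  have hH1 : H 1 = 1 := by simp [hH]
  have hmul : ∀ {m n : ℕ}, m.Coprime n → H (m * n) = H m * H n := by
    intro m n hmn
    rcases eq_or_ne m 0 with rfl | hm
    · simp [hH]
    rcases eq_or_ne n 0 with rfl | hn
    · simp [hH]
    simp only [hH, hm, hn, mul_ne_zero hm hn, if_false]
    rw [Nat.factorization_mul_of_coprime hmn, Finsupp.prod_add_index_of_disjoint]
    simpa using hmn.disjoint_primeFactors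
  have hpow : ∀ {p : ℕ}, p.Prime → ∀ k, H (p ^ k) = ψ p k := by
    intro p hp k
    simp only [hH, pow_ne_zero k hp.ne_zero, if_false]
    rw [hp.factorization_pow, Finsupp.prod_single_index (hψ0 p)]
  have hfin : ∀ p : ℕ, ∀ k ∉ Finset.range (N + 1), ψ p k = 0 := by
    intro p k hk
    simp only [Finset.mem_range, not_lt] at hk
    rw [hψ, if_neg (by omega)]
  have h := EulerProduct.summable_and_hasSum_factoredNumbers_prod_filter_prime_tsum
    (f := H) hH1 hmul (fun {p} hp => by
      simp_rw [hpow hp]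
      exact summable_of_ne_finset_zero (s := Finset.range (N + 1))
        fun k hk => by rw [hfin p k hk, norm_zero]) (Finset.range (N + 1))
  have hsum := hasSum_subtype_iff_indicator.1 h.2
  have hprod : ∏ p ∈ Finset.range (N + 1) with p.Prime, ∑' k, H (p ^ k)
      = ∏ p ∈ Finset.range (N + 1) with p.Prime, ∑ k ∈ Finset.range (N + 1), φ p k := by
    refine Finset.prod_congr rfl fun p hp => ?_
    simp_rw [hpow (Finset.mem_filter.1 hp).2]
    rw [tsum_eq_sum (hfin p)]
    refine Finset.sum_congr rfl fun k hk => ?_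
    rw [hψ, if_pos (Nat.lt_succ_iff.1 (Finset.mem_range.1 hk))]
  rw [hprod] at hsum
  refine le_trans (le_of_eq ?_) (sum_le_hasSum (Finset.Ioc 0 N)
    (fun n _ => Set.indicator_nonneg (fun n _ => hHn n) n) hsum)
  refine Finset.sum_congr rfl fun n hn => ?_
  obtain ⟨hn0, hnN⟩ := Finset.mem_Ioc.1 hn
  rw [Set.indicator_of_mem]
  · simp only [hH, hn0.ne', if_false]
    refine Finset.prod_congr rfl fun p _ => ?_
    rw [hψ, if_pos ((Nat.factorization_lt p hn0.ne').le.trans hnN)]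
  · rw [Nat.mem_factoredNumbers_iff_primeFactors_subset]
    refine ⟨hn0.ne', fun p hp => Finset.mem_range.2 ?_⟩
    have := Nat.le_of_dvd hn0 (Nat.dvd_of_mem_primeFactors hp)
    omega

theorem one_add_log_prod_rpow_le {γ : ℝ} (hγ : 0 ≤ γ) (s : Finset ℕ) (m : ℕ → ℕ)
    (hm : ∀ i ∈ s, 1 ≤ m i) :
    (1 + Real.log ((∏ i ∈ s, m i : ℕ) : ℝ)) ^ γ ≤ ∏ i ∈ s, (1 + Real.log (m i)) ^ γ := by
  classical
  induction s using Finset.induction_on with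
  | empty => simp
  | insert i s hi ih =>
    have h1 : 1 ≤ m i := hm i (Finset.mem_insert_self _ _)
    have hs : ∀ j ∈ s, 1 ≤ m j := fun j hj => hm j (Finset.mem_insert_of_mem hj)
    have h2 : 1 ≤ ∏ j ∈ s, m j := Finset.one_le_prod' hs
    rw [Finset.prod_insert hi, Finset.prod_insert hi, Nat.cast_mul]
    refine (one_add_log_mul_rpow_le hγ (by exact_mod_cast h1) (by exact_mod_cast h2)).trans ?_
    exact mul_le_mul_of_nonneg_left (ih hs)
      (Real.rpow_nonneg (by linarith [Real.log_natCast_nonneg (m i)]) _)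

/-- The logarithmic weight is only submultiplicative; replacing it by the product of its values at
prime powers gives a multiplicative majorant. -/
theorem norm_mul_rpow_div_le_factorization_prod {h : ArithmeticFunction ℂ}
    (hh : h.IsMultiplicative) {γ : ℝ} (hγ : 0 ≤ γ) {n : ℕ} (hn : n ≠ 0) :
    ‖h n‖ * (1 + Real.log n) ^ γ / n ≤ n.factorization.prod fun p k =>
      ‖h (p ^ k)‖ * (1 + Real.log ((p ^ k : ℕ) : ℝ)) ^ γ / ((p ^ k : ℕ) : ℝ) := by
  have e1 : n = ∏ p ∈ n.factorization.support, p ^ n.factorization p :=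
    (Nat.prod_factorization_pow_eq_self hn).symm
  have e2 : ‖h n‖ = ∏ p ∈ n.factorization.support, ‖h (p ^ n.factorization p)‖ := by
    rw [hh.multiplicative_factorization h hn, Finsupp.prod, norm_prod]
  have e3 : (1 + Real.log n) ^ γ ≤ ∏ p ∈ n.factorization.support,
      (1 + Real.log ((p ^ n.factorization p : ℕ) : ℝ)) ^ γ := by
    conv_lhs => rw [e1]
    refine one_add_log_prod_rpow_le hγ _ _ fun p hp => Nat.one_le_pow _ _ ?_
    rw [Nat.support_factorization] at hp
    exact (Nat.prime_of_mem_primeFactors hp).pos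
  have e4 : (n : ℝ) = ∏ p ∈ n.factorization.support, ((p ^ n.factorization p : ℕ) : ℝ) := by
    conv_lhs => rw [e1]
    push_cast
    rfl
  rw [Finsupp.prod, Finset.prod_div_distrib, Finset.prod_mul_distrib, ← e2, ← e4]
  gcongr


/-- The exponent 1/4 is chosen so that two such factors divided by p² leave the summable p^{-3/2}.
-/
theorem one_add_log_rpow_le {γ : ℝ} (hγ : 0 < γ) {t : ℝ} (ht : 1 ≤ t) :
    (1 + Real.log t) ^ γ ≤ (1 + 4 * γ) ^ γ * t ^ (1 / 4 : ℝ) := by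
  have h1 := Real.log_le_rpow_div (by linarith : 0 ≤ t) (by positivity : 0 < 1 / (4 * γ))
  have h2 : 1 ≤ t ^ (1 / (4 * γ)) := Real.one_le_rpow ht (by positivity)
  have h3 : 1 + Real.log t ≤ (1 + 4 * γ) * t ^ (1 / (4 * γ)) := by
    rw [div_div_eq_mul_div, div_one] at h1
    nlinarith
  have h4 : (t ^ (1 / (4 * γ))) ^ γ = t ^ (1 / 4 : ℝ) := by
    rw [← Real.rpow_mul (by linarith)]
    congr 1
    field_simp
  rw [← h4, ← Real.mul_rpow (by positivity) (by positivity)]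
  exact Real.rpow_le_rpow (by linarith [Real.log_nonneg ht]) h3 hγ.le

theorem one_add_log_pow_rpow_le {γ : ℝ} (hγ : 0 ≤ γ) (p j : ℕ) :
    (1 + Real.log ((p ^ j : ℕ) : ℝ)) ^ γ ≤ Real.exp γ ^ j * (1 + Real.log p) ^ γ := by
  have hl := Real.log_natCast_nonneg p
  have h1 : 1 + Real.log ((p ^ j : ℕ) : ℝ) ≤ Real.exp j * (1 + Real.log p) := by
    push_cast
    rw [Real.log_pow]
    have := Real.add_one_le_exp (j : ℝ)
    nlinarith [Nat.cast_nonneg (α := ℝ) j]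
  have h2 : Real.exp γ ^ j = Real.exp j ^ γ := by
    rw [← Real.exp_nat_mul, ← Real.exp_mul]
  rw [h2, ← Real.mul_rpow (Real.exp_pos _).le (by linarith)]
  exact Real.rpow_le_rpow (by linarith [Real.log_natCast_nonneg (p ^ j)]) h1 hγ

/-- Bounds for the local factor of the exponential. -/
theorem sum_exp_local_le {β γ : ℝ} (hβ : 0 ≤ β) (hγ : 0 ≤ γ) {p : ℕ} (hp : 1 ≤ p) (m M : ℕ) :
    ∑ j ∈ Finset.range M, β ^ (j + m) / ((j + m).factorial : ℝ) *
      (1 + Real.log ((p ^ (j + m) : ℕ) : ℝ)) ^ γ / ((p ^ (j + m) : ℕ) : ℝ)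
      ≤ Real.exp (β * Real.exp γ) * ((1 + Real.log p) ^ γ / (p : ℝ) ^ m) := by
  have hp1 : (1 : ℝ) ≤ p := by exact_mod_cast hp
  have hω : 0 ≤ (1 + Real.log p) ^ γ :=
    Real.rpow_nonneg (by linarith [Real.log_natCast_nonneg p]) _
  set b := β * Real.exp γ with hb
  have hb0 : 0 ≤ b := by positivity
  have hterm : ∀ j ∈ Finset.range M, β ^ (j + m) / ((j + m).factorial : ℝ) *
      (1 + Real.log ((p ^ (j + m) : ℕ) : ℝ)) ^ γ / ((p ^ (j + m) : ℕ) : ℝ)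
      ≤ b ^ (j + m) / ((j + m).factorial : ℝ) * ((1 + Real.log p) ^ γ / (p : ℝ) ^ m) := by
    intro j _
    have h1 := one_add_log_pow_rpow_le hγ p (j + m)
    have h2 : (p : ℝ) ^ m ≤ ((p ^ (j + m) : ℕ) : ℝ) := by
      push_cast
      exact pow_le_pow_right₀ hp1 (by omega)
    calc _ ≤ β ^ (j + m) / ((j + m).factorial : ℝ) *
          (Real.exp γ ^ (j + m) * (1 + Real.log p) ^ γ) / (p : ℝ) ^ m := by gcongr
      _ = _ := by rw [hb, mul_pow]; ring
  refine (Finset.sum_le_sum hterm).trans ?_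
  rw [← Finset.sum_mul]
  refine mul_le_mul_of_nonneg_right ?_ (by positivity)
  have h3 := Real.sum_le_exp_of_nonneg hb0 (M + m)
  refine le_trans ?_ h3
  rw [add_comm M m, Finset.sum_range_add]
  simp_rw [add_comm m]
  exact le_add_of_nonneg_left (Finset.sum_nonneg fun i _ => by positivity)

/-- Bound the truncated Cauchy product by the full product and remove the terms of degree 0 and 1.
What remains has i ≥ 2 with any j, or i ≤ 1 with j ≥ 2, or i = j = 1. -/
theorem sum_range_cauchy_product_tail_le {G E : ℕ → ℝ} (hG : ∀ i, 0 ≤ G i) (hE : ∀ i, 0 ≤ E i)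
    (hG0 : G 0 = 1) (hE0 : E 0 = 1) (M : ℕ) :
    ∑ k ∈ Finset.range M, ∑ x ∈ Finset.HasAntidiagonal.antidiagonal (k + 2), G x.1 * E x.2
      ≤ (∑ i ∈ Finset.range M, G (i + 2)) * (∑ j ∈ Finset.range (M + 2), E j)
        + (1 + G 1) * (∑ j ∈ Finset.range M, E (j + 2)) + G 1 * E 1 := by
  have h1 : ∑ k ∈ Finset.range (M + 2), ∑ x ∈ Finset.HasAntidiagonal.antidiagonal k, G x.1 * E x.2
      ≤ (∑ i ∈ Finset.range (M + 2), G i) * (∑ j ∈ Finset.range (M + 2), E j) := by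
    simp_rw [Finset.Nat.sum_antidiagonal_eq_sum_range_succ (fun i j => G i * E j)]
    rw [Finset.sum_range_diag_flip (M + 2) (fun i j => G i * E j), Finset.sum_mul]
    refine Finset.sum_le_sum fun i _ => ?_
    rw [Finset.mul_sum]
    exact Finset.sum_le_sum_of_subset_of_nonneg (Finset.range_mono (Nat.sub_le _ _))
      fun j _ _ => mul_nonneg (hG i) (hE j)
  rw [Finset.sum_range_succ', Finset.sum_range_succ', Finset.sum_range_succ' G,
    Finset.sum_range_succ' (fun i => G (i + 1))] at h1
  have hEsplit : ∑ j ∈ Finset.range (M + 2), E j = ∑ j ∈ Finset.range M, E (j + 2) + E 1 + 1 := by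
    rw [Finset.sum_range_succ', Finset.sum_range_succ', hE0]
  have e1 : ∑ x ∈ Finset.HasAntidiagonal.antidiagonal (0 + 1), G x.1 * E x.2 = E 1 + G 1 := by
    rw [Finset.Nat.sum_antidiagonal_eq_sum_range_succ (fun i j => G i * E j)]
    simp [Finset.sum_range_succ, hG0, hE0]
  have e0 : ∑ x ∈ Finset.HasAntidiagonal.antidiagonal 0, G x.1 * E x.2 = 1 := by
    simp [hG0, hE0]
  rw [e1, e0, hG0] at h1
  simp only [zero_add, add_assoc, Nat.reduceAdd] at h1 hEsplit ⊢
  have h2 : (G 1 + 1) * ∑ j ∈ Finset.range (M + 2), E j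
      = (1 + G 1) * ∑ j ∈ Finset.range M, E (j + 2) + G 1 * E 1 + (E 1 + (G 1 + 1)) := by
    rw [hEsplit]; ring
  rw [add_mul, h2] at h1
  linarith

theorem summable_nat_rpow_neg_three_halves : Summable fun n : ℕ => (n : ℝ) ^ (-(3 / 2) : ℝ) :=
  Real.summable_nat_rpow.2 (by norm_num)

/-- Unique factorization makes (p, i) ↦ p^(i+2) injective, so each higher prime power is counted at
most once. -/
theorem sum_prime_pow_le_tsum {φ : ℕ → ℝ} (hφ : ∀ n, 0 ≤ φ n)
    (hs : Summable fun q : higherPrimePowers => φ q) {S : Finset ℕ} (hS : ∀ p ∈ S, p.Prime)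
    (M : ℕ) :
    ∑ p ∈ S, ∑ i ∈ Finset.range M, φ (p ^ (i + 2)) ≤ ∑' q : higherPrimePowers, φ q := by
  classical
  have hinj : Set.InjOn (fun z : ℕ × ℕ => z.1 ^ (z.2 + 2)) (S ×ˢ Finset.range M : Finset (ℕ × ℕ)) := by
    rintro ⟨p, i⟩ hp ⟨q, j⟩ hq h
    simp only [Finset.coe_product, Set.mem_prod, Finset.mem_coe] at hp hq
    simp only at h
    have hpp := hS p hp.1
    have hqp := hS q hq.1
    have hpq : p = q := by
      have : p ∣ q ^ (j + 2) := h ▸ dvd_pow_self p (by omega)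
      exact (Nat.prime_dvd_prime_iff_eq hpp hqp).1 (hpp.dvd_of_dvd_pow this)
    subst hpq
    have := Nat.pow_right_injective hpp.two_le h
    simp only [Prod.mk.injEq, true_and]
    omega
  rw [← Finset.sum_product' S (Finset.range M) (fun p i => φ (p ^ (i + 2))),
    ← Finset.sum_image (f := φ) (g := fun z : ℕ × ℕ => z.1 ^ (z.2 + 2)) hinj, tsum_subtype]
  have hsum := summable_subtype_iff_indicator.1 hs
  refine le_trans (le_of_eq ?_) (hsum.sum_le_tsum
    (Finset.image (fun z : ℕ × ℕ => z.1 ^ (z.2 + 2)) (S ×ˢ Finset.range M))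
    (fun n _ => Set.indicator_nonneg (fun n _ => hφ n) n))
  refine Finset.sum_congr rfl fun n hn => ?_
  rw [Set.indicator_of_mem]
  obtain ⟨⟨p, i⟩, hz, rfl⟩ := Finset.mem_image.1 hn
  exact ⟨p, i + 2, hS p (Finset.mem_product.1 hz).1, by omega, rfl⟩


/-- Since h vanishes at p, the local factor departs from 1 only from p² on. There the terms with g
at exponent at least 2 are governed by the hypothesis on prime powers, and all others are
O(p^{-3/2}). -/
theorem sum_norm_quotient_local_le {β γ : ℝ} (hβ : 0 ≤ β) (hγ : 0 < γ) {g : ArithmeticFunction ℂ}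
    (hg : g.IsMultiplicative) {p : ℕ} (hp : p.Prime) (hgp : ‖g p‖ ≤ β) (M : ℕ) :
    ∑ k ∈ Finset.range (M + 2), ‖(g * expMul fun p => -g p) (p ^ k)‖ *
        (1 + Real.log ((p ^ k : ℕ) : ℝ)) ^ γ / ((p ^ k : ℕ) : ℝ)
      ≤ 1 + ((1 + Real.exp (β * Real.exp γ) * (1 + 4 * γ) ^ γ) *
          (∑ i ∈ Finset.range M, ‖g (p ^ (i + 2))‖ *
            (1 + Real.log ((p ^ (i + 2) : ℕ) : ℝ)) ^ γ / ((p ^ (i + 2) : ℕ) : ℝ))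
        + ((1 + β * (1 + 4 * γ) ^ γ) * Real.exp (β * Real.exp γ) + β ^ 2) *
          ((1 + 4 * γ) ^ γ) ^ 2 * (p : ℝ) ^ (-(3 / 2) : ℝ)) := by
  set h := g * expMul fun p => -g p with hh
  set K := (1 + 4 * γ) ^ γ with hK
  have hK0 : 0 < K := by positivity
  set b := Real.exp (β * Real.exp γ) with hb
  have hb0 : 0 < b := Real.exp_pos _
  set ω : ℕ → ℝ := fun n => (1 + Real.log (n : ℝ)) ^ γ with hω
  have hω1 : ∀ n, 1 ≤ ω n := fun n =>
    Real.one_le_rpow (by linarith [Real.log_natCast_nonneg n]) hγ.le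
  have hω0 : ∀ n, 0 ≤ ω n := fun n => by linarith [hω1 n]
  have hp1 : (1 : ℝ) ≤ p := by exact_mod_cast hp.one_le
  have hp0 : (0 : ℝ) < p := by linarith
  set G : ℕ → ℝ := fun i => ‖g (p ^ i)‖ * ω (p ^ i) / ((p ^ i : ℕ) : ℝ) with hG
  set E : ℕ → ℝ := fun j => β ^ j / (j.factorial : ℝ) * ω (p ^ j) / ((p ^ j : ℕ) : ℝ) with hE
  have hGn : ∀ i, 0 ≤ G i := fun i => by
    have := hω0 (p ^ i)
    positivity
  have hEn : ∀ i, 0 ≤ E i := fun i => by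
    have := hω0 (p ^ i)
    positivity
  have hG0 : G 0 = 1 := by simp [hG, hω, hg.1]
  have hE0 : E 0 = 1 := by simp [hE, hω]
  -- The two terms of the convolution at p are g(p) and -g(p).
  have hhp : h p = 0 := by
    have := arithmeticFunction_mul_apply_prime_pow g (expMul fun p => -g p) hp 1
    rw [pow_one] at this
    rw [hh, this, Finset.Nat.sum_antidiagonal_eq_sum_range_succ
      (fun i j => g (p ^ i) * expMul (fun p => -g p) (p ^ j))]
    simp only [expMul_prime_pow _ hp, Finset.sum_range_succ, Finset.sum_range_zero]
    simp [hg.1]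
  have hh1 : h 1 = 1 := (hg.mul (isMultiplicative_expMul _)).1
  have hterm : ∀ k, ‖h (p ^ k)‖ * ω (p ^ k) / ((p ^ k : ℕ) : ℝ)
      ≤ ∑ x ∈ Finset.HasAntidiagonal.antidiagonal k, G x.1 * E x.2 := by
    intro k
    rw [hh, arithmeticFunction_mul_apply_prime_pow _ _ hp]
    refine le_trans (div_le_div_of_nonneg_right (mul_le_mul_of_nonneg_right
      (norm_sum_le _ _) (hω0 _)) (Nat.cast_nonneg _)) ?_
    rw [Finset.sum_mul, Finset.sum_div]
    refine Finset.sum_le_sum fun x hx => ?_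
    obtain rfl := Finset.HasAntidiagonal.mem_antidiagonal.1 hx
    rw [expMul_prime_pow _ hp, norm_mul, norm_div, norm_pow, norm_neg, Complex.norm_natCast]
    have h1 : ω (p ^ (x.1 + x.2)) ≤ ω (p ^ x.1) * ω (p ^ x.2) := by
      have := one_add_log_mul_rpow_le (v := ((p ^ x.1 : ℕ) : ℝ)) (w := ((p ^ x.2 : ℕ) : ℝ)) hγ.le
        (by exact_mod_cast Nat.one_le_pow _ _ hp.pos) (by exact_mod_cast Nat.one_le_pow _ _ hp.pos)
      simp only [hω]
      rw [pow_add, Nat.cast_mul]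
      exact this
    have h2 := hω0 (p ^ x.1)
    have h3 := hω0 (p ^ x.2)
    calc ‖g (p ^ x.1)‖ * (‖g p‖ ^ x.2 / (x.2.factorial : ℝ)) * ω (p ^ (x.1 + x.2)) /
          ((p ^ (x.1 + x.2) : ℕ) : ℝ)
        ≤ ‖g (p ^ x.1)‖ * (β ^ x.2 / (x.2.factorial : ℝ)) * (ω (p ^ x.1) * ω (p ^ x.2)) /
          ((p ^ (x.1 + x.2) : ℕ) : ℝ) := by gcongr
      _ = G x.1 * E x.2 := by
          simp only [hG, hE]
          rw [pow_add, Nat.cast_mul]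
          field_simp
  have hsplit : ∑ k ∈ Finset.range (M + 2), ‖h (p ^ k)‖ * ω (p ^ k) / ((p ^ k : ℕ) : ℝ)
      = ∑ k ∈ Finset.range M, ‖h (p ^ (k + 2))‖ * ω (p ^ (k + 2)) / ((p ^ (k + 2) : ℕ) : ℝ)
        + 1 := by
    have e : ‖(1 : ℂ)‖ * ω 1 / ((1 : ℕ) : ℝ) = 1 := by simp [hω]
    rw [Finset.sum_range_succ', Finset.sum_range_succ', zero_add, pow_one, hhp, pow_zero, hh1, e,
      norm_zero, zero_mul, zero_div, add_zero]
  change ∑ k ∈ Finset.range (M + 2), ‖h (p ^ k)‖ * ω (p ^ k) / ((p ^ k : ℕ) : ℝ) ≤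
    1 + ((1 + b * K) * (∑ i ∈ Finset.range M, G (i + 2)) + _)
  rw [hsplit, add_comm]
  refine add_le_add le_rfl ?_
  refine (Finset.sum_le_sum fun k _ => hterm (k + 2)).trans ?_
  refine (sum_range_cauchy_product_tail_le hGn hEn hG0 hE0 M).trans ?_
  rw [add_assoc]
  set r := ω p / p with hr
  have hr0 : 0 ≤ r := div_nonneg (hω0 p) hp0.le
  have hωp : ω p ≤ K * (p : ℝ) ^ (1 / 4 : ℝ) := one_add_log_rpow_le hγ hp1
  have hrK : r ≤ K := by
    rw [hr, div_le_iff₀ hp0]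
    refine hωp.trans ?_
    gcongr
    calc (p : ℝ) ^ (1 / 4 : ℝ) ≤ (p : ℝ) ^ (1 : ℝ) :=
          Real.rpow_le_rpow_of_exponent_le hp1 (by norm_num)
      _ = p := Real.rpow_one _
  have hr2 : r ^ 2 ≤ K ^ 2 * (p : ℝ) ^ (-(3 / 2) : ℝ) := by
    have e : (p : ℝ) ^ (-(3 / 2) : ℝ) = ((p : ℝ) ^ (1 / 4 : ℝ)) ^ 2 / (p : ℝ) ^ 2 := by
      rw [← Real.rpow_natCast, ← Real.rpow_natCast, ← Real.rpow_mul hp0.le, ← Real.rpow_sub hp0]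
      norm_num
    rw [e, hr, div_pow, mul_div_assoc', ← mul_pow]
    have := hω0 p
    gcongr
  have hωr : ω p / (p : ℝ) ^ 2 ≤ r ^ 2 := by
    rw [hr, div_pow]
    gcongr
    nlinarith [hω1 p]
  have hG1 : G 1 ≤ β * r := by
    simp only [hG, pow_one]
    rw [mul_div_assoc]
    gcongr
  have hE1 : E 1 = β * r := by
    simp only [hE, pow_one, Nat.factorial_one, Nat.cast_one, div_one]
    rw [mul_div_assoc]
  have hE2 : ∑ j ∈ Finset.range M, E (j + 2) ≤ b * r ^ 2 :=
    (sum_exp_local_le hβ hγ.le hp.one_le 2 M).trans (by gcongr)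
  have hT0 : ∑ j ∈ Finset.range (M + 2), E j ≤ 1 + b * K := by
    rw [Finset.sum_range_succ', hE0, add_comm]
    gcongr
    refine (sum_exp_local_le hβ hγ.le hp.one_le 1 (M + 1)).trans ?_
    rw [pow_one]
    gcongr
  have hGs : 0 ≤ ∑ i ∈ Finset.range M, G (i + 2) := Finset.sum_nonneg fun i _ => hGn _
  refine add_le_add ?_ ?_
  · rw [mul_comm]
    gcongr
  · have hG1K : G 1 ≤ β * K := hG1.trans (by gcongr)
    have hEs : 0 ≤ ∑ j ∈ Finset.range M, E (j + 2) := Finset.sum_nonneg fun i _ => hEn _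
    calc (1 + G 1) * ∑ j ∈ Finset.range M, E (j + 2) + G 1 * E 1
        ≤ (1 + β * K) * (b * r ^ 2) + β * r * (β * r) := by
          rw [hE1]
          gcongr
      _ = ((1 + β * K) * b + β ^ 2) * r ^ 2 := by ring
      _ ≤ ((1 + β * K) * b + β ^ 2) * (K ^ 2 * (p : ℝ) ^ (-(3 / 2) : ℝ)) := by gcongr
      _ = _ := by ring

/-- Each local factor is at most exp of its excess over 1, and the excesses sum to a constant
depending on β, γ and B. -/
theorem exists_sum_norm_quotient_le {β γ : ℝ} (hβ : 0 ≤ β) (hγ : 0 < γ) (B : ℝ) :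
    ∃ C : ℝ, 0 < C ∧ ∀ g : ArithmeticFunction ℂ, g.IsMultiplicative →
      (∀ p : ℕ, p.Prime → ‖g p‖ ≤ β) →
      Summable (fun q : higherPrimePowers =>
        ‖g (q : ℕ)‖ * ((q : ℕ) : ℝ)⁻¹ * Real.log ((q : ℕ) : ℝ) ^ γ) →
      ∑' q : higherPrimePowers, ‖g (q : ℕ)‖ * ((q : ℕ) : ℝ)⁻¹ * Real.log ((q : ℕ) : ℝ) ^ γ ≤ B →
      ∀ M : ℕ, ∑ d ∈ Finset.Ioc 0 (M + 1),
        ‖(g * expMul fun p => -g p) d‖ * (1 + Real.log d) ^ γ / d ≤ C := by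
  set K₀ := 1 + Real.exp (β * Real.exp γ) * (1 + 4 * γ) ^ γ with hK₀
  set K₁ := ((1 + β * (1 + 4 * γ) ^ γ) * Real.exp (β * Real.exp γ) + β ^ 2) *
    ((1 + 4 * γ) ^ γ) ^ 2 with hK₁
  have hK₀0 : 0 < K₀ := by positivity
  have hK₁0 : 0 < K₁ := by positivity
  refine ⟨Real.exp (K₀ * (2 ^ γ * B) + K₁ * ∑' n : ℕ, (n : ℝ) ^ (-(3 / 2) : ℝ)), Real.exp_pos _,
    fun g hg hgβ hs hB M => ?_⟩
  have hmul := hg.mul (isMultiplicative_expMul fun p => -g p)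
  refine (Finset.sum_le_sum fun d hd => norm_mul_rpow_div_le_factorization_prod hmul hγ.le
    (Finset.mem_Ioc.1 hd).1.ne').trans ?_
  refine (sum_factorization_prod_le (fun p => by simp [hmul.1]) (fun p k => by
    have : 0 ≤ (1 + Real.log ((p ^ k : ℕ) : ℝ)) ^ γ :=
      Real.rpow_nonneg (by linarith [Real.log_natCast_nonneg (p ^ k)]) _
    positivity) (M + 1)).trans ?_
  set S := (Finset.range (M + 1 + 1)).filter Nat.Prime with hS
  have hSp : ∀ p ∈ S, p.Prime := fun p hp => (Finset.mem_filter.1 hp).2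
  set ψ : ℕ → ℝ := fun n => ‖g n‖ * (n : ℝ)⁻¹ * Real.log n ^ γ with hψ
  have hψ0 : ∀ n, 0 ≤ ψ n := fun n => by
    have : 0 ≤ Real.log n ^ γ := Real.rpow_nonneg (Real.log_natCast_nonneg n) _
    positivity
  have hφψ : ∀ p ∈ S, ∀ i, ‖g (p ^ (i + 2))‖ * (1 + Real.log ((p ^ (i + 2) : ℕ) : ℝ)) ^ γ /
      ((p ^ (i + 2) : ℕ) : ℝ) ≤ 2 ^ γ * ψ (p ^ (i + 2)) := by
    intro p hp i
    have h4 : 4 ≤ p ^ (i + 2) := by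
      calc 4 = 2 ^ 2 := by norm_num
        _ ≤ p ^ 2 := Nat.pow_le_pow_left (hSp p hp).two_le 2
        _ ≤ p ^ (i + 2) := Nat.pow_le_pow_right (hSp p hp).pos (by omega)
    have hl : 1 ≤ Real.log ((p ^ (i + 2) : ℕ) : ℝ) := by
      rw [Real.le_log_iff_exp_le (by exact_mod_cast (by omega : 0 < p ^ (i + 2)))]
      have h5 : (4 : ℝ) ≤ ((p ^ (i + 2) : ℕ) : ℝ) := by exact_mod_cast h4
      linarith [Real.exp_one_lt_d9]
    -- A higher prime power is at least 4 > e, so 1 + log q ≤ 2 log q; this is the origin of 2^γ.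
    have h6 : (1 + Real.log ((p ^ (i + 2) : ℕ) : ℝ)) ^ γ
        ≤ 2 ^ γ * Real.log ((p ^ (i + 2) : ℕ) : ℝ) ^ γ := by
      rw [← Real.mul_rpow (by norm_num) (by linarith)]
      exact Real.rpow_le_rpow (by linarith) (by linarith) hγ.le
    simp only [hψ]
    calc _ ≤ ‖g (p ^ (i + 2))‖ * (2 ^ γ * Real.log ((p ^ (i + 2) : ℕ) : ℝ) ^ γ) /
          ((p ^ (i + 2) : ℕ) : ℝ) := by gcongr
      _ = _ := by rw [div_eq_mul_inv]; ring
  have hlocal : ∀ p ∈ S, ∑ k ∈ Finset.range (M + 1 + 1), ‖(g * expMul fun p => -g p) (p ^ k)‖ *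
        (1 + Real.log ((p ^ k : ℕ) : ℝ)) ^ γ / ((p ^ k : ℕ) : ℝ)
      ≤ Real.exp (K₀ * (2 ^ γ * ∑ i ∈ Finset.range M, ψ (p ^ (i + 2)))
        + K₁ * (p : ℝ) ^ (-(3 / 2) : ℝ)) := by
    intro p hp
    refine (sum_norm_quotient_local_le hβ hγ hg (hSp p hp) (hgβ p (hSp p hp)) M).trans ?_
    rw [add_comm]
    refine (Real.add_one_le_exp _).trans (Real.exp_le_exp.2 ?_)
    gcongr
    rw [Finset.mul_sum]
    exact Finset.sum_le_sum fun i _ => hφψ p hp i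
  refine (Finset.prod_le_prod (fun p _ => Finset.sum_nonneg fun k _ => ?_) hlocal).trans ?_
  · have : 0 ≤ (1 + Real.log ((p ^ k : ℕ) : ℝ)) ^ γ :=
      Real.rpow_nonneg (by linarith [Real.log_natCast_nonneg (p ^ k)]) _
    positivity
  rw [← Real.exp_sum, Finset.sum_add_distrib, ← Finset.mul_sum, ← Finset.mul_sum, ← Finset.mul_sum]
  refine Real.exp_le_exp.2 ?_
  have h1 := (sum_prime_pow_le_tsum hψ0 hs hSp M).trans hB
  have h2 := summable_nat_rpow_neg_three_halves.sum_le_tsum S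
    (fun n _ => Real.rpow_nonneg n.cast_nonneg _)
  gcongr

/-! ### Return to the product over primes and conclusion for g. -/

/-- Used at y = |g(p)|/p: the loss exp(y²) multiplies up to a constant, so exp(∑ |g(p)|/p) may be
replaced by ∏ (1 + |g(p)|/p). -/
theorem exp_le_one_add_mul_exp_sq {y : ℝ} (hy : 0 ≤ y) :
    Real.exp y ≤ (1 + y) * Real.exp (y ^ 2) := by
  have h : Real.exp (y - y ^ 2) ≤ 1 + y := by
    rcases le_or_gt y 1 with h1 | h1
    · have hz0 : 0 ≤ y - y ^ 2 := by nlinarith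
      have hz1 : |y - y ^ 2| ≤ 1 := by rw [abs_of_nonneg hz0]; nlinarith
      have h2 := (abs_le.1 (Real.abs_exp_sub_one_sub_id_le hz1)).2
      have h3 : (y - y ^ 2) ^ 2 ≤ y ^ 2 := pow_le_pow_left₀ hz0 (by nlinarith) 2
      linarith
    · have : Real.exp (y - y ^ 2) ≤ 1 := Real.exp_le_one_iff.2 (by nlinarith)
      linarith
  calc Real.exp y = Real.exp (y - y ^ 2) * Real.exp (y ^ 2) := by
        rw [← Real.exp_add]; ring_nf
    _ ≤ _ := by gcongr

theorem exists_exp_primeMass_le {β : ℝ} (hβ : 0 < β) :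
    ∃ C : ℝ, 0 < C ∧ ∀ g : ℕ → ℂ, (∀ p : ℕ, p.Prime → ‖g p‖ ≤ β) → ∀ x : ℝ,
      Real.exp (primeMass g 0 x) ≤ C * ∏ p ∈ primesIoc 0 x, (1 + ‖g p‖ / (p : ℝ)) := by
  refine ⟨Real.exp (β ^ 2 * ∑' n : ℕ, (n : ℝ) ^ (-(3 / 2) : ℝ)), Real.exp_pos _,
    fun g hg x => ?_⟩
  rw [primeMass, Real.exp_sum]
  refine (Finset.prod_le_prod (fun p _ => (Real.exp_pos _).le) fun p _ =>
    exp_le_one_add_mul_exp_sq (by positivity : 0 ≤ ‖g p‖ / (p : ℝ))).trans ?_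
  rw [Finset.prod_mul_distrib, mul_comm, ← Real.exp_sum]
  have hP : 0 ≤ ∏ p ∈ primesIoc 0 x, (1 + ‖g p‖ / (p : ℝ)) :=
    Finset.prod_nonneg fun p _ => by positivity
  gcongr
  refine le_trans ?_ (mul_le_mul_of_nonneg_left
    (summable_nat_rpow_neg_three_halves.sum_le_tsum (primesIoc 0 x)
      (fun n _ => Real.rpow_nonneg n.cast_nonneg _)) (by positivity))
  rw [Finset.mul_sum]
  refine Finset.sum_le_sum fun p hp => ?_
  have hpp := prime_of_mem_primesIoc hp
  have hp1 : (1 : ℝ) ≤ p := by exact_mod_cast hpp.one_le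
  have h1 : ((p : ℝ) ^ 2)⁻¹ ≤ (p : ℝ) ^ (-(3 / 2) : ℝ) := by
    rw [← Real.rpow_natCast, ← Real.rpow_neg (by linarith)]
    exact Real.rpow_le_rpow_of_exponent_le hp1 (by norm_num)
  rw [div_pow, div_eq_mul_inv]
  have := hg p hpp
  gcongr

theorem theorem2 (β c c₁ B : ℝ) (hβ : 0 < β) (hc : 0 < c) (hc₁ : 0 < c₁) :
    ∃ C : ℝ, 0 < C ∧
      ∀ g : ArithmeticFunction ℂ, g.IsMultiplicative →
      (∀ p : ℕ, p.Prime → ‖g p‖ ≤ β) →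
      Summable (fun q : higherPrimePowers =>
        ‖g (q : ℕ)‖ * ((q : ℕ) : ℝ)⁻¹ * Real.log ((q : ℕ) : ℝ) ^ (1 + c * β / (c + β))) →
      ∑' q : higherPrimePowers,
        ‖g (q : ℕ)‖ * ((q : ℕ) : ℝ)⁻¹ * Real.log ((q : ℕ) : ℝ) ^ (1 + c * β / (c + β)) ≤ B →
      ∀ Y x : ℝ, 3 / 2 ≤ Y → Y ≤ x →
      (∀ w : ℝ, Y ≤ w → w ≤ x → -c₁ ≤ ∑ p ∈ primesIoc w x, (‖g p‖ - c) / (p : ℝ)) →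
      ∀ T : ℝ, 0 < T →
        ‖∑ n ∈ Finset.Icc 1 ⌊x⌋₊, g n‖ ≤
          C * (x / Real.log x * (∏ p ∈ primesIoc 0 x, (1 + ‖g p‖ / (p : ℝ))) *
            (Real.exp (-(pretentiousMin g Y x T * c / (c + β))) + T ^ (-(1 / 2) : ℝ))) := by
  have hγ : 0 < 1 + c * β / (c + β) := by positivity
  obtain ⟨C₀, hC₀, h₀⟩ := exists_norm_summatory_expMul_le hβ hc hc₁
  obtain ⟨C₁, hC₁, h₁⟩ := exists_sum_norm_quotient_le hβ.le hγ B
  obtain ⟨C₂, hC₂, h₂⟩ := exists_exp_primeMass_le hβ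
  refine ⟨C₀ * C₁ * C₂, by positivity, fun g hg hgβ hs hB Y x hY hYx hlow T hT => ?_⟩
  set γ := 1 + c * β / (c + β) with hγd
  have hx : 3 / 2 ≤ x := hY.trans hYx
  have hlx : 0 < Real.log x := Real.log_pos (by linarith)
  set Q := Real.exp (-(pretentiousMin g Y x T * c / (c + β))) + T ^ (-(1 / 2) : ℝ) with hQ
  have hQ0 : 0 < Q := by
    have := Real.rpow_pos_of_pos hT (-(1 / 2) : ℝ)
    positivity
  set h := g * expMul fun p => -g p with hh
  -- The sum of g is then ∑ h(d) S(x/d). Uniformity of the estimate for S in u = x/d ≤ x is what is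
  -- needed, and the weight (1 + log d)^γ it carries is absorbed by the weighted sum of |h|.
  have hgh : g = h * expMul g := by
    rw [hh, mul_assoc, mul_comm (expMul _) (expMul g), expMul_mul_expMul_neg, mul_one]
  have hsum : ∑ n ∈ Finset.Icc 1 ⌊x⌋₊, g n
      = summatory (fun d => h d * summatory (expMul g) (x / d)) x := by
    rw [← summatory_mul, ← hgh]
    rfl
  obtain ⟨M, hM⟩ : ∃ M, ⌊x⌋₊ = M + 1 := by
    refine Nat.exists_eq_succ_of_ne_zero (Nat.floor_pos.2 (by linarith)).ne'
  have hh₁ := h₁ g hg hgβ hs hB M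
  set R := Real.exp (primeMass g 0 x) / Real.log x * Q with hR
  have hR0 : 0 ≤ R := by positivity
  have hterm : ∀ d ∈ Finset.Ioc 0 ⌊x⌋₊, ‖h d * summatory (expMul g) (x / d)‖
      ≤ C₀ * x * R * (‖h d‖ * (1 + Real.log d) ^ γ / d) := by
    intro d hd
    obtain ⟨hd0, hdx⟩ := Finset.mem_Ioc.1 hd
    have hd1 : (1 : ℝ) ≤ d := by exact_mod_cast hd0
    have hdx' : (d : ℝ) ≤ x := (Nat.le_floor_iff (by linarith)).1 hdx
    have hb := h₀ g hgβ Y x hY hYx hlow T hT (x / d)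
      (by rwa [le_div_iff₀ (by linarith), one_mul]) (div_le_self (by linarith) hd1)
    have e : x / (x / d) = d := by field_simp
    rw [e] at hb
    rw [norm_mul]
    calc ‖h d‖ * ‖summatory (expMul g) (x / d)‖
        ≤ ‖h d‖ * (C₀ * (x / d * (1 + Real.log d) ^ γ * R)) := by gcongr
      _ = _ := by ring
  rw [hsum]
  refine (norm_sum_le _ _).trans ((Finset.sum_le_sum hterm).trans ?_)
  rw [← Finset.mul_sum, hM]
  have hP := h₂ g hgβ x
  have hx0 : 0 < x := by linarith
  calc C₀ * x * R * ∑ d ∈ Finset.Ioc 0 (M + 1), ‖h d‖ * (1 + Real.log d) ^ γ / d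
      ≤ C₀ * x * R * C₁ := by gcongr
    _ ≤ C₀ * x * ((C₂ * ∏ p ∈ primesIoc 0 x, (1 + ‖g p‖ / (p : ℝ))) / Real.log x * Q) * C₁ := by
        rw [hR]
        gcongr
    _ = _ := by ring
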